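/- **Setting.** Let $\mathcal H$ be a complex separable Hilbert space, $\Theta\subset\mathbb R^m$ an open convex set, and $\{\rho_\theta\}_{\theta\in\Theta}$ a family of density operators on $\mathcal H$ (positive, trace one). Write $\|A\|_1=\operatorname{tr}|A|$ and $\partial_i=\partial/\partial\theta^i$; derivatives of operators are taken in $\|\cdot\|_1$. Let $G_\theta$ ($\theta\in\Theta$) be real symmetric positive semidefinite $m\times m$ matrices. An *estimator* on $n$ copies is a pair $\mathcal E_n=\{M^n,T_n\}$ of a positive operator valued measure $M^n$ on the Borel sets of some $\mathbb R^{l_n}$ acting in $\mathcal H^{\otimes n}$ (an arbitrary collective measurement) and a measurable map $T_n:\mathbb R^{l_n}\to\mathbb R^m$. Put $\mathrm E_\theta[f]=\int f(\omega)\,\operatorname{tr}\rho_\theta^{\otimes n}M^n(d\omega)$ and $$\mathrm{MSE}_\theta[\mathcal E_n]_{ij}=\mathrm E_\theta\big[(T_n^i-\theta^i)(T_n^j-\theta^j)\big],\quad \mathrm V_\theta[\mathcal E_n]_{ij}=\mathrm E_\theta\big[(T_n^i-\mathrm E_\theta[T_n^i])(T_n^j-\mathrm E_\theta[T_n^j])\big],\quad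 B_\theta[\mathcal E_n]^i_j=\partial_j\mathrm E_\theta[T_n^i].$$ A sequence $\{\mathcal E_n\}_{n\ge1}$ is *asymptotically unbiased* if $\mathrm E_\theta[T_n]\to\theta$ and $B_\theta[\mathcal E_n]^i_j\to\delta^i_j$ for all $\theta\in\Theta$. An estimator $\mathcal E_n$ is *locally unbiased at* $\theta$ if $\mathrm E_\theta[T_n]=\theta$ and $B_\theta[\mathcal E_n]^i_j=\delta^i_j$. In both cases the partial derivatives are required to exist. **Conditions on an estimator $\mathcal E_n$, $n\ge1$.** * (E) There are constants $a_1\ge0$, $a_2>0$, $a_{4,n}\ge0$ and positive operators $\Diamond_{i,\theta}$ ($1\le i\le m$, $\theta\in\Theta$) with $\operatorname{tr}\Diamond_{i,\theta}\le a_1$ and $|\partial_i\rho_{\theta_0}|\le\Diamond_{i,\theta}$ for all $\theta_0\in\Theta$ such that $|\theta_0^i-\theta^i|<a_2$ and $\theta_0^j=\theta^j$ ($j\ne i$), such that for all $\theta\in\Theta$ and all $i$ $$\int\|T_n(\omega)-\theta\|\operatorname{tr}\Diamond^{(1)}_{i,\theta,n}M^n(d\omega)\le n a_1a_{4,n},\qquad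 \int\|T_n(\omega)-\theta\|^2\operatorname{tr}\rho_\theta^{\otimes n}M^n(d\omega)\le n a_{4,n}^2,$$ where $\Diamond^{(1)}_{i,\theta,n}=\Diamond_{i,\theta}\otimes\rho_\theta^{\otimes n-1}+\rho_\theta\otimes\Diamond_{i,\theta}\otimes\rho_\theta^{\otimes n-2}+\cdots+\rho_\theta^{\otimes n-1}\otimes\Diamond_{i,\theta}$. * (E') $T_n$ takes values in a bounded set. **Conditions on the model.** * (M.1) On $\Theta$ the derivatives $\partial_i\rho_\theta$ and $\partial_i\partial_j\rho_\theta$ exist, are locally uniformly continuous, and are bounded, all with respect to $\|\cdot\|_1$. * (M.2) For all $\theta\in\Theta$ and $i$ there is a Hermitian (possibly unbounded) operator $L_{\theta,i}$ with $\partial_i\rho_\theta=\tfrac12(L_{\theta,i}\rho_\theta+\rho_\theta L_{\theta,i})$ and $\operatorname{tr}\rho_\theta L_{\theta,i}^2<\infty$. For unbounded $L$ this means: $L$ is densely defined and symmetric, its domain contains the ranges of $\rho_\theta^{1/2}$ and $\rho_\theta$, $\langle x,\partial_i\rho_\theta\,y\rangle=\tfrac12(\langle x,L\rho_\theta y\rangle+\langle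 L\rho_\theta x,y\rangle)$ for all $x,y\in\mathcal H$, and $\operatorname{tr}\rho_\theta L^2$ is the squared Hilbert–Schmidt norm of $L\rho_\theta^{1/2}$. * (M.3) There is an asymptotically unbiased sequence of estimators $\tilde{\mathcal E}_n=\{\tilde M^n,\tilde T_n\}$, each satisfying (E), such that $\tilde M^n$ is the $n$-fold repetition of one measurement $\tilde M$ in $\mathcal H$ with data in $\mathbb R^l$, and such that for every $\theta\in\Theta$ there is $D_\theta$ with $\mathrm E_\theta\|\tilde T_n-\theta\|^4\le D_\theta/n^2$ for all $n\ge1$. Define the *asymptotic quantum Cramér–Rao type bound* $$C^Q_\theta=\inf\Big\{\limsup_{n\to\infty} n\operatorname{Tr}G_\theta\,\mathrm{MSE}_\theta[\mathcal E_n]\ ;\ \{\mathcal E_n\}_{n\ge1}\text{ asymptotically unbiased, each }\mathcal E_n\text{ satisfying (E)}\Big\}.$$ **Theorem.** Suppose (M.1), (M.2) and (M.3) hold. Then for every $\theta\in\Theta$ $$C^Q_\theta=\lim_{n\to\infty}\inf\big\{n\operatorname{Tr}G_\theta\mathrm V_\theta[\mathcal E_n]\,;\ \mathcal E_n\text{ on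 }n\text{ copies, locally unbiased at }\theta,\ \text{(E')}\big\}$$ $$\phantom{C^Q_\theta}=\lim_{n\to\infty}\inf\big\{n\operatorname{Tr}G_\theta\mathrm V_\theta[\mathcal E_n]\,;\ \mathcal E_n\text{ on }n\text{ copies, locally unbiased at }\theta,\ \text{(E)}\big\},$$ and in particular both limits exist (an infimum over the empty set being $+\infty$). -/

import Mathlib

open MeasureTheory Filter Topology
open scoped ENNReal NNReal InnerProductSpace

noncomputable section

namespace QEst

/-! ### Tensor powers of a Hilbert space

Throughout, `b` is a complete orthonormal basis of the Hilbert space `H`, indexed by `ι`. -/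

/-- The Hilbert space tensor power `H ⊗ ⋯ ⊗ H` (`n` factors): the Hilbert space with complete
orthonormal basis `b (i 0) ⊗ ⋯ ⊗ b (i (n-1))`, `i : Fin n → ι`, that is, `ℓ²(Fin n → ι)`. -/
abbrev TensorPower (ι : Type*) (n : ℕ) : Type _ := lp (fun _ : Fin n → ι => ℂ) 2

/-- The product basis of the tensor power. -/
abbrev tensorBasis (ι : Type*) (n : ℕ) : HilbertBasis (Fin n → ι) ℂ (TensorPower ι n) :=
  HilbertBasis.ofRepr (LinearIsometryEquiv.refl ℂ _)

theorem l2_memlp_iff {κ : Type*} (f : κ → ℂ) :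
    Memℓp f 2 ↔ ∑' i, ‖f i‖ₑ ^ 2 ≠ ∞ := by
  rw [memℓp_gen_iff (by norm_num)]
  have : (fun i => ‖f i‖ ^ (2 : ℝ≥0∞).toReal) = fun i => ((‖f i‖₊ ^ 2 : ℝ≥0) : ℝ) := by
    ext i; simp
  rw [this, NNReal.summable_coe, ← ENNReal.tsum_coe_ne_top_iff_summable]
  simp [enorm_eq_nnnorm]

theorem l2_enorm_sq {κ : Type*} (f : lp (fun _ : κ => ℂ) 2) :
    ‖f‖ₑ ^ 2 = ∑' i, ‖f i‖ₑ ^ 2 := by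
  have h := lp.hasSum_norm (p := 2) (by norm_num) f
  have e : (fun i => ‖f i‖ ^ (2 : ℝ≥0∞).toReal) = fun i => ((‖f i‖₊ ^ 2 : ℝ≥0) : ℝ) := by
    ext i; simp
  have e2 : ‖f‖ ^ (2 : ℝ≥0∞).toReal = ((‖f‖₊ ^ 2 : ℝ≥0) : ℝ) := by simp
  rw [e, e2, NNReal.hasSum_coe, ← ENNReal.hasSum_coe] at h
  simpa [enorm_eq_nnnorm] using h.tsum_eq.symm

theorem basis_enorm_sq {ι H : Type*} [NormedAddCommGroup H] [InnerProductSpace ℂ H]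
    (b : HilbertBasis ι ℂ H) (x : H) :
    ‖x‖ₑ ^ 2 = ∑' i, ‖⟪b i, x⟫_ℂ‖ₑ ^ 2 := by
  have : ‖x‖ₑ = ‖b.repr x‖ₑ := by simp [enorm_eq_nnnorm]
  rw [this, l2_enorm_sq]
  simp [HilbertBasis.repr_apply_apply]

/-- The coordinates of `f` along the `k`-th index, the other indices being those of `i`. -/
def slice {ι : Type*} {n : ℕ} (k : Fin n) (f : TensorPower ι n) (i : Fin n → ι) :
    lp (fun _ : ι => ℂ) 2 :=
  ⟨fun j => f (Function.update i k j), (l2_memlp_iff _).2 (ne_top_of_le_ne_top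
    ((l2_memlp_iff _).1 (lp.memℓp f)) (ENNReal.tsum_comp_le_tsum_of_injective
      (Function.update_injective i k) (fun c => ‖f c‖ₑ ^ 2)))⟩

section Operators

variable {ι H : Type*} [NormedAddCommGroup H] [InnerProductSpace ℂ H]

theorem slot_bound (b : HilbertBasis ι ℂ H) {n : ℕ} (k : Fin n) (A : H →L[ℂ] H)
    (f : TensorPower ι n) :
    ∑' i : Fin n → ι, ‖⟪b (i k), A (b.repr.symm (slice k f i))⟫_ℂ‖ₑ ^ 2
      ≤ (‖A‖ₑ * ‖f‖ₑ) ^ 2 := by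
  classical
  let e := (Equiv.funSplitAt k ι).symm
  have hk : ∀ j r, e (j, r) k = j := fun j r => by simp [e, Equiv.funSplitAt, Equiv.piSplitAt]
  have hu : ∀ j j' r, Function.update (e (j, r)) k j' = e (j', r) := by
    intro j j' r
    ext x
    by_cases hx : x = k
    · subst hx; simp [hk]
    · simp [hx, e, Equiv.funSplitAt, Equiv.piSplitAt]
  have hsplit : ∀ F : (Fin n → ι) → ℝ≥0∞, ∑' i, F i = ∑' r, ∑' j, F (e (j, r)) := by
    intro F
    rw [← e.tsum_eq, ENNReal.tsum_prod', ENNReal.tsum_comm]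
  rw [hsplit, mul_pow, l2_enorm_sq f, hsplit, ← ENNReal.tsum_mul_left]
  refine ENNReal.tsum_le_tsum fun r => ?_
  rcases isEmpty_or_nonempty ι with h | ⟨⟨j₀⟩⟩
  · simp
  have hs : ∀ j, slice k f (e (j, r)) = slice k f (e (j₀, r)) := by
    intro j; ext c; simp [slice, hu]
  simp only [hs, hk]
  rw [← basis_enorm_sq b]
  have h1 : ‖A (b.repr.symm (slice k f (e (j₀, r))))‖ₑ ≤
      ‖A‖ₑ * ‖slice k f (e (j₀, r))‖ₑ := by
    refine (A.le_opENorm _).trans_eq ?_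
    congr 1
    simp [enorm_eq_nnnorm]
  refine (pow_le_pow_left' h1 2).trans_eq ?_
  rw [mul_pow, l2_enorm_sq]
  simp [slice, hu]

/-- The coordinates of `(1 ⊗ ⋯ ⊗ A ⊗ ⋯ ⊗ 1) f`, with `A` acting on the `k`-th factor. -/
def slotFun (b : HilbertBasis ι ℂ H) {n : ℕ} (k : Fin n) (A : H →L[ℂ] H)
    (f : TensorPower ι n) : TensorPower ι n :=
  ⟨fun i => ⟪b (i k), A (b.repr.symm (slice k f i))⟫_ℂ,
    (l2_memlp_iff _).2 (ne_top_of_le_ne_top (by finiteness) (slot_bound b k A f))⟩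

/-- The operator `1 ⊗ ⋯ ⊗ A ⊗ ⋯ ⊗ 1`, with `A` acting on the `k`-th factor. -/
def slotOp (b : HilbertBasis ι ℂ H) {n : ℕ} (k : Fin n) (A : H →L[ℂ] H) :
    TensorPower ι n →L[ℂ] TensorPower ι n :=
  LinearMap.mkContinuous
    { toFun := slotFun b k A
      map_add' := by
        intro f g
        ext i
        have : slice k (f + g) i = slice k f i + slice k g i := by ext j; rfl
        rw [lp.coeFn_add, Pi.add_apply]
        simp only [slotFun, this, map_add, inner_add_right]
      map_smul' := by
        intro c f
        ext i
        have : slice k (c • f) i = c • slice k f i := by ext j; rfl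
        rw [RingHom.id_apply, lp.coeFn_smul, Pi.smul_apply]
        simp only [slotFun, this, map_smul, inner_smul_right, smul_eq_mul] }
    ‖A‖ (by
      intro f
      have h2 : ‖slotFun b k A f‖ₑ ^ 2 ≤ (‖A‖ₑ * ‖f‖ₑ) ^ 2 := by
        rw [l2_enorm_sq]; exact slot_bound b k A f
      have h3 := (ENNReal.pow_le_pow_left_iff two_ne_zero).1 h2
      simp only [enorm_eq_nnnorm] at h3
      exact_mod_cast h3)

/-- The operator `A 0 ⊗ A 1 ⊗ ⋯ ⊗ A (n-1)`. -/
def tensorOp (b : HilbertBasis ι ℂ H) {n : ℕ} (A : Fin n → H →L[ℂ] H) :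
    TensorPower ι n →L[ℂ] TensorPower ι n :=
  ((List.finRange n).map fun k => slotOp b k (A k)).prod

theorem tprod_sum (b : HilbertBasis ι ℂ H) {n : ℕ} (v : Fin n → H) :
    ∑' i : Fin n → ι, ‖∏ k, ⟪b (i k), v k⟫_ℂ‖ₑ ^ 2 = ∏ k, ‖v k‖ₑ ^ 2 := by
  induction n with
  | zero => simp
  | succ n ih =>
    rw [← (Fin.consEquiv (fun _ => ι)).tsum_eq, ENNReal.tsum_prod', Fin.prod_univ_succ,
      ← ih (fun k => v k.succ), basis_enorm_sq b, ← ENNReal.tsum_mul_right]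
    refine tsum_congr fun j => ?_
    rw [← ENNReal.tsum_mul_left]
    refine tsum_congr fun r => ?_
    simp [Fin.consEquiv, Fin.prod_univ_succ, mul_pow]

/-- The product vector `v 0 ⊗ ⋯ ⊗ v (n-1)`. -/
def tprod (b : HilbertBasis ι ℂ H) {n : ℕ} (v : Fin n → H) : TensorPower ι n :=
  ⟨fun i => ∏ k, ⟪b (i k), v k⟫_ℂ, (l2_memlp_iff _).2 (by
    rw [tprod_sum]
    exact ENNReal.prod_ne_top fun k _ => by finiteness)⟩

theorem slotOp_tprod (b : HilbertBasis ι ℂ H) {n : ℕ} (k : Fin n) (A : H →L[ℂ] H)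
    (v : Fin n → H) :
    slotOp b k A (tprod b v) = tprod b (Function.update v k (A (v k))) := by
  ext i
  have key : slice k (tprod b v) i = (∏ j ∈ Finset.univ.erase k, ⟪b (i j), v j⟫_ℂ) •
      b.repr (v k) := by
    ext j
    simp only [slice, tprod, lp.coeFn_smul, Pi.smul_apply, smul_eq_mul,
      HilbertBasis.repr_apply_apply]
    rw [← Finset.mul_prod_erase _ _ (Finset.mem_univ k), mul_comm]
    congr 1
    · refine Finset.prod_congr rfl fun c hc => ?_
      rw [Function.update_of_ne (Finset.ne_of_mem_erase hc)]
    · simp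
  change ⟪b (i k), A (b.repr.symm (slice k (tprod b v) i))⟫_ℂ =
    ∏ j, ⟪b (i j), Function.update v k (A (v k)) j⟫_ℂ
  rw [key, ← Finset.mul_prod_erase _ _ (Finset.mem_univ k)]
  simp only [map_smul, LinearIsometryEquiv.symm_apply_apply, inner_smul_right,
    Function.update_self]
  rw [mul_comm]
  congr 1
  refine Finset.prod_congr rfl fun c hc => ?_
  rw [Function.update_of_ne (Finset.ne_of_mem_erase hc)]

/-- `tensorOp` is the tensor product of operators: `(⨂ A k) (⨂ v k) = ⨂ (A k (v k))`. -/
theorem tensorOp_tprod (b : HilbertBasis ι ℂ H) {n : ℕ} (A : Fin n → H →L[ℂ] H)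
    (v : Fin n → H) :
    tensorOp b A (tprod b v) = tprod b (fun k => A k (v k)) := by
  have key : ∀ l : List (Fin n), l.Nodup →
      (l.map fun k => slotOp b k (A k)).prod (tprod b v) =
        tprod b (fun k => if k ∈ l then A k (v k) else v k) := by
    intro l
    induction l with
    | nil => intro _; simp
    | cons a l ih =>
      intro hl
      rw [List.nodup_cons] at hl
      rw [List.map_cons, List.prod_cons, mul_apply_eq_comp, ih hl.2, slotOp_tprod]
      congr 1
      ext k
      by_cases hk : k = a
      · subst hk; simp [hl.1]
      · simp [hk]
  rw [tensorOp, key _ (List.nodup_finRange n)]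
  simp

end Operators

/-! ### Trace, trace norm, states -/

section Trace

variable {ι H : Type*} [NormedAddCommGroup H] [InnerProductSpace ℂ H] [CompleteSpace H]

/-- The trace of a positive operator, a number in `[0, ∞]`. -/
def traceE (b : HilbertBasis ι ℂ H) (P : H →L[ℂ] H) : ℝ≥0∞ :=
  ∑' i, ENNReal.ofReal (⟪b i, P (b i)⟫_ℂ).re

/-- The trace norm `‖A‖₁ = tr |A|`. -/
def traceNorm (b : HilbertBasis ι ℂ H) (A : H →L[ℂ] H) : ℝ≥0∞ := traceE b (CFC.abs A)

/-- Density operators. -/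
def IsDensity (b : HilbertBasis ι ℂ H) (σ : H →L[ℂ] H) : Prop := 0 ≤ σ ∧ traceE b σ = 1

end Trace

/-! ### Measurements -/

/-- Positive operator valued measures on `X` acting in `K`; `σ`-additivity is in the weak operator
topology. The values at non-measurable sets are irrelevant. -/
structure POVM (X : Type*) [MeasurableSpace X] (K : Type*) [NormedAddCommGroup K]
    [InnerProductSpace ℂ K] [CompleteSpace K] where
  /-- the operator `M(Δ)` -/
  op : Set X → K →L[ℂ] K
  pos : ∀ Δ, MeasurableSet Δ → 0 ≤ op Δ
  univ : op Set.univ = 1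
  iUnion : ∀ Δ : ℕ → Set X, (∀ k, MeasurableSet (Δ k)) → Pairwise (Function.onFun Disjoint Δ) →
    ∀ φ ψ : K, HasSum (fun k => ⟪φ, op (Δ k) ψ⟫_ℂ) ⟪φ, op (⋃ k, Δ k) ψ⟫_ℂ

namespace POVM

variable {X : Type*} [MeasurableSpace X] {K : Type*} [NormedAddCommGroup K]
    [InnerProductSpace ℂ K] [CompleteSpace K]

theorem re_nonneg (M : POVM X K) {Δ : Set X} (h : MeasurableSet Δ) (φ : K) :
    0 ≤ (⟪φ, M.op Δ φ⟫_ℂ).re :=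
  ((ContinuousLinearMap.nonneg_iff_isPositive _).1 (M.pos Δ h)).re_inner_nonneg_right φ

/-- The measure `Δ ↦ ⟨φ, M(Δ) φ⟩`. -/
def vecMeasure (M : POVM X K) (φ : K) : Measure X :=
  Measure.ofMeasurable (fun Δ _ => ENNReal.ofReal (⟪φ, M.op Δ φ⟫_ℂ).re)
    (by
      have h := M.iUnion (fun _ => ∅) (fun _ => MeasurableSet.empty)
        (fun _ _ _ => by simp [Function.onFun]) φ φ
      have h0 : ⟪φ, M.op ∅ φ⟫_ℂ = 0 :=
        tendsto_nhds_unique tendsto_const_nhds h.summable.tendsto_atTop_zero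
      simp [h0])
    (by
      intro Δ hm hd
      have h := Complex.hasSum_re (M.iUnion Δ hm hd φ φ)
      rw [← h.tsum_eq, ENNReal.ofReal_tsum_of_nonneg (fun k => M.re_nonneg (hm k) φ) h.summable])

/-- For a positive trace class operator `τ` the measure `Δ ↦ tr τ M(Δ)`, computed in the form
`tr τ^{1/2} M(Δ) τ^{1/2} = ∑ i, ⟨τ^{1/2} b i, M(Δ) τ^{1/2} b i⟩`. If `τ` is a state, this is the
probability distribution of the outcome of the measurement. -/
def law {κ : Type*} (b : HilbertBasis κ ℂ K) (M : POVM X K) (τ : K →L[ℂ] K) : Measure X :=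
  Measure.sum fun i => M.vecMeasure (CFC.sqrt τ (b i))

end POVM

/-! ### Estimators -/

/-- An estimator of an `m`-dimensional parameter from `n` copies: a measurement in the `n`-th tensor
power with data in `ℝ^l`, and a measurable function `T` of the data. -/
structure Estimator (ι : Type*) (n m : ℕ) where
  /-- the number of real coordinates of the data -/
  l : ℕ
  /-- the measurement -/
  M : POVM (Fin l → ℝ) (TensorPower ι n)
  /-- the estimate as a function of the data -/
  T : (Fin l → ℝ) → EuclideanSpace ℝ (Fin m)
  measurable_T : Measurable T

section Model

variable {ι H : Type*} [NormedAddCommGroup H] [InnerProductSpace ℂ H]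

/-- The distribution of the data when each of the `n` systems is in the state `σ`. -/
def Estimator.law (b : HilbertBasis ι ℂ H) {n m : ℕ} (E : Estimator ι n m) (σ : H →L[ℂ] H) :
    Measure (Fin E.l → ℝ) :=
  E.M.law (tensorBasis ι n) (tensorOp b fun _ => σ)

/-- The expectation of the `i`-th component of the estimate. -/
def Estimator.mean (b : HilbertBasis ι ℂ H) {n m : ℕ} (E : Estimator ι n m) (σ : H →L[ℂ] H)
    (i : Fin m) : ℝ :=
  ∫ ω, E.T ω i ∂(E.law b σ)

/-- The mean square error matrix of the estimate about `θ`. -/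
def Estimator.mse (b : HilbertBasis ι ℂ H) {n m : ℕ} (E : Estimator ι n m) (σ : H →L[ℂ] H)
    (θ : EuclideanSpace ℝ (Fin m)) : Matrix (Fin m) (Fin m) ℝ :=
  Matrix.of fun i j => ∫ ω, (E.T ω i - θ i) * (E.T ω j - θ j) ∂(E.law b σ)

/-- The covariance matrix of the estimate. -/
def Estimator.cov (b : HilbertBasis ι ℂ H) {n m : ℕ} (E : Estimator ι n m) (σ : H →L[ℂ] H) :
    Matrix (Fin m) (Fin m) ℝ :=
  Matrix.of fun i j =>
    ∫ ω, (E.T ω i - E.mean b σ i) * (E.T ω j - E.mean b σ j) ∂(E.law b σ)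

variable {m : ℕ}

/-- `B i j = ∂_j E_θ[T^i]`, the partial derivatives being required to exist. -/
def HasBMatrix (b : HilbertBasis ι ℂ H) (ρ : EuclideanSpace ℝ (Fin m) → H →L[ℂ] H) {n : ℕ}
    (E : Estimator ι n m) (θ : EuclideanSpace ℝ (Fin m)) (B : Matrix (Fin m) (Fin m) ℝ) : Prop :=
  ∀ i j, HasDerivAt (fun t : ℝ => E.mean b (ρ (θ + t • EuclideanSpace.single j 1)) i) (B i j) 0

/-- Local unbiasedness at `θ`. -/
def LocallyUnbiased (b : HilbertBasis ι ℂ H) (ρ : EuclideanSpace ℝ (Fin m) → H →L[ℂ] H) {n : ℕ}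
    (E : Estimator ι n m) (θ : EuclideanSpace ℝ (Fin m)) : Prop :=
  (∀ i, E.mean b (ρ θ) i = θ i) ∧ HasBMatrix b ρ E θ 1

/-- Asymptotic unbiasedness of a sequence of estimators. -/
def AsympUnbiased (b : HilbertBasis ι ℂ H) (ρ : EuclideanSpace ℝ (Fin m) → H →L[ℂ] H)
    (Θ : Set (EuclideanSpace ℝ (Fin m))) (E : ∀ n, Estimator ι n m) : Prop :=
  ∀ θ ∈ Θ, (∀ i, Tendsto (fun n => (E n).mean b (ρ θ) i) atTop (𝓝 (θ i))) ∧
    ∃ B : ℕ → Matrix (Fin m) (Fin m) ℝ,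
      (∀ n ≥ 1, HasBMatrix b ρ (E n) θ (B n)) ∧ Tendsto B atTop (𝓝 1)

/-- `M'` is the `n` times repetition of the measurement `M` with data in `ℝ^l`: the data
`ω ∈ ℝ^{nl}` consist of the `n` blocks `j ↦ ω (k, j)`, one for each of the `n` systems. -/
def IsRepetition [CompleteSpace H] (b : HilbertBasis ι ℂ H) {l n : ℕ} (M : POVM (Fin l → ℝ) H)
    (M' : POVM (Fin (n * l) → ℝ) (TensorPower ι n)) : Prop :=
  ∀ Δ : Fin n → Set (Fin l → ℝ), (∀ k, MeasurableSet (Δ k)) →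
    M'.op {ω | ∀ k, (fun j => ω (finProdFinEquiv (k, j))) ∈ Δ k} = tensorOp b fun k => M.op (Δ k)

variable [CompleteSpace H]

/-! ### Regularity conditions on the model -/

/-- `D = ∂_i ρ_θ`, the difference quotients converging in trace norm. -/
def HasTraceDeriv (b : HilbertBasis ι ℂ H) (ρ : EuclideanSpace ℝ (Fin m) → H →L[ℂ] H)
    (i : Fin m) (θ : EuclideanSpace ℝ (Fin m)) (D : H →L[ℂ] H) : Prop :=
  Tendsto (fun t : ℝ => traceNorm b (t⁻¹ • (ρ (θ + t • EuclideanSpace.single i 1) - ρ θ) - D))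
    (𝓝[≠] 0) (𝓝 0)

open Classical in
/-- The trace norm partial derivative `∂_i ρ_θ` (`0` where it does not exist). -/
def traceDeriv (b : HilbertBasis ι ℂ H) (ρ : EuclideanSpace ℝ (Fin m) → H →L[ℂ] H)
    (i : Fin m) (θ : EuclideanSpace ℝ (Fin m)) : H →L[ℂ] H :=
  if h : ∃ D, HasTraceDeriv b ρ i θ D then h.choose else 0

/-- Local uniform continuity on `Θ` with respect to the trace norm. -/
def LocUnifContOn (b : HilbertBasis ι ℂ H) (f : EuclideanSpace ℝ (Fin m) → H →L[ℂ] H)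
    (Θ : Set (EuclideanSpace ℝ (Fin m))) : Prop :=
  ∀ θ₀ ∈ Θ, ∃ r > 0, ∀ ε > 0, ∃ δ > 0, ∀ θ ∈ Θ ∩ Metric.ball θ₀ r,
    ∀ θ' ∈ Θ ∩ Metric.ball θ₀ r, dist θ θ' < δ → traceNorm b (f θ - f θ') < ε

/-- Smoothness of the model: in trace norm, the first and second partial derivatives exist, are
locally uniformly continuous, and are bounded. -/
structure CondM1 (b : HilbertBasis ι ℂ H) (ρ : EuclideanSpace ℝ (Fin m) → H →L[ℂ] H)
    (Θ : Set (EuclideanSpace ℝ (Fin m))) : Prop where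
  exists_fst : ∀ θ ∈ Θ, ∀ i, ∃ D, HasTraceDeriv b ρ i θ D
  exists_snd : ∀ θ ∈ Θ, ∀ i j, ∃ D, HasTraceDeriv b (traceDeriv b ρ j) i θ D
  cont_fst : ∀ i, LocUnifContOn b (traceDeriv b ρ i) Θ
  cont_snd : ∀ i j, LocUnifContOn b (traceDeriv b (traceDeriv b ρ j) i) Θ
  bound : ∃ a₁ : ℝ≥0, ∀ θ ∈ Θ, (∀ i, traceNorm b (traceDeriv b ρ i θ) ≤ a₁) ∧
    ∀ i j, traceNorm b (traceDeriv b (traceDeriv b ρ j) i θ) ≤ a₁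

/-- `D = (Lσ + σL)/2` for a Hermitian, possibly unbounded, operator `L` with `tr σL² < ∞`. As usual
for unbounded `L`, the range of `σ^{1/2}` has to lie in the domain of `L`, the operator `σL` is the
adjoint of `Lσ`, and `tr σL²` is the squared Hilbert-Schmidt norm of `L σ^{1/2}`. -/
def HasSLD (b : HilbertBasis ι ℂ H) (σ D : H →L[ℂ] H) : Prop :=
  ∃ L : H →ₗ.[ℂ] H, Dense (L.domain : Set H) ∧ L.IsFormalAdjoint L ∧
    ∃ (hs : ∀ x, CFC.sqrt σ x ∈ L.domain) (hσ : ∀ x, σ x ∈ L.domain),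
      (∀ x y, ⟪x, D y⟫_ℂ = (⟪x, L ⟨σ y, hσ y⟩⟫_ℂ + ⟪L ⟨σ x, hσ x⟩, y⟫_ℂ) / 2) ∧
      ∑' i, ‖L ⟨CFC.sqrt σ (b i), hs (b i)⟩‖ₑ ^ 2 ≠ ∞

/-- Each `∂_i ρ_θ` has a symmetric logarithmic derivative with finite second moment. -/
def CondM2 (b : HilbertBasis ι ℂ H) (ρ : EuclideanSpace ℝ (Fin m) → H →L[ℂ] H)
    (Θ : Set (EuclideanSpace ℝ (Fin m))) : Prop :=
  ∀ θ ∈ Θ, ∀ i, HasSLD b (ρ θ) (traceDeriv b ρ i θ)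

/-! ### Regularity conditions on estimators -/

/-- A family `◇_{i,θ}` of positive operators with `tr ◇_{i,θ} ≤ a₁` such that
`|∂_i ρ_{θ₀}| ≤ ◇_{i,θ}` for all `θ₀ ∈ Θ` that differ from `θ` in the `i`-th coordinate only, by
less than `a₂`. -/
def IsDiamond (b : HilbertBasis ι ℂ H) (ρ : EuclideanSpace ℝ (Fin m) → H →L[ℂ] H)
    (Θ : Set (EuclideanSpace ℝ (Fin m))) (a₁ : ℝ≥0) (a₂ : ℝ)
    (Dia : Fin m → EuclideanSpace ℝ (Fin m) → H →L[ℂ] H) : Prop :=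
  ∀ i, ∀ θ ∈ Θ, traceE b (Dia i θ) ≤ a₁ ∧ ∀ θ₀ ∈ Θ, |θ i - θ₀ i| < a₂ →
    (∀ j, j ≠ i → θ j = θ₀ j) → CFC.abs (traceDeriv b ρ i θ₀) ≤ Dia i θ

/-- `◇⊗σ⊗⋯⊗σ + σ⊗◇⊗σ⊗⋯⊗σ + ⋯ + σ⊗⋯⊗σ⊗◇` in the `n`-th tensor power. -/
def tensorSum (b : HilbertBasis ι ℂ H) (n : ℕ) (σ D : H →L[ℂ] H) :
    TensorPower ι n →L[ℂ] TensorPower ι n :=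
  ∑ k : Fin n, tensorOp b (Function.update (fun _ => σ) k D)

/-- The moment condition (E) for an estimator on `n` copies. -/
def CondE (b : HilbertBasis ι ℂ H) (ρ : EuclideanSpace ℝ (Fin m) → H →L[ℂ] H)
    (Θ : Set (EuclideanSpace ℝ (Fin m))) {n : ℕ} (E : Estimator ι n m) : Prop :=
  ∃ (a₁ : ℝ≥0) (a₂ : ℝ) (Dia : Fin m → EuclideanSpace ℝ (Fin m) → H →L[ℂ] H),
    0 < a₂ ∧ IsDiamond b ρ Θ a₁ a₂ Dia ∧
    ∃ a₄ : ℝ≥0, ∀ θ ∈ Θ,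
      (∀ i, ∫⁻ ω, ‖E.T ω - θ‖ₑ ∂(E.M.law (tensorBasis ι n) (tensorSum b n (ρ θ) (Dia i θ)))
        ≤ n * a₁ * a₄) ∧
      ∫⁻ ω, ‖E.T ω - θ‖ₑ ^ 2 ∂(E.law b (ρ θ)) ≤ n * a₄ ^ 2

/-- The boundedness condition (E'): the estimate takes values in a bounded set. -/
def CondE' {n : ℕ} (E : Estimator ι n m) : Prop :=
  ∃ S : Set (EuclideanSpace ℝ (Fin m)), (∀ ω, E.T ω ∈ S) ∧
    ∃ a₄ : ℝ, ∀ x ∈ S, ∀ y ∈ S, ‖x - y‖ ≤ a₄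

/-- Existence of a preliminary estimator: there is an asymptotically unbiased sequence of estimators with (E) whose
measurements are repetitions of one measurement on a single system, and whose fourth moment error
is at most `D_θ / n²`. -/
def CondM3 (b : HilbertBasis ι ℂ H) (ρ : EuclideanSpace ℝ (Fin m) → H →L[ℂ] H)
    (Θ : Set (EuclideanSpace ℝ (Fin m))) : Prop :=
  ∃ (l : ℕ) (M : POVM (Fin l → ℝ) H) (M' : ∀ n, POVM (Fin (n * l) → ℝ) (TensorPower ι n))
    (T : ∀ n, (Fin (n * l) → ℝ) → EuclideanSpace ℝ (Fin m)) (hT : ∀ n, Measurable (T n)),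
    (∀ n ≥ 1, IsRepetition b M (M' n)) ∧
    AsympUnbiased b ρ Θ (fun n => ⟨n * l, M' n, T n, hT n⟩) ∧
    (∀ n ≥ 1, CondE b ρ Θ ⟨n * l, M' n, T n, hT n⟩) ∧
    ∀ θ ∈ Θ, ∃ D : ℝ, ∀ n : ℕ, 1 ≤ n →
      ∫⁻ ω, ‖T n ω - θ‖ₑ ^ 4 ∂(Estimator.law b ⟨n * l, M' n, T n, hT n⟩ (ρ θ))
        ≤ ENNReal.ofReal (D / n ^ 2)

/-! ### The Cramér-Rao type bounds -/

/-- The asymptotic quantum Cramér-Rao type bound: the infimum, over all asymptotically unbiased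
sequences of estimators with (E), of `limsup n Tr G MSE_θ`. -/
def CQ (b : HilbertBasis ι ℂ H) (ρ : EuclideanSpace ℝ (Fin m) → H →L[ℂ] H)
    (Θ : Set (EuclideanSpace ℝ (Fin m))) (G : Matrix (Fin m) (Fin m) ℝ)
    (θ : EuclideanSpace ℝ (Fin m)) : EReal :=
  ⨅ (E : ∀ n, Estimator ι n m) (_ : AsympUnbiased b ρ Θ E) (_ : ∀ n ≥ 1, CondE b ρ Θ (E n)),
    limsup (fun n : ℕ => ((n * (G * (E n).mse b (ρ θ) θ).trace : ℝ) : EReal)) atTop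

/-- `inf n Tr G V_θ` over the estimators on `n` copies that are locally unbiased at `θ` and satisfy
the condition `C` (an infimum over the empty set is `+∞`). -/
def localBound (b : HilbertBasis ι ℂ H) (ρ : EuclideanSpace ℝ (Fin m) → H →L[ℂ] H)
    (G : Matrix (Fin m) (Fin m) ℝ) (θ : EuclideanSpace ℝ (Fin m)) (n : ℕ)
    (C : Estimator ι n m → Prop) : EReal :=
  ⨅ (E : Estimator ι n m) (_ : LocallyUnbiased b ρ E θ) (_ : C E),
    ((n * (G * E.cov b (ρ θ)).trace : ℝ) : EReal)

end Model

end QEst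

end

open MeasureTheory Filter Topology
open scoped ENNReal NNReal InnerProductSpace

noncomputable section

namespace QEst

set_option linter.unusedSectionVars false

/-! ### The pairing of positive operators and the laws of measurements -/

section Pairing

variable {κ K : Type*} [NormedAddCommGroup K] [InnerProductSpace ℂ K] [CompleteSpace K]

/-! Everything rests on adding estimators that act on disjoint groups of copies: the distribution of
the sum is a convolution, so means, derivative matrices of the means and covariance matrices all
add.

The local bounds do not exceed the asymptotic bound in the limit. Let `E n` be asymptotically
unbiased, with derivative matrices `B n` tending to 1. Out of `n` copies about `n / q` are set aside
for an almost locally unbiased estimator `V` obtained from (M.3), whose covariance is of the order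
of the inverse number of copies. An affine function of `V` with linear part `(1 - B) * V'⁻¹`, where
`V'` is the derivative matrix of `V`, is added to the estimate from the other copies; this makes the
sum locally unbiased at `θ`. The linear part tends to 0, so `n` times the covariance of the
correction vanishes, and only a factor `q / (q - 1)` is lost, with `q` as large as desired
(`localBound_le_of_correction`, `limsup_localBound_le`).

The asymptotic bound does not exceed the local ones. Let `S` on `N` copies be locally unbiased at
one point `θ`, and let `f x` be its mean at `x`. Spend about `n / q` copies on a preliminary
estimate `T` from (M.3), average `S` over the remaining groups of `N` copies, and use `T - f(T) +
average of S`. At every `x` the mean tends to `x`, because `f(T)` is close to `f x`, which is the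
mean of the average. At `θ` the function `x - f x` vanishes to second order, so the second moments
of `T - f(T)` are controlled by the fourth moments of `T - θ`; they are of order `n⁻²` and do not
contribute to `n` times the mean square error. What remains is the covariance of the average
(`exists_asympUnbiased`, `residual_moments`).

The delicate point is that the derivative matrices converge at every `x`, where `f` is only known to
have a first order expansion with quadratic remainder `R`. The information inequality bounds the
squared derivative of the expectation of `R(T)` on `k` copies by `k * J` times the expectation of
`R(T) ^ 2`, which is of order `1/k`. It follows from (M.2), the Fisher information being additive
over copies (`HasSLD.exists_fisher`, `exists_fisher_bound`, `residual_asymptotics`).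

Expectations of unbounded estimates must be differentiated although only second moments are locally
bounded. A truncation at height proportional to `1/|s|` does this, once the distributions have an
expansion up to `o(s^2)` in total variation; (M.1) supplies it (`exists_tensor_expansion`,
`hasDerivAt_integral_of_expansion`).

Estimators with finitely many values mediate between (E) and (E'). They are bounded, and they
approximate every locally unbiased estimator with either condition after a small affine correction
(`localBound_isFinite_le`). Both local bounds are thereby squeezed to the asymptotic one. -/

/-- The squared Hilbert-Schmidt norm. -/
def hsq (b : HilbertBasis κ ℂ K) (A : K →L[ℂ] K) : ℝ≥0∞ := ∑' i, ‖A (b i)‖ₑ ^ 2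

/-- By Parseval both sides are the double sum of the squared absolute values of the matrix entries,
summed in opposite orders. -/
theorem hsq_star (b : HilbertBasis κ ℂ K) (A : K →L[ℂ] K) : hsq b (star A) = hsq b A := by
  simp only [hsq, basis_enorm_sq b]
  rw [ENNReal.tsum_comm]
  refine tsum_congr fun i => tsum_congr fun j => ?_
  rw [ContinuousLinearMap.star_eq_adjoint, ContinuousLinearMap.adjoint_inner_right,
    ← inner_conj_symm, RCLike.enorm_conj]

theorem ofReal_inner_self (φ : K) : ENNReal.ofReal (⟪φ, φ⟫_ℂ).re = ‖φ‖ₑ ^ 2 := by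
  rw [show (⟪φ, φ⟫_ℂ).re = ‖φ‖ ^ 2 from inner_self_eq_norm_sq (𝕜 := ℂ) φ,
    ENNReal.ofReal_pow (norm_nonneg _), ofReal_norm]

theorem ofReal_inner_star_mul (A : K →L[ℂ] K) (φ : K) :
    ENNReal.ofReal (⟪φ, (star A * A) φ⟫_ℂ).re = ‖A φ‖ₑ ^ 2 := by
  rw [← ofReal_inner_self, mul_apply_eq_comp, ContinuousLinearMap.star_eq_adjoint,
    ContinuousLinearMap.adjoint_inner_right]

theorem star_sqrt (A : K →L[ℂ] K) : star (CFC.sqrt A) = CFC.sqrt A :=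
  (IsSelfAdjoint.of_nonneg (CFC.sqrt_nonneg A)).star_eq

theorem ofReal_inner_nonneg_op {C : K →L[ℂ] K} (hC : 0 ≤ C) (φ : K) :
    ENNReal.ofReal (⟪φ, C φ⟫_ℂ).re = ‖CFC.sqrt C φ‖ₑ ^ 2 := by
  rw [← ofReal_inner_star_mul, star_sqrt, CFC.sqrt_mul_sqrt_self C hC]

theorem re_inner_nonneg_op {C : K →L[ℂ] K} (hC : 0 ≤ C) (φ : K) : 0 ≤ (⟪φ, C φ⟫_ℂ).re :=
  ((ContinuousLinearMap.nonneg_iff_isPositive _).1 hC).re_inner_nonneg_right φ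

theorem traceE_star_mul (b : HilbertBasis κ ℂ K) (A : K →L[ℂ] K) :
    traceE b (star A * A) = hsq b A :=
  tsum_congr fun i => ofReal_inner_star_mul A (b i)

theorem traceE_mul_star (b : HilbertBasis κ ℂ K) (A : K →L[ℂ] K) :
    traceE b (A * star A) = hsq b A := by
  rw [← hsq_star, ← traceE_star_mul, star_star]

theorem traceE_add (b : HilbertBasis κ ℂ K) {P Q : K →L[ℂ] K} (hP : 0 ≤ P) (hQ : 0 ≤ Q) :
    traceE b (P + Q) = traceE b P + traceE b Q := by
  simp only [traceE]
  rw [← ENNReal.tsum_add]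
  refine tsum_congr fun i => ?_
  rw [← ENNReal.ofReal_add (re_inner_nonneg_op hP _) (re_inner_nonneg_op hQ _)]
  simp

theorem traceE_mono (b : HilbertBasis κ ℂ K) {P Q : K →L[ℂ] K} (hP : 0 ≤ P) (h : P ≤ Q) :
    traceE b P ≤ traceE b Q := by
  have := traceE_add b hP (sub_nonneg.2 h)
  rw [add_sub_cancel] at this
  rw [this]
  exact le_self_add

theorem traceE_smul (b : HilbertBasis κ ℂ K) {c : ℝ} (hc : 0 ≤ c) (P : K →L[ℂ] K) :
    traceE b (c • P) = ENNReal.ofReal c * traceE b P := by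
  simp only [traceE]
  rw [← ENNReal.tsum_mul_left]
  refine tsum_congr fun i => ?_
  rw [← ENNReal.ofReal_mul hc]
  congr 1
  have : (c • P) (b i) = (c : ℂ) • P (b i) := by simp
  rw [this, inner_smul_right]
  simp

namespace POVM

variable {X : Type*} [MeasurableSpace X]

theorem vecMeasure_apply (M : POVM X K) (φ : K) {Δ : Set X} (hΔ : MeasurableSet Δ) :
    M.vecMeasure φ Δ = ENNReal.ofReal (⟪φ, M.op Δ φ⟫_ℂ).re :=
  Measure.ofMeasurable_apply Δ hΔ

/-- `law` computed from any factorization of the state. -/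
theorem law_mul_star (b : HilbertBasis κ ℂ K) (M : POVM X K) (A : K →L[ℂ] K) {Δ : Set X}
    (hΔ : MeasurableSet Δ) :
    M.law b (A * star A) Δ = ∑' i, ENNReal.ofReal (⟪A (b i), M.op Δ (A (b i))⟫_ℂ).re := by
  have hC := M.pos Δ hΔ
  set C := M.op Δ
  have hτ : 0 ≤ A * star A := mul_star_self_nonneg A
  -- Both sides are the trace of `√C (B B*) √C`, which depends on `B` only through `B B*`. Applied
  -- to `A` and to the square root of `A A*`, this identifies the two factorizations.
  have h1 : ∀ B : K →L[ℂ] K, ∑' i, ENNReal.ofReal (⟪B (b i), C (B (b i))⟫_ℂ).re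
      = traceE b (star (CFC.sqrt C) * (B * star B) * CFC.sqrt C) := by
    intro B
    have : star (CFC.sqrt C) * (B * star B) * CFC.sqrt C =
        star (star B * CFC.sqrt C) * (star B * CFC.sqrt C) := by
      simp only [star_mul, star_star, mul_assoc]
    rw [this, traceE_star_mul, ← hsq_star]
    simp only [star_mul, star_star, star_sqrt]
    refine tsum_congr fun i => ?_
    rw [ofReal_inner_nonneg_op hC]
    simp
  rw [h1, law, Measure.sum_apply _ hΔ]
  simp only [M.vecMeasure_apply _ hΔ]
  rw [h1, star_sqrt (A * star A), CFC.sqrt_mul_sqrt_self _ hτ]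

/-- With the square root moved from the state to the measurement operator the expression is visibly
additive and homogeneous in `τ`; the next lemmas read this off. -/
theorem law_apply (b : HilbertBasis κ ℂ K) (M : POVM X K) {τ : K →L[ℂ] K} (hτ : 0 ≤ τ)
    {Δ : Set X} (hΔ : MeasurableSet Δ) :
    M.law b τ Δ = ∑' i, ENNReal.ofReal (⟪CFC.sqrt (M.op Δ) (b i),
      τ (CFC.sqrt (M.op Δ) (b i))⟫_ℂ).re := by
  have hC := M.pos Δ hΔ
  rw [law, Measure.sum_apply _ hΔ]
  simp only [M.vecMeasure_apply _ hΔ]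
  set C := M.op Δ
  simp only [ofReal_inner_nonneg_op hC, ofReal_inner_nonneg_op hτ]
  have := hsq_star b (CFC.sqrt C * CFC.sqrt τ)
  simpa [hsq, star_sqrt] using this.symm

theorem law_add (b : HilbertBasis κ ℂ K) (M : POVM X K) {τ τ' : K →L[ℂ] K} (hτ : 0 ≤ τ)
    (hτ' : 0 ≤ τ') : M.law b (τ + τ') = M.law b τ + M.law b τ' := by
  ext Δ hΔ
  rw [Measure.add_apply, law_apply b M hτ hΔ, law_apply b M hτ' hΔ,
    law_apply b M (add_nonneg hτ hτ') hΔ, ← ENNReal.tsum_add]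
  refine tsum_congr fun i => ?_
  rw [← ENNReal.ofReal_add (re_inner_nonneg_op hτ _) (re_inner_nonneg_op hτ' _)]
  simp

theorem law_zero (b : HilbertBasis κ ℂ K) (M : POVM X K) : M.law b 0 = 0 := by
  ext Δ hΔ
  simp [law_apply b M le_rfl hΔ]

theorem law_smul (b : HilbertBasis κ ℂ K) (M : POVM X K) {τ : K →L[ℂ] K} (hτ : 0 ≤ τ)
    {c : ℝ} (hc : 0 ≤ c) : M.law b (c • τ) = ENNReal.ofReal c • M.law b τ := by
  ext Δ hΔ
  rw [Measure.smul_apply, law_apply b M hτ hΔ, law_apply b M (smul_nonneg hc hτ) hΔ, smul_eq_mul,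
    ← ENNReal.tsum_mul_left]
  refine tsum_congr fun i => ?_
  rw [← ENNReal.ofReal_mul hc]
  congr 1
  have : ∀ x, (c • τ) x = (c : ℂ) • τ x := by simp
  rw [this, inner_smul_right]
  simp

theorem law_univ (b : HilbertBasis κ ℂ K) (M : POVM X K) {τ : K →L[ℂ] K} (hτ : 0 ≤ τ) :
    M.law b τ Set.univ = traceE b τ := by
  rw [law_apply b M hτ MeasurableSet.univ, M.univ]
  simp [traceE]

theorem op_empty (M : POVM X K) : M.op ∅ = 0 := by
  have : ∀ φ ψ, ⟪φ, M.op ∅ ψ⟫_ℂ = 0 := fun φ ψ => by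
    have h := M.iUnion (fun _ => ∅) (fun _ => MeasurableSet.empty)
        (fun _ _ _ => by simp [Function.onFun]) φ ψ
    simp only [Set.iUnion_empty] at h
    exact tendsto_nhds_unique tendsto_const_nhds h.summable.tendsto_atTop_zero
  ext ψ
  simpa using this (M.op ∅ ψ) ψ

/-- A positive operator valued set function is a measure if its quadratic forms are. -/
def ofDiag (op : Set X → K →L[ℂ] K) (pos : ∀ Δ, MeasurableSet Δ → 0 ≤ op Δ)
    (univ : op Set.univ = 1)
    (add : ∀ Δ : ℕ → Set X, (∀ k, MeasurableSet (Δ k)) →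
      Pairwise (Function.onFun Disjoint Δ) →
      ∀ φ : K, ∑' k, ENNReal.ofReal (⟪φ, op (Δ k) φ⟫_ℂ).re =
        ENNReal.ofReal (⟪φ, op (⋃ k, Δ k) φ⟫_ℂ).re) : POVM X K where
  op := op
  pos := pos
  univ := univ
  iUnion := by
    intro Δ hm hd φ ψ
    have hre : ∀ Δ, MeasurableSet Δ → ∀ φ, ((⟪φ, op Δ φ⟫_ℂ).re : ℂ) = ⟪op Δ φ, φ⟫_ℂ := by
      intro Δ hΔ φ
      have hp := (ContinuousLinearMap.nonneg_iff_isPositive _).1 (pos Δ hΔ)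
      rw [show ⟪φ, op Δ φ⟫_ℂ = ⟪op Δ φ, φ⟫_ℂ from (hp.isSelfAdjoint.isSymmetric φ φ).symm]
      exact hp.isSelfAdjoint.isSymmetric.coe_re_inner_apply_self φ
    -- Nonnegative forms with finite sum converge as real series. Polarization then carries the
    -- convergence from the diagonal to all pairs of vectors.
    have hdiag : ∀ φ, HasSum (fun k => ⟪op (Δ k) φ, φ⟫_ℂ) ⟪op (⋃ k, Δ k) φ, φ⟫_ℂ := by
      intro φ
      simp only [← hre _ (hm _), ← hre _ (MeasurableSet.iUnion hm)]
      rw [Complex.hasSum_ofReal]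
      have h := add Δ hm hd φ
      have hn : ∀ k, 0 ≤ (⟪φ, op (Δ k) φ⟫_ℂ).re := fun k => re_inner_nonneg_op (pos _ (hm k)) φ
      have hs : Summable fun k => (⟪φ, op (Δ k) φ⟫_ℂ).re := by
        have : ∑' k, ENNReal.ofReal (⟪φ, op (Δ k) φ⟫_ℂ).re ≠ ∞ := by rw [h]; finiteness
        have := ENNReal.summable_toReal this
        simpa [ENNReal.toReal_ofReal, hn] using this
      rw [hs.hasSum_iff]
      rw [← ENNReal.ofReal_tsum_of_nonneg hn hs] at h
      exact (ENNReal.ofReal_eq_ofReal_iff (tsum_nonneg hn)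
        (re_inner_nonneg_op (pos _ (.iUnion hm)) φ)).1 h
    have hsa : ∀ Δ, MeasurableSet Δ → ∀ φ ψ, ⟪φ, op Δ ψ⟫_ℂ = ⟪op Δ φ, ψ⟫_ℂ := fun Δ hΔ φ ψ =>
      (((ContinuousLinearMap.nonneg_iff_isPositive _).1
        (pos Δ hΔ)).isSelfAdjoint.isSymmetric φ ψ).symm
    simp only [hsa _ (hm _), hsa _ (MeasurableSet.iUnion hm)]
    have hpol : ∀ A : K →L[ℂ] K, ⟪A φ, ψ⟫_ℂ = (⟪A (φ + ψ), φ + ψ⟫_ℂ - ⟪A (φ - ψ), φ - ψ⟫_ℂ -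
        Complex.I * ⟪A (φ + Complex.I • ψ), φ + Complex.I • ψ⟫_ℂ +
        Complex.I * ⟪A (φ - Complex.I • ψ), φ - Complex.I • ψ⟫_ℂ) / 4 := fun A =>
      inner_map_polarization' (A : K →ₗ[ℂ] K) φ ψ
    simp only [hpol]
    exact ((((hdiag _).sub (hdiag _)).sub ((hdiag _).mul_left _)).add
      ((hdiag _).mul_left _)).div_const 4

/-- The image of a measurement under a measurable function of the data. -/
def map {Y : Type*} [MeasurableSpace Y] (M : POVM X K) (g : X → Y) (hg : Measurable g) :
    POVM Y K where
  op Δ := M.op (g ⁻¹' Δ)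
  pos Δ hΔ := M.pos _ (hg hΔ)
  univ := by simpa using M.univ
  iUnion Δ hm hd φ ψ := by
    rw [Set.preimage_iUnion]
    exact M.iUnion _ (fun k => hg (hm k)) (fun i j hij => (hd hij).preimage g) φ ψ

theorem map_law {Y : Type*} [MeasurableSpace Y] (b : HilbertBasis κ ℂ K) (M : POVM X K)
    (g : X → Y) (hg : Measurable g) {τ : K →L[ℂ] K} (hτ : 0 ≤ τ) :
    (M.map g hg).law b τ = (M.law b τ).map g := by
  ext Δ hΔ
  rw [Measure.map_apply hg hΔ, law_apply b _ hτ hΔ, law_apply b _ hτ (hg hΔ)]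
  rfl

end POVM

end Pairing

/-! ### Algebra of tensor products of operators -/

section Tensor

theorem tsum_prod_pi_enn {ι : Type*} {n : ℕ} (a : Fin n → ι → ℝ≥0∞) :
    ∑' i : Fin n → ι, ∏ k, a k (i k) = ∏ k, ∑' j, a k j := by
  induction n with
  | zero => simp
  | succ n ih =>
    rw [← (Fin.consEquiv (fun _ => ι)).tsum_eq, ENNReal.tsum_prod', Fin.prod_univ_succ,
      ← ih (fun k => a k.succ), ← ENNReal.tsum_mul_right]
    refine tsum_congr fun j => ?_
    rw [← ENNReal.tsum_mul_left]
    refine tsum_congr fun r => ?_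
    simp [Fin.consEquiv, Fin.prod_univ_succ]

theorem summable_norm_prod_pi {ι : Type*} {n : ℕ} (a : Fin n → ι → ℂ)
    (h : ∀ k, Summable fun j => ‖a k j‖) : Summable fun i : Fin n → ι => ‖∏ k, a k (i k)‖ := by
  have h1 : ∑' i : Fin n → ι, ∏ k, ‖a k (i k)‖ₑ ≠ ∞ := by
    rw [tsum_prod_pi_enn fun k j => ‖a k j‖ₑ]
    refine ENNReal.prod_ne_top fun k _ => ?_
    have := (h k).toNNReal
    rw [← ENNReal.tsum_coe_ne_top_iff_summable] at this
    simpa [enorm_eq_nnnorm] using this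
  have h2 := ENNReal.summable_toReal h1
  simpa [ENNReal.toReal_prod] using h2

theorem tsum_prod_pi {ι : Type*} {n : ℕ} (a : Fin n → ι → ℂ)
    (h : ∀ k, Summable fun j => ‖a k j‖) :
    ∑' i : Fin n → ι, ∏ k, a k (i k) = ∏ k, ∑' j, a k j := by
  induction n with
  | zero => simp
  | succ n ih =>
    rw [← (Fin.consEquiv (fun _ => ι)).tsum_eq, Fin.prod_univ_succ,
      ← ih (fun k => a k.succ) (fun k => h _), tsum_mul_tsum_of_summable_norm (h 0)
        (summable_norm_prod_pi _ fun k => h _)]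
    refine tsum_congr fun x => ?_
    simp [Fin.consEquiv, Fin.prod_univ_succ]

variable {ι H : Type*} [NormedAddCommGroup H] [InnerProductSpace ℂ H]

theorem inner_summable (b : HilbertBasis ι ℂ H) (v w : H) :
    Summable fun j => ‖inner ℂ v (b j) * inner ℂ (b j) w‖ :=
  (b.summable_inner_mul_inner v w).norm

/-- Parseval in each factor, and Fubini for a product of absolutely convergent series. -/
theorem inner_tprod (b : HilbertBasis ι ℂ H) {n : ℕ} (v w : Fin n → H) :
    ⟪tprod b v, tprod b w⟫_ℂ = ∏ k, ⟪v k, w k⟫_ℂ := by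
  simp only [← fun k => b.tsum_inner_mul_inner (v k) (w k)]
  rw [← tsum_prod_pi _ fun k => inner_summable b (v k) (w k), lp.inner_eq_tsum]
  refine tsum_congr fun i => ?_
  simp only [tprod, RCLike.inner_apply, map_prod, inner_conj_symm]
  rw [mul_comm, Finset.prod_mul_distrib]

theorem enorm_tprod_sq (b : HilbertBasis ι ℂ H) {n : ℕ} (v : Fin n → H) :
    ‖tprod b v‖ₑ ^ 2 = ∏ k, ‖v k‖ₑ ^ 2 := by
  rw [l2_enorm_sq, ← tprod_sum b v]
  rfl

theorem tensorBasis_apply (b : HilbertBasis ι ℂ H) {n : ℕ} (i : Fin n → ι) :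
    tensorBasis ι n i = tprod b fun k => b (i k) := by
  classical
  rw [← HilbertBasis.repr_symm_single]
  ext j
  change (lp.single 2 i (1 : ℂ) : TensorPower ι n) j = ∏ k, ⟪b (j k), b (i k)⟫_ℂ
  rw [lp.single_apply, Pi.single_apply]
  simp only [orthonormal_iff_ite.1 b.orthonormal]
  by_cases h : j = i
  · simp [h]
  · rw [if_neg h]
    obtain ⟨k, hk⟩ := Function.ne_iff.1 h
    exact (Finset.prod_eq_zero (Finset.mem_univ k) (if_neg hk)).symm

theorem basis_op_ext {κ K K' : Type*} [NormedAddCommGroup K] [InnerProductSpace ℂ K]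
    [NormedAddCommGroup K'] [NormedSpace ℂ K'] (b : HilbertBasis κ ℂ K) {A B : K →L[ℂ] K'}
    (h : ∀ i, A (b i) = B (b i)) : A = B :=
  ContinuousLinearMap.ext_on (s := Set.range b)
    ((Submodule.dense_iff_topologicalClosure_eq_top).2 b.dense_span)
    (by rintro _ ⟨i, rfl⟩; exact h i)

theorem basis_inner_ext {κ K : Type*} [NormedAddCommGroup K] [InnerProductSpace ℂ K]
    (b : HilbertBasis κ ℂ K) {A B : K →L[ℂ] K}
    (h : ∀ i j, ⟪b i, A (b j)⟫_ℂ = ⟪b i, B (b j)⟫_ℂ) : A = B := by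
  refine basis_op_ext b fun j => b.repr.injective ?_
  ext i
  simpa [HilbertBasis.repr_apply_apply] using h i j

/-- Product vectors include the product basis, so they suffice to identify a bounded operator; all
algebraic identities for tensor products are checked on them. -/
theorem tensor_op_ext (b : HilbertBasis ι ℂ H) {n : ℕ} {K' : Type*} [NormedAddCommGroup K']
    [NormedSpace ℂ K'] {A B : TensorPower ι n →L[ℂ] K'}
    (h : ∀ v : Fin n → H, A (tprod b v) = B (tprod b v)) : A = B :=
  basis_op_ext (tensorBasis ι n) fun i => by rw [tensorBasis_apply b, h]

theorem tprod_update_add (b : HilbertBasis ι ℂ H) {n : ℕ} (v : Fin n → H) (k : Fin n) (x y : H) :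
    tprod b (Function.update v k (x + y)) =
      tprod b (Function.update v k x) + tprod b (Function.update v k y) := by
  ext i
  simp only [tprod, lp.coeFn_add, Pi.add_apply]
  simp only [← Finset.mul_prod_erase _ _ (Finset.mem_univ k), Function.update_self,
    inner_add_right, add_mul]
  congr 2 <;> refine Finset.prod_congr rfl fun c hc => ?_ <;>
    simp only [Function.update_of_ne (Finset.ne_of_mem_erase hc)]

theorem tprod_update_smul (b : HilbertBasis ι ℂ H) {n : ℕ} (v : Fin n → H) (k : Fin n) (c : ℂ)
    (x : H) : tprod b (Function.update v k (c • x)) = c • tprod b (Function.update v k x) := by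
  ext i
  simp only [tprod, lp.coeFn_smul, Pi.smul_apply]
  simp only [← Finset.mul_prod_erase _ _ (Finset.mem_univ k), Function.update_self,
    inner_smul_right, smul_eq_mul, mul_assoc]
  congr 2; refine Finset.prod_congr rfl fun c hc => ?_
  simp only [Function.update_of_ne (Finset.ne_of_mem_erase hc)]

theorem tensorOp_mul (b : HilbertBasis ι ℂ H) {n : ℕ} (A B : Fin n → H →L[ℂ] H) :
    tensorOp b A * tensorOp b B = tensorOp b fun k => A k * B k :=
  tensor_op_ext b fun v => by simp [tensorOp_tprod]

theorem update_apply_vec {n : ℕ} (A : Fin n → H →L[ℂ] H) (k : Fin n) (B : H →L[ℂ] H)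
    (v : Fin n → H) : (fun l => Function.update A k B l (v l)) =
      Function.update (fun l => A l (v l)) k (B (v k)) := by
  ext l
  by_cases h : l = k
  · subst h; simp
  · simp [h]

theorem tensorOp_update_add (b : HilbertBasis ι ℂ H) {n : ℕ} (A : Fin n → H →L[ℂ] H)
    (k : Fin n) (B C : H →L[ℂ] H) :
    tensorOp b (Function.update A k (B + C)) =
      tensorOp b (Function.update A k B) + tensorOp b (Function.update A k C) :=
  tensor_op_ext b fun v => by
    simp only [tensorOp_tprod, update_apply_vec, add_apply, tprod_update_add]

theorem tensorOp_update_smul (b : HilbertBasis ι ℂ H) {n : ℕ} (A : Fin n → H →L[ℂ] H)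
    (k : Fin n) (c : ℝ) (B : H →L[ℂ] H) :
    tensorOp b (Function.update A k (c • B)) = c • tensorOp b (Function.update A k B) :=
  tensor_op_ext b fun v => by
    have h : ∀ x : H, (c • B) x = (c : ℂ) • B x := by simp
    simp only [tensorOp_tprod, update_apply_vec, h, tprod_update_smul]
    rw [smul_apply, tensorOp_tprod, update_apply_vec]
    exact Complex.coe_smul c _

variable [CompleteSpace H]

theorem star_tensorOp (b : HilbertBasis ι ℂ H) {n : ℕ} (A : Fin n → H →L[ℂ] H) :
    star (tensorOp b A) = tensorOp b fun k => star (A k) := by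
  refine basis_inner_ext (tensorBasis ι n) fun i j => ?_
  rw [ContinuousLinearMap.star_eq_adjoint, ContinuousLinearMap.adjoint_inner_right]
  simp only [tensorBasis_apply b, tensorOp_tprod, inner_tprod]
  simp [ContinuousLinearMap.star_eq_adjoint, ContinuousLinearMap.adjoint_inner_right]

theorem tensorOp_eq_sqrt (b : HilbertBasis ι ℂ H) {n : ℕ} {τ : Fin n → H →L[ℂ] H}
    (h : ∀ k, 0 ≤ τ k) : tensorOp b τ =
      tensorOp b (fun k => CFC.sqrt (τ k)) * star (tensorOp b fun k => CFC.sqrt (τ k)) := by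
  rw [star_tensorOp, tensorOp_mul]
  congr 1
  ext1 k
  rw [star_sqrt, CFC.sqrt_mul_sqrt_self _ (h k)]

theorem tensorOp_nonneg (b : HilbertBasis ι ℂ H) {n : ℕ} {τ : Fin n → H →L[ℂ] H}
    (h : ∀ k, 0 ≤ τ k) : 0 ≤ tensorOp b τ := by
  rw [tensorOp_eq_sqrt b h]
  exact mul_star_self_nonneg _

theorem hsq_tensorOp (b : HilbertBasis ι ℂ H) {n : ℕ} (A : Fin n → H →L[ℂ] H) :
    hsq (tensorBasis ι n) (tensorOp b A) = ∏ k, hsq b (A k) := by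
  simp only [hsq, tensorBasis_apply b, tensorOp_tprod, enorm_tprod_sq]
  exact tsum_prod_pi_enn fun k j => ‖A k (b j)‖ₑ ^ 2

theorem traceE_eq_hsq_sqrt (b : HilbertBasis ι ℂ H) {τ : H →L[ℂ] H} (h : 0 ≤ τ) :
    traceE b τ = hsq b (CFC.sqrt τ) := by
  rw [← traceE_mul_star, star_sqrt, CFC.sqrt_mul_sqrt_self _ h]

/-- The square root of a tensor product factorizes, and squared Hilbert-Schmidt norms are
multiplicative because the product basis is. -/
theorem traceE_tensorOp (b : HilbertBasis ι ℂ H) {n : ℕ} {τ : Fin n → H →L[ℂ] H}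
    (h : ∀ k, 0 ≤ τ k) : traceE (tensorBasis ι n) (tensorOp b τ) = ∏ k, traceE b (τ k) := by
  simp only [tensorOp_eq_sqrt b h, traceE_mul_star, hsq_tensorOp, traceE_eq_hsq_sqrt b (h _)]

theorem update_nonneg {n : ℕ} {σ D : H →L[ℂ] H} (hσ : 0 ≤ σ) (hD : 0 ≤ D) (k l : Fin n) :
    0 ≤ Function.update (fun _ => σ) k D l := by
  by_cases h : l = k
  · subst h; simpa
  · simpa [h]

theorem tensorSum_nonneg (b : HilbertBasis ι ℂ H) {n : ℕ} {σ D : H →L[ℂ] H} (hσ : 0 ≤ σ)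
    (hD : 0 ≤ D) : 0 ≤ tensorSum b n σ D :=
  Finset.sum_nonneg fun k _ => tensorOp_nonneg b (update_nonneg hσ hD k)

theorem tensorSum_add (b : HilbertBasis ι ℂ H) (n : ℕ) (σ D D' : H →L[ℂ] H) :
    tensorSum b n σ (D + D') = tensorSum b n σ D + tensorSum b n σ D' := by
  simp only [tensorSum, tensorOp_update_add, Finset.sum_add_distrib]

theorem traceE_finset_sum {κ K : Type*} [NormedAddCommGroup K] [InnerProductSpace ℂ K]
    [CompleteSpace K] (b : HilbertBasis κ ℂ K) {α : Type*} (s : Finset α) (P : α → K →L[ℂ] K)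
    (hP : ∀ a, 0 ≤ P a) : traceE b (∑ a ∈ s, P a) = ∑ a ∈ s, traceE b (P a) := by
  classical
  induction s using Finset.induction_on with
  | empty => simp [traceE]
  | insert a s ha ih =>
    rw [Finset.sum_insert ha, Finset.sum_insert ha,
      traceE_add b (hP a) (Finset.sum_nonneg fun c _ => hP c), ih]

theorem traceE_update (b : HilbertBasis ι ℂ H) {n : ℕ} {σ D : H →L[ℂ] H} (hσ : IsDensity b σ)
    (hD : 0 ≤ D) (k : Fin n) :
    traceE (tensorBasis ι n) (tensorOp b (Function.update (fun _ => σ) k D)) = traceE b D := by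
  rw [traceE_tensorOp b (update_nonneg hσ.1 hD k), ← Finset.mul_prod_erase _ _ (Finset.mem_univ k),
    Finset.prod_eq_one]
  · simp
  · intro l hl
    rw [Function.update_of_ne (Finset.ne_of_mem_erase hl), hσ.2]

theorem traceE_tensorSum (b : HilbertBasis ι ℂ H) {n : ℕ} {σ D : H →L[ℂ] H}
    (hσ : IsDensity b σ) (hD : 0 ≤ D) :
    traceE (tensorBasis ι n) (tensorSum b n σ D) = n * traceE b D := by
  rw [tensorSum, traceE_finset_sum _ _ _ fun k => tensorOp_nonneg b (update_nonneg hσ.1 hD k)]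
  simp [traceE_update b hσ hD]

theorem traceE_tensorOp_density (b : HilbertBasis ι ℂ H) {n : ℕ} {σ : H →L[ℂ] H}
    (hσ : IsDensity b σ) : traceE (tensorBasis ι n) (tensorOp b fun _ : Fin n => σ) = 1 := by
  rw [traceE_tensorOp b fun _ => hσ.1]
  simp [hσ.2]

end Tensor

/-! ### Tensor products of two factors -/

section OpSqrt

variable {K : Type*} [NormedAddCommGroup K] [InnerProductSpace ℂ K] [CompleteSpace K]

/-- The square root of a positive operator. -/
def opSqrt (A : K →L[ℂ] K) : K →L[ℂ] K := CFC.sqrt A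

theorem star_opSqrt (A : K →L[ℂ] K) : star (opSqrt A) = opSqrt A := star_sqrt A

theorem opSqrt_mul_self {A : K →L[ℂ] K} (hA : 0 ≤ A) : opSqrt A * opSqrt A = A :=
  CFC.sqrt_mul_sqrt_self A hA

theorem ofReal_inner_opSqrt {C : K →L[ℂ] K} (hC : 0 ≤ C) (φ : K) :
    ENNReal.ofReal (⟪φ, C φ⟫_ℂ).re = ‖opSqrt C φ‖ₑ ^ 2 := ofReal_inner_nonneg_op hC φ

end OpSqrt

section TwoFactors

/-- The space `ℓ²(α)`. -/
abbrev L2 (α : Type*) : Type _ := lp (fun _ : α => ℂ) 2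

/-- The standard basis of `ℓ²(α)`. -/
abbrev stdBasis (α : Type*) : HilbertBasis α ℂ (L2 α) :=
  HilbertBasis.ofRepr (LinearIsometryEquiv.refl ℂ _)

variable {α β γ : Type*}

theorem stdBasis_eval [DecidableEq α] (i j : α) : (stdBasis α i) j = if j = i then 1 else 0 := by
  rw [← HilbertBasis.repr_symm_single]
  change (lp.single 2 i (1 : ℂ) : L2 α) j = _
  rw [lp.single_apply, Pi.single_apply]

theorem tsum_equiv_prod (e : α × β ≃ γ) (F : γ → ℝ≥0∞) :
    ∑' c, F c = ∑' j, ∑' i, F (e (i, j)) := by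
  rw [← e.tsum_eq, ENNReal.tsum_prod', ENNReal.tsum_comm]

/-- The product vector `x ⊗ y`. -/
def tens (e : α × β ≃ γ) (x : L2 α) (y : L2 β) : L2 γ :=
  ⟨fun c => x (e.symm c).1 * y (e.symm c).2, (l2_memlp_iff _).2 (by
    rw [tsum_equiv_prod e]
    simp only [Equiv.symm_apply_apply, enorm_mul, mul_pow, ENNReal.tsum_mul_right,
      ENNReal.tsum_mul_left, ← l2_enorm_sq]
    finiteness)⟩

theorem tens_apply (e : α × β ≃ γ) (x : L2 α) (y : L2 β) (c : γ) :
    tens e x y c = x (e.symm c).1 * y (e.symm c).2 := rfl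

theorem enorm_tens_sq (e : α × β ≃ γ) (x : L2 α) (y : L2 β) :
    ‖tens e x y‖ₑ ^ 2 = ‖x‖ₑ ^ 2 * ‖y‖ₑ ^ 2 := by
  rw [l2_enorm_sq, tsum_equiv_prod e]
  simp only [tens_apply, Equiv.symm_apply_apply, enorm_mul, mul_pow, ENNReal.tsum_mul_right,
    ENNReal.tsum_mul_left, ← l2_enorm_sq]

/-- The coordinates of `f` with the second index fixed. -/
def sect (e : α × β ≃ γ) (f : L2 γ) (j : β) : L2 α :=
  ⟨fun i => f (e (i, j)), (l2_memlp_iff _).2 (ne_top_of_le_ne_top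
    ((l2_memlp_iff _).1 (lp.memℓp f)) (ENNReal.tsum_comp_le_tsum_of_injective
      (fun i i' h => by simpa using h : Function.Injective fun i => e (i, j))
        (fun c => ‖f c‖ₑ ^ 2)))⟩

theorem sect_apply (e : α × β ≃ γ) (f : L2 γ) (j : β) (i : α) : sect e f j i = f (e (i, j)) := rfl

theorem tsum_sect (e : α × β ≃ γ) (f : L2 γ) : ∑' j, ‖sect e f j‖ₑ ^ 2 = ‖f‖ₑ ^ 2 := by
  rw [l2_enorm_sq f, tsum_equiv_prod e]
  simp only [l2_enorm_sq, sect_apply]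

theorem left_sum (e : α × β ≃ γ) (A : L2 α →L[ℂ] L2 α) (f : L2 γ) :
    ∑' c, ‖A (sect e f (e.symm c).2) (e.symm c).1‖ₑ ^ 2 = ∑' j, ‖A (sect e f j)‖ₑ ^ 2 := by
  rw [tsum_equiv_prod e]
  simp only [Equiv.symm_apply_apply, l2_enorm_sq]

theorem left_bound (e : α × β ≃ γ) (A : L2 α →L[ℂ] L2 α) (f : L2 γ) :
    ∑' j, ‖A (sect e f j)‖ₑ ^ 2 ≤ (‖A‖ₑ * ‖f‖ₑ) ^ 2 := by
  rw [mul_pow, ← tsum_sect e, ← ENNReal.tsum_mul_left]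
  refine ENNReal.tsum_le_tsum fun j => ?_
  rw [← mul_pow]
  exact pow_le_pow_left' (A.le_opENorm _) 2

/-- The coordinates of `(A ⊗ 1) f`. -/
def leftFun (e : α × β ≃ γ) (A : L2 α →L[ℂ] L2 α) (f : L2 γ) : L2 γ :=
  ⟨fun c => A (sect e f (e.symm c).2) (e.symm c).1, (l2_memlp_iff _).2 (by
    rw [left_sum]
    exact ne_top_of_le_ne_top (by finiteness) (left_bound e A f))⟩

theorem enorm_leftFun_sq (e : α × β ≃ γ) (A : L2 α →L[ℂ] L2 α) (f : L2 γ) :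
    ‖leftFun e A f‖ₑ ^ 2 = ∑' j, ‖A (sect e f j)‖ₑ ^ 2 := by
  rw [l2_enorm_sq, ← left_sum]
  rfl

/-- The operator `A ⊗ 1`. -/
def leftOp (e : α × β ≃ γ) (A : L2 α →L[ℂ] L2 α) : L2 γ →L[ℂ] L2 γ :=
  LinearMap.mkContinuous
    { toFun := leftFun e A
      map_add' := by
        intro f g
        ext c
        have : ∀ j, sect e (f + g) j = sect e f j + sect e g j := fun j => by ext i; rfl
        rw [lp.coeFn_add, Pi.add_apply]
        simp only [leftFun, this, map_add, lp.coeFn_add, Pi.add_apply]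
      map_smul' := by
        intro z f
        ext c
        have : ∀ j, sect e (z • f) j = z • sect e f j := fun j => by ext i; rfl
        rw [RingHom.id_apply, lp.coeFn_smul, Pi.smul_apply]
        simp only [leftFun, this, map_smul, lp.coeFn_smul, Pi.smul_apply] }
    ‖A‖ (by
      intro f
      have h2 : ‖leftFun e A f‖ₑ ^ 2 ≤ (‖A‖ₑ * ‖f‖ₑ) ^ 2 := by
        rw [enorm_leftFun_sq]; exact left_bound e A f
      have h3 := (ENNReal.pow_le_pow_left_iff two_ne_zero).1 h2
      simp only [enorm_eq_nnnorm] at h3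
      exact_mod_cast h3)

theorem enorm_leftOp_sq (e : α × β ≃ γ) (A : L2 α →L[ℂ] L2 α) (f : L2 γ) :
    ‖leftOp e A f‖ₑ ^ 2 = ∑' j, ‖A (sect e f j)‖ₑ ^ 2 := enorm_leftFun_sq e A f

/-- The operator `A ⊗ B`. -/
def tensOp (e : α × β ≃ γ) (A : L2 α →L[ℂ] L2 α) (B : L2 β →L[ℂ] L2 β) : L2 γ →L[ℂ] L2 γ :=
  leftOp e A * leftOp ((Equiv.prodComm β α).trans e) B

theorem leftOp_tens (e : α × β ≃ γ) (A : L2 α →L[ℂ] L2 α) (x : L2 α) (y : L2 β) :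
    leftOp e A (tens e x y) = tens e (A x) y := by
  ext c
  have : ∀ j, sect e (tens e x y) j = y j • x := fun j => by
    ext i
    simp [sect_apply, tens_apply, mul_comm]
  change A (sect e (tens e x y) (e.symm c).2) (e.symm c).1 = _
  rw [this, map_smul, tens_apply]
  simp [mul_comm]

theorem tens_comm (e : α × β ≃ γ) (x : L2 α) (y : L2 β) :
    tens ((Equiv.prodComm β α).trans e) y x = tens e x y := by
  ext c
  simp [tens_apply, mul_comm]

theorem tensOp_tens (e : α × β ≃ γ) (A : L2 α →L[ℂ] L2 α) (B : L2 β →L[ℂ] L2 β) (x : L2 α)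
    (y : L2 β) : tensOp e A B (tens e x y) = tens e (A x) (B y) := by
  rw [tensOp, mul_apply_eq_comp, ← tens_comm, leftOp_tens, tens_comm, leftOp_tens]

theorem stdBasis_prod (e : α × β ≃ γ) (c : γ) :
    stdBasis γ c = tens e (stdBasis α (e.symm c).1) (stdBasis β (e.symm c).2) := by
  classical
  ext d
  simp only [tens_apply, stdBasis_eval]
  have : d = c ↔ (e.symm d).1 = (e.symm c).1 ∧ (e.symm d).2 = (e.symm c).2 := by
    rw [← Prod.ext_iff, e.symm.injective.eq_iff]
  simp [this, ← ite_and, and_comm]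

theorem tens_op_ext (e : α × β ≃ γ) {K' : Type*} [NormedAddCommGroup K']
    [NormedSpace ℂ K'] {A B : L2 γ →L[ℂ] K'} (h : ∀ x y, A (tens e x y) = B (tens e x y)) :
    A = B :=
  basis_op_ext (stdBasis γ) fun c => by rw [stdBasis_prod e, h]

theorem inner_tens (e : α × β ≃ γ) (x x' : L2 α) (y y' : L2 β) :
    ⟪tens e x y, tens e x' y'⟫_ℂ = ⟪x, x'⟫_ℂ * ⟪y, y'⟫_ℂ := by
  have h1 : Summable fun i => ‖inner ℂ (x i) (x' i)‖ := (lp.summable_inner (𝕜 := ℂ) x x').norm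
  have h2 : Summable fun i => ‖inner ℂ (y i) (y' i)‖ := (lp.summable_inner (𝕜 := ℂ) y y').norm
  rw [lp.inner_eq_tsum, lp.inner_eq_tsum, lp.inner_eq_tsum,
    tsum_mul_tsum_of_summable_norm h1 h2, ← e.tsum_eq]
  refine tsum_congr fun p => ?_
  simp only [tens_apply, Equiv.symm_apply_apply, RCLike.inner_apply, map_mul]
  ring

theorem tens_add_right (e : α × β ≃ γ) (x : L2 α) (y y' : L2 β) :
    tens e x (y + y') = tens e x y + tens e x y' := by
  ext c; simp [tens_apply, mul_add]

theorem tens_zero_left (e : α × β ≃ γ) (y : L2 β) : tens e 0 y = 0 := by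
  ext c; simp [tens_apply]

theorem tens_zero_right (e : α × β ≃ γ) (x : L2 α) : tens e x 0 = 0 := by
  ext c; simp [tens_apply]

theorem tensOp_mul (e : α × β ≃ γ) (A A' : L2 α →L[ℂ] L2 α) (B B' : L2 β →L[ℂ] L2 β) :
    tensOp e A B * tensOp e A' B' = tensOp e (A * A') (B * B') :=
  tens_op_ext e fun x y => by simp [tensOp_tens]

theorem tensOp_one (e : α × β ≃ γ) : tensOp e 1 1 = 1 :=
  tens_op_ext e fun x y => by simp [tensOp_tens]

theorem tensOp_zero_left (e : α × β ≃ γ) (B : L2 β →L[ℂ] L2 β) : tensOp e 0 B = 0 :=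
  tens_op_ext e fun x y => by simp [tensOp_tens, tens_zero_left]

theorem tensOp_sum_right (e : α × β ≃ γ) (A : L2 α →L[ℂ] L2 α) {σ : Type*} (s : Finset σ)
    (B : σ → L2 β →L[ℂ] L2 β) : tensOp e A (∑ a ∈ s, B a) = ∑ a ∈ s, tensOp e A (B a) := by
  classical
  induction s using Finset.induction_on with
  | empty => exact tens_op_ext e fun x y => by simp [tensOp_tens, tens_zero_right]
  | insert a s ha ih =>
    rw [Finset.sum_insert ha, Finset.sum_insert ha, ← ih]
    exact tens_op_ext e fun x y => by simp [tensOp_tens, tens_add_right]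

theorem star_tensOp (e : α × β ≃ γ) (A : L2 α →L[ℂ] L2 α) (B : L2 β →L[ℂ] L2 β) :
    star (tensOp e A B) = tensOp e (star A) (star B) := by
  refine basis_inner_ext (stdBasis γ) fun i j => ?_
  rw [ContinuousLinearMap.star_eq_adjoint, ContinuousLinearMap.adjoint_inner_right]
  simp only [stdBasis_prod e, tensOp_tens, inner_tens]
  simp only [ContinuousLinearMap.star_eq_adjoint, ContinuousLinearMap.adjoint_inner_right]

theorem tensOp_eq_sqrt (e : α × β ≃ γ) {A : L2 α →L[ℂ] L2 α} {B : L2 β →L[ℂ] L2 β} (hA : 0 ≤ A)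
    (hB : 0 ≤ B) : tensOp e A B =
      star (tensOp e (opSqrt A) (opSqrt B)) * tensOp e (opSqrt A) (opSqrt B) := by
  rw [star_tensOp, tensOp_mul, star_opSqrt, star_opSqrt, opSqrt_mul_self hA,
    opSqrt_mul_self hB]

theorem tensOp_nonneg (e : α × β ≃ γ) {A : L2 α →L[ℂ] L2 α} {B : L2 β →L[ℂ] L2 β} (hA : 0 ≤ A)
    (hB : 0 ≤ B) : 0 ≤ tensOp e A B := by
  rw [tensOp_eq_sqrt e hA hB]
  exact star_mul_self_nonneg _

theorem ofReal_inner_tensOp_tens (e : α × β ≃ γ) {A : L2 α →L[ℂ] L2 α} {B : L2 β →L[ℂ] L2 β}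
    (hA : 0 ≤ A) (hB : 0 ≤ B) (x : L2 α) (y : L2 β) :
    ENNReal.ofReal (⟪tens e x y, tensOp e A B (tens e x y)⟫_ℂ).re =
      ENNReal.ofReal (⟪x, A x⟫_ℂ).re * ENNReal.ofReal (⟪y, B y⟫_ℂ).re := by
  rw [tensOp_eq_sqrt e hA hB, ofReal_inner_star_mul, tensOp_tens, enorm_tens_sq,
    ofReal_inner_opSqrt hA, ofReal_inner_opSqrt hB]

/-- For fixed `B` the form of `A ⊗ B` is a sum of forms of `A` at vectors that do not involve `A`.
Hence `A ↦ A ⊗ B` inherits countable additivity when `A` runs through the values of a measurement.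
-/
theorem ofReal_inner_tensOp (e : α × β ≃ γ) {A : L2 α →L[ℂ] L2 α} {B : L2 β →L[ℂ] L2 β}
    (hA : 0 ≤ A) (hB : 0 ≤ B) (f : L2 γ) :
    ENNReal.ofReal (⟪f, tensOp e A B f⟫_ℂ).re = ∑' j, ENNReal.ofReal
      (⟪sect e (tensOp e 1 (opSqrt B) f) j, A (sect e (tensOp e 1 (opSqrt B) f) j)⟫_ℂ).re := by
  rw [tensOp_eq_sqrt e hA hB, ofReal_inner_star_mul]
  have : tensOp e (opSqrt A) (opSqrt B) = leftOp e (opSqrt A) * tensOp e 1 (opSqrt B) :=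
    tens_op_ext e fun x y => by simp [tensOp_tens, leftOp_tens]
  rw [this, mul_apply_eq_comp, enorm_leftOp_sq]
  simp only [ofReal_inner_opSqrt hA]

end TwoFactors

/-! ### Joint measurements on two factors -/

namespace POVM

section Additivity

variable {κ K : Type*} [NormedAddCommGroup K] [InnerProductSpace ℂ K] [CompleteSpace K]
  {X : Type*} [MeasurableSpace X]

theorem nonneg_op_ext {A B : K →L[ℂ] K} (hA : 0 ≤ A) (hB : 0 ≤ B)
    (h : ∀ φ, ENNReal.ofReal (⟪φ, A φ⟫_ℂ).re = ENNReal.ofReal (⟪φ, B φ⟫_ℂ).re) : A = B := by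
  have hpA := (ContinuousLinearMap.nonneg_iff_isPositive _).1 hA
  have hpB := (ContinuousLinearMap.nonneg_iff_isPositive _).1 hB
  have key : ∀ φ, ⟪A φ, φ⟫_ℂ = ⟪B φ, φ⟫_ℂ := fun φ => by
    have h1 := (ENNReal.ofReal_eq_ofReal_iff (re_inner_nonneg_op hA φ)
      (re_inner_nonneg_op hB φ)).1 (h φ)
    rw [show ⟪A φ, φ⟫_ℂ = ⟪φ, A φ⟫_ℂ from hpA.isSelfAdjoint.isSymmetric φ φ,
      show ⟪B φ, φ⟫_ℂ = ⟪φ, B φ⟫_ℂ from hpB.isSelfAdjoint.isSymmetric φ φ]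
    have hA' : (((⟪φ, A φ⟫_ℂ).re : ℝ) : ℂ) = ⟪φ, A φ⟫_ℂ :=
      hpA.isSelfAdjoint.isSymmetric.coe_re_inner_self_apply φ
    have hB' : (((⟪φ, B φ⟫_ℂ).re : ℝ) : ℂ) = ⟪φ, B φ⟫_ℂ :=
      hpB.isSelfAdjoint.isSymmetric.coe_re_inner_self_apply φ
    rw [← hA', ← hB', h1]
  have : (A : K →ₗ[ℂ] K) = B := ext_inner_map (A : K →ₗ[ℂ] K) B |>.1 key
  exact ContinuousLinearMap.coe_injective this

/-- Finite additivity of the measurement, read off from the scalar measures of its quadratic forms.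
-/
theorem sum_op_fibers {E : Type*} (F : POVM X K) (v : SimpleFunc X E) (B : Set E)
    [DecidablePred (· ∈ B)] :
    ∑ y ∈ v.range with y ∈ B, F.op (v ⁻¹' {y}) = F.op (v ⁻¹' B) := by
  refine nonneg_op_ext (Finset.sum_nonneg fun y _ => F.pos _ (v.measurableSet_fiber y))
    (F.pos _ (v.measurableSet_preimage B)) fun φ => ?_
  rw [← F.vecMeasure_apply φ (v.measurableSet_preimage B), sum_apply, inner_sum,
    Complex.re_sum, ENNReal.ofReal_sum_of_nonneg fun y _ => F.re_nonneg (v.measurableSet_fiber y) φ]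
  simp only [← F.vecMeasure_apply φ (v.measurableSet_fiber _)]
  rw [sum_measure_preimage_singleton _ fun y _ => v.measurableSet_fiber y]
  congr 1
  ext x
  simp

end Additivity

section Product

variable {α β γ : Type*} {X Y E : Type*} [MeasurableSpace X] [MeasurableSpace Y]
  [MeasurableSpace E]

/-- The joint measurement of `M` on the first factor and the simple function `v` of the data of `F`
on the second factor. -/
def prodSimple (e : α × β ≃ γ) (M : POVM X (L2 α)) (F : POVM Y (L2 β)) (v : SimpleFunc Y E) :
    POVM (X × E) (L2 γ) :=
  -- Since `v` has finitely many values, the joint measurement is a finite sum over them, each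
  -- summand being a measurement on the first factor weighted by a fixed operator on the second. No
  -- extension from rectangles is needed.
  ofDiag (fun Δ => ∑ y ∈ v.range, tensOp e (M.op ((fun x => (x, y)) ⁻¹' Δ)) (F.op (v ⁻¹' {y})))
    (fun Δ hΔ => Finset.sum_nonneg fun y _ => tensOp_nonneg e (M.pos _ (measurable_prodMk_right hΔ))
      (F.pos _ (v.measurableSet_fiber y)))
    (by
      classical
      have := sum_op_fibers F v Set.univ
      simp only [Set.mem_univ, Finset.filter_true, Set.preimage_univ] at this
      simp only [Set.preimage_univ, M.univ, ← tensOp_sum_right, this, F.univ, tensOp_one])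
    (by
      intro Δ hm hd f
      have key : ∀ Δ, MeasurableSet Δ → ENNReal.ofReal (⟪f, (∑ y ∈ v.range,
          tensOp e (M.op ((fun x => (x, y)) ⁻¹' Δ)) (F.op (v ⁻¹' {y}))) f⟫_ℂ).re =
          ∑ y ∈ v.range, ∑' j, M.vecMeasure (sect e (tensOp e 1
            (opSqrt (F.op (v ⁻¹' {y}))) f) j) ((fun x => (x, y)) ⁻¹' Δ) := by
        intro Δ hΔ
        rw [sum_apply, inner_sum, Complex.re_sum,
          ENNReal.ofReal_sum_of_nonneg fun y _ => re_inner_nonneg_op (tensOp_nonneg e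
            (M.pos _ (measurable_prodMk_right hΔ)) (F.pos _ (v.measurableSet_fiber y))) f]
        refine Finset.sum_congr rfl fun y _ => ?_
        rw [ofReal_inner_tensOp e (M.pos _ (measurable_prodMk_right hΔ))
          (F.pos _ (v.measurableSet_fiber y))]
        simp only [vecMeasure_apply _ _ (measurable_prodMk_right hΔ)]
      simp only [key _ (hm _), key _ (MeasurableSet.iUnion hm)]
      rw [Summable.tsum_finsetSum fun _ _ => ENNReal.summable]
      refine Finset.sum_congr rfl fun y _ => ?_
      rw [ENNReal.tsum_comm]
      refine tsum_congr fun j => ?_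
      rw [Set.preimage_iUnion, measure_iUnion]
      · exact fun i j hij => (hd hij).preimage _
      · exact fun k => measurable_prodMk_right (hm k))

theorem prodSimple_op_prod (e : α × β ≃ γ) (M : POVM X (L2 α)) (F : POVM Y (L2 β))
    (v : SimpleFunc Y E) (S : Set X) (B : Set E) :
    (prodSimple e M F v).op (S ×ˢ B) = tensOp e (M.op S) (F.op (v ⁻¹' B)) := by
  classical
  change ∑ y ∈ v.range, tensOp e (M.op ((fun x => (x, y)) ⁻¹' (S ×ˢ B))) (F.op (v ⁻¹' {y})) = _
  rw [← sum_op_fibers F v B, tensOp_sum_right, Finset.sum_filter]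
  refine Finset.sum_congr rfl fun y _ => ?_
  by_cases hy : y ∈ B
  · simp [hy]
  · simp [hy, op_empty, tensOp_zero_left]

/-- A product measure is determined by its values on rectangles. There the factorized form of the
state turns the law into a double sum over product basis vectors, which splits. -/
theorem prodSimple_law (e : α × β ≃ γ) (M : POVM X (L2 α)) (F : POVM Y (L2 β))
    (v : SimpleFunc Y E) (A : L2 α →L[ℂ] L2 α) (B : L2 β →L[ℂ] L2 β)
    (hv : Measurable v) [SigmaFinite (M.law (stdBasis α) (A * star A))]
    [SigmaFinite ((F.law (stdBasis β) (B * star B)).map v)] :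
    (prodSimple e M F v).law (stdBasis γ) (tensOp e (A * star A) (B * star B)) =
      (M.law (stdBasis α) (A * star A)).prod ((F.law (stdBasis β) (B * star B)).map v) := by
  symm
  refine Measure.prod_eq fun S U hS hU => ?_
  have : tensOp e (A * star A) (B * star B) = tensOp e A B * star (tensOp e A B) := by
    rw [star_tensOp, tensOp_mul]
  rw [this, law_mul_star _ _ _ (hS.prod hU), Measure.map_apply hv hU, law_mul_star _ _ _ hS,
    law_mul_star _ _ _ (hv hU), tsum_equiv_prod e, ENNReal.tsum_comm, ← ENNReal.tsum_mul_right]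
  refine tsum_congr fun i => ?_
  rw [← ENNReal.tsum_mul_left]
  refine tsum_congr fun j => ?_
  rw [prodSimple_op_prod, stdBasis_prod e, tensOp_tens,
    ofReal_inner_tensOp_tens e (M.pos _ hS) (F.pos _ (hv hU))]
  simp

end Product

end POVM

/-! ### Combining estimators -/

section Estimators

variable {ι H : Type*} [NormedAddCommGroup H] [InnerProductSpace ℂ H]

theorem tprod_append (b : HilbertBasis ι ℂ H) {a c : ℕ} (v : Fin (a + c) → H) :
    tprod b v = tens (Fin.appendEquiv a c) (tprod b fun k => v (Fin.castAdd c k))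
      (tprod b fun k => v (Fin.natAdd a k)) := by
  ext i
  simp [tens_apply, tprod, Fin.prod_univ_add, Fin.appendEquiv]

/-- Concatenation of multi-indices identifies the tensor power of order `a + c` with the product of
those of orders `a` and `c`; on product vectors the two operators agree. -/
theorem tensorOp_append (b : HilbertBasis ι ℂ H) {a c : ℕ} (A : Fin (a + c) → H →L[ℂ] H) :
    tensorOp b A = tensOp (Fin.appendEquiv a c) (tensorOp b fun k => A (Fin.castAdd c k))
      (tensorOp b fun k => A (Fin.natAdd a k)) :=
  tensor_op_ext b fun v => by
    rw [tensorOp_tprod, tprod_append, tprod_append b v, tensOp_tens, tensorOp_tprod,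
      tensorOp_tprod]

/-- The distribution of the estimate when the systems are in the (unnormalized) state `τ`. -/
def Estimator.distOp {n m : ℕ} (E : Estimator ι n m) (τ : TensorPower ι n →L[ℂ] TensorPower ι n) :
    Measure (EuclideanSpace ℝ (Fin m)) :=
  (E.M.law (tensorBasis ι n) τ).map E.T

/-- The distribution of the estimate when each system is in the state `σ`. -/
abbrev Estimator.dist (b : HilbertBasis ι ℂ H) {n m : ℕ} (E : Estimator ι n m) (σ : H →L[ℂ] H) :
    Measure (EuclideanSpace ℝ (Fin m)) :=
  E.distOp (tensorOp b fun _ => σ)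

/-- The estimator with measurement `M` and estimate `T`. -/
def Estimator.ofPOVM {n m : ℕ} {X : Type*} [MeasurableSpace X] (M : POVM X (TensorPower ι n))
    (T : X → EuclideanSpace ℝ (Fin m)) (hT : Measurable T) : Estimator ι n m where
  -- The measurement is pushed forward along the estimate, so the data are the estimate itself and
  -- live in a Euclidean space whatever `X` is.
  l := m
  M := M.map (fun x => (T x).ofLp) (by fun_prop)
  T := WithLp.toLp 2
  measurable_T := by fun_prop

theorem Estimator.ofPOVM_distOp {n m : ℕ} {X : Type*} [MeasurableSpace X]
    (M : POVM X (TensorPower ι n)) (T : X → EuclideanSpace ℝ (Fin m)) (hT : Measurable T)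
    {τ : TensorPower ι n →L[ℂ] TensorPower ι n} (hτ : 0 ≤ τ) :
    (Estimator.ofPOVM M T hT).distOp τ = (M.law (tensorBasis ι n) τ).map T := by
  have hT' : Measurable fun x => (T x).ofLp := by fun_prop
  change ((M.map (fun x => (T x).ofLp) hT').law (tensorBasis ι n) τ).map (WithLp.toLp 2) = _
  rw [POVM.map_law _ _ _ _ hτ, Measure.map_map (by fun_prop) (by fun_prop)]
  rfl

/-- The estimator with the same measurement and a function of the estimate as its estimate. -/
def Estimator.comp {n m : ℕ} (E : Estimator ι n m)
    (φ : EuclideanSpace ℝ (Fin m) → EuclideanSpace ℝ (Fin m)) (hφ : Measurable φ) :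
    Estimator ι n m where
  l := E.l
  M := E.M
  T := φ ∘ E.T
  measurable_T := hφ.comp E.measurable_T

theorem Estimator.comp_distOp {n m : ℕ} (E : Estimator ι n m)
    (φ : EuclideanSpace ℝ (Fin m) → EuclideanSpace ℝ (Fin m)) (hφ : Measurable φ)
    (τ : TensorPower ι n →L[ℂ] TensorPower ι n) :
    (E.comp φ hφ).distOp τ = (E.distOp τ).map φ :=
  (Measure.map_map hφ E.measurable_T).symm

/-- The estimate is a simple function. -/
def Estimator.IsFinite {n m : ℕ} (E : Estimator ι n m) : Prop := (Set.range E.T).Finite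

theorem Estimator.IsFinite.comp {n m : ℕ} {E : Estimator ι n m} (h : E.IsFinite)
    (φ : EuclideanSpace ℝ (Fin m) → EuclideanSpace ℝ (Fin m)) (hφ : Measurable φ) :
    (E.comp φ hφ).IsFinite := by
  change (Set.range (φ ∘ E.T)).Finite
  rw [Set.range_comp]
  exact h.image φ

theorem Estimator.IsFinite.exists_bound {n m : ℕ} {E : Estimator ι n m} (h : E.IsFinite) :
    ∃ K, ∀ ω, ‖E.T ω‖ ≤ K := by
  obtain ⟨K, hK⟩ := h.isBounded.exists_norm_le
  exact ⟨K, fun ω => hK _ ⟨ω, rfl⟩⟩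

theorem Estimator.IsFinite.condE' {n m : ℕ} {E : Estimator ι n m} (h : E.IsFinite) :
    CondE' E := by
  obtain ⟨C, hC⟩ := Metric.isBounded_iff.1 h.isBounded
  exact ⟨Set.range E.T, fun ω => ⟨ω, rfl⟩, C, fun x hx y hy => by
    rw [← dist_eq_norm]; exact hC hx hy⟩

section Complete

variable [CompleteSpace H]

theorem isFiniteMeasure_law {κ K : Type*} [NormedAddCommGroup K] [InnerProductSpace ℂ K]
    [CompleteSpace K] (b : HilbertBasis κ ℂ K) {X : Type*} [MeasurableSpace X] (M : POVM X K)
    {τ : K →L[ℂ] K} (hτ : 0 ≤ τ) (h : traceE b τ ≠ ∞) : IsFiniteMeasure (M.law b τ) :=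
  ⟨by rw [M.law_univ b hτ]; exact h.lt_top⟩

theorem Estimator.distOp_univ {n m : ℕ} (E : Estimator ι n m)
    {τ : TensorPower ι n →L[ℂ] TensorPower ι n} (hτ : 0 ≤ τ) :
    E.distOp τ Set.univ = traceE (tensorBasis ι n) τ := by
  rw [Estimator.distOp, Measure.map_apply E.measurable_T .univ, Set.preimage_univ,
    E.M.law_univ _ hτ]

theorem Estimator.distOp_add {n m : ℕ} (E : Estimator ι n m)
    {τ τ' : TensorPower ι n →L[ℂ] TensorPower ι n} (hτ : 0 ≤ τ) (hτ' : 0 ≤ τ') :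
    E.distOp (τ + τ') = E.distOp τ + E.distOp τ' := by
  rw [Estimator.distOp, E.M.law_add _ hτ hτ', Measure.map_add _ _ E.measurable_T]
  rfl

theorem Estimator.distOp_sum {n m : ℕ} (E : Estimator ι n m) {α : Type*} (s : Finset α)
    (τ : α → TensorPower ι n →L[ℂ] TensorPower ι n) (hτ : ∀ a, 0 ≤ τ a) :
    E.distOp (∑ a ∈ s, τ a) = ∑ a ∈ s, E.distOp (τ a) := by
  classical
  induction s using Finset.induction_on with
  | empty => simp [Estimator.distOp, POVM.law_zero]
  | insert a s ha ih =>
    rw [Finset.sum_insert ha, Finset.sum_insert ha,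
      E.distOp_add (hτ a) (Finset.sum_nonneg fun c _ => hτ c), ih]

theorem Estimator.isProbabilityMeasure_dist (b : HilbertBasis ι ℂ H) {n m : ℕ}
    (E : Estimator ι n m) {σ : H →L[ℂ] H} (hσ : IsDensity b σ) :
    IsProbabilityMeasure (E.dist b σ) :=
  ⟨by rw [E.distOp_univ (tensorOp_nonneg b fun _ => hσ.1), traceE_tensorOp_density b hσ]⟩

/-- The sum of an estimator on `a` further systems and a finite valued one on `c` systems. -/
def Estimator.add {a c m : ℕ} (E : Estimator ι a m) (F : Estimator ι c m) (hF : F.IsFinite) :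
    Estimator ι (a + c) m :=
  Estimator.ofPOVM (POVM.prodSimple (Fin.appendEquiv a c) E.M F.M
    ⟨F.T, fun y => F.measurable_T (measurableSet_singleton y), hF⟩)
    (fun p => E.T p.1 + p.2) ((E.measurable_T.comp measurable_fst).add measurable_snd)

/-- Measurements on separate systems in a product state are independent, so the sum of the estimates
is distributed by a convolution. The factors may differ from slot to slot, since derivatives of the
state change one of them. -/
theorem Estimator.add_distOp (b : HilbertBasis ι ℂ H) {a c m : ℕ} (E : Estimator ι a m)
    (F : Estimator ι c m) (hF : F.IsFinite) {A : Fin (a + c) → H →L[ℂ] H} (hA : ∀ k, 0 ≤ A k)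
    (hA' : ∀ k, traceE b (A k) ≠ ∞) :
    (E.add F hF).distOp (tensorOp b A) =
      ((E.distOp (tensorOp b fun k => A (Fin.castAdd c k))).prod
        (F.distOp (tensorOp b fun k => A (Fin.natAdd a k)))).map fun p => p.1 + p.2 := by
  have h1 := tensorOp_eq_sqrt b fun k => hA (Fin.castAdd c k)
  have h2 := tensorOp_eq_sqrt b fun k => hA (Fin.natAdd a k)
  have hfin : ∀ {d : ℕ} {B : Fin d → H →L[ℂ] H}, (∀ k, 0 ≤ B k) → (∀ k, traceE b (B k) ≠ ∞) →
      ∀ {X : Type} [MeasurableSpace X] (M : POVM X (TensorPower ι d)),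
      IsFiniteMeasure (M.law (tensorBasis ι d) (tensorOp b B)) := fun hB hB' X _ M =>
    isFiniteMeasure_law _ M (tensorOp_nonneg b hB) (by
      rw [traceE_tensorOp b hB]; exact ENNReal.prod_ne_top fun k _ => hB' k)
  have i1 := hfin (fun k => hA (Fin.castAdd c k)) (fun k => hA' _) E.M
  have i2 := hfin (fun k => hA (Fin.natAdd a k)) (fun k => hA' _) F.M
  rw [Estimator.add, Estimator.ofPOVM_distOp _ _ _ (tensorOp_nonneg b hA), tensorOp_append]
  rw [h1] at i1 ⊢
  rw [h2] at i2 ⊢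
  set v : SimpleFunc (Fin F.l → ℝ) (EuclideanSpace ℝ (Fin m)) :=
    ⟨F.T, fun y => F.measurable_T (measurableSet_singleton y), hF⟩
  have hv : Measurable v := F.measurable_T
  rw [POVM.prodSimple_law _ _ _ v _ _ hv, Estimator.distOp, Estimator.distOp]
  have : (fun p : (Fin E.l → ℝ) × EuclideanSpace ℝ (Fin m) => E.T p.1 + p.2) =
      (fun p => p.1 + p.2) ∘ Prod.map E.T id := rfl
  rw [this, ← Measure.map_map (by fun_prop) (E.measurable_T.prodMap measurable_id),
    ← Measure.map_prod_map _ _ E.measurable_T measurable_id, Measure.map_id]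
  rfl

theorem Estimator.add_dist (b : HilbertBasis ι ℂ H) {a c m : ℕ} (E : Estimator ι a m)
    (F : Estimator ι c m) (hF : F.IsFinite) {σ : H →L[ℂ] H} (hσ : IsDensity b σ) :
    (E.add F hF).dist b σ = ((E.dist b σ).prod (F.dist b σ)).map fun p => p.1 + p.2 :=
  E.add_distOp b F hF (fun _ => hσ.1) fun _ => by rw [hσ.2]; exact ENNReal.one_ne_top

/-- This is the Leibniz rule: the slot carrying `D` lies either in the first block or in the second,
and the other block is then in the unmodified state. -/
theorem Estimator.add_distOp_tensorSum (b : HilbertBasis ι ℂ H) {a c m : ℕ} (E : Estimator ι a m)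
    (F : Estimator ι c m) (hF : F.IsFinite) {σ D : H →L[ℂ] H} (hσ : IsDensity b σ) (hD : 0 ≤ D)
    (hD' : traceE b D ≠ ∞) :
    (E.add F hF).distOp (tensorSum b (a + c) σ D) =
      (((E.distOp (tensorSum b a σ D)).prod (F.dist b σ)).map fun p => p.1 + p.2) +
      (((E.dist b σ).prod (F.distOp (tensorSum b c σ D))).map fun p => p.1 + p.2) := by
  have hu : ∀ {d : ℕ} (k l : Fin d), traceE b (Function.update (fun _ => σ) k D l) ≠ ∞ := by
    intro d k l
    by_cases h : l = k
    · subst h; simpa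
    · simp [h, hσ.2]
  have i0 : ∀ {d : ℕ} (F : Estimator ι d m) (k : Fin d),
      IsFiniteMeasure (F.distOp (tensorOp b (Function.update (fun _ => σ) k D))) :=
    fun F k => ⟨by
      rw [F.distOp_univ (tensorOp_nonneg b (update_nonneg hσ.1 hD k)), traceE_update b hσ hD]
      exact hD'.lt_top⟩
  have i1 := E.isProbabilityMeasure_dist b hσ
  have i2 := F.isProbabilityMeasure_dist b hσ
  have hm : Measurable fun p : EuclideanSpace ℝ (Fin m) × EuclideanSpace ℝ (Fin m) =>
    p.1 + p.2 := by fun_prop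
  simp only [tensorSum]
  rw [Estimator.distOp_sum _ _ _ fun k => tensorOp_nonneg b (update_nonneg hσ.1 hD k),
    Estimator.distOp_sum _ _ _ fun k => tensorOp_nonneg b (update_nonneg hσ.1 hD k),
    Estimator.distOp_sum _ _ _ fun k => tensorOp_nonneg b (update_nonneg hσ.1 hD k),
    Fin.sum_univ_add]
  simp only [E.add_distOp b F hF (update_nonneg hσ.1 hD _) (hu _)]
  have e1 : ∀ k : Fin a, (fun l : Fin a => Function.update (fun _ : Fin (a + c) => σ)
      (Fin.castAdd c k) D (Fin.castAdd c l)) = Function.update (fun _ => σ) k D := fun k => by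
    ext1 l; simp [Function.update_apply]
  have e2 : ∀ k : Fin a, (fun l : Fin c => Function.update (fun _ : Fin (a + c) => σ)
      (Fin.castAdd c k) D (Fin.natAdd a l)) = fun _ => σ := fun k => by
    ext1 l
    rw [Function.update_of_ne]
    simp [Fin.ext_iff]; omega
  have e3 : ∀ k : Fin c, (fun l : Fin c => Function.update (fun _ : Fin (a + c) => σ)
      (Fin.natAdd a k) D (Fin.natAdd a l)) = Function.update (fun _ => σ) k D := fun k => by
    ext1 l; simp [Function.update_apply]
  have e4 : ∀ k : Fin c, (fun l : Fin a => Function.update (fun _ : Fin (a + c) => σ)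
      (Fin.natAdd a k) D (Fin.castAdd c l)) = fun _ => σ := fun k => by
    ext1 l
    rw [Function.update_of_ne]
    simp [Fin.ext_iff]; omega
  simp only [e1, e2, e3, e4]
  congr 1
  · rw [← Measure.sum_fintype, ← Measure.sum_fintype, Measure.prod_sum_left,
      Measure.map_sum hm.aemeasurable]
  · rw [← Measure.sum_fintype, ← Measure.sum_fintype, Measure.prod_sum_right,
      Measure.map_sum hm.aemeasurable]

end Complete

end Estimators

/-! ### Moments of estimators -/

section Moments

variable {m : ℕ}

theorem enn_add_sq_le (a b : ℝ≥0∞) : (a + b) ^ 2 ≤ 2 * a ^ 2 + 2 * b ^ 2 := by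
  induction a with
  | top => simp
  | coe a =>
    induction b with
    | top => simp
    | coe b =>
      rw [← mul_add]
      exact_mod_cast add_sq_le (a := (a : ℝ)) (b := (b : ℝ))

theorem coord_abs_le (x : EuclideanSpace ℝ (Fin m)) (i : Fin m) : |x i| ≤ ‖x‖ :=
  PiLp.norm_apply_le x i

theorem memLp_coord {μ : Measure (EuclideanSpace ℝ (Fin m))} (h : MemLp (fun x => x) 2 μ)
    (i : Fin m) : MemLp (fun x => x i) 2 μ :=
  h.of_le (by fun_prop) (.of_forall fun x => coord_abs_le x i)

theorem memLp_two_iff {μ : Measure (EuclideanSpace ℝ (Fin m))} :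
    MemLp (fun x => x) 2 μ ↔ ∫⁻ x, ‖x‖ₑ ^ 2 ∂μ < ∞ := by
  rw [memLp_two_iff_integrable_sq_norm (by fun_prop), Integrable, hasFiniteIntegral_iff_enorm]
  simp only [enorm_pow, enorm_norm]
  exact and_iff_right (by fun_prop)

/-- The covariance matrix of a distribution. -/
def covM (μ : Measure (EuclideanSpace ℝ (Fin m))) : Matrix (Fin m) (Fin m) ℝ :=
  Matrix.of fun i j => ∫ x, (x i - ∫ y, y i ∂μ) * (x j - ∫ y, y j ∂μ) ∂μ

variable {μ ν : Measure (EuclideanSpace ℝ (Fin m))} [IsProbabilityMeasure μ]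
  [IsProbabilityMeasure ν]

theorem measurable_addPair : Measurable fun p : EuclideanSpace ℝ (Fin m) ×
    EuclideanSpace ℝ (Fin m) => p.1 + p.2 := by fun_prop

theorem mean_conv (hμ : MemLp (fun x => x) 2 μ) (hν : MemLp (fun x => x) 2 ν) (i : Fin m) :
    ∫ z, z i ∂((μ.prod ν).map fun p => p.1 + p.2) = ∫ x, x i ∂μ + ∫ x, x i ∂ν := by
  have h1 := (memLp_coord hμ i).integrable one_le_two
  have h2 := (memLp_coord hν i).integrable one_le_two
  rw [integral_map (by fun_prop) (by fun_prop)]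
  simp only [PiLp.add_apply]
  rw [integral_add (h1.comp_fst ν) (h2.comp_snd μ),
    integral_fun_fst fun x : EuclideanSpace ℝ (Fin m) => x i,
    integral_fun_snd fun x : EuclideanSpace ℝ (Fin m) => x i]
  simp

theorem covM_conv (hμ : MemLp (fun x => x) 2 μ) (hν : MemLp (fun x => x) 2 ν) :
    covM ((μ.prod ν).map fun p => p.1 + p.2) = covM μ + covM ν := by
  ext i j
  simp only [covM, Matrix.of_apply, Matrix.add_apply, mean_conv hμ hν]
  rw [integral_map (by fun_prop) (by fun_prop)]
  set u : Fin m → EuclideanSpace ℝ (Fin m) → ℝ := fun i x => x i - ∫ y, y i ∂μ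
  set w : Fin m → EuclideanSpace ℝ (Fin m) → ℝ := fun i x => x i - ∫ y, y i ∂ν
  have hu : ∀ i, MemLp (u i) 2 μ := fun i => (memLp_coord hμ i).sub (memLp_const _)
  have hw : ∀ i, MemLp (w i) 2 ν := fun i => (memLp_coord hν i).sub (memLp_const _)
  have hu1 : ∀ i, Integrable (u i) μ := fun i => (hu i).integrable one_le_two
  have hw1 : ∀ i, Integrable (w i) ν := fun i => (hw i).integrable one_le_two
  have hu0 : ∀ i, ∫ x, u i x ∂μ = 0 := fun i => by
    rw [integral_sub ((memLp_coord hμ i).integrable one_le_two) (integrable_const _)]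
    simp
  have e : ∀ p : EuclideanSpace ℝ (Fin m) × EuclideanSpace ℝ (Fin m),
      ((p.1 + p.2) i - (∫ x, x i ∂μ + ∫ x, x i ∂ν)) *
        ((p.1 + p.2) j - (∫ x, x j ∂μ + ∫ x, x j ∂ν)) =
      (u i p.1 * u j p.1 + w i p.2 * w j p.2) + (u i p.1 * w j p.2 + u j p.1 * w i p.2) := by
    intro p
    simp only [u, w, PiLp.add_apply]
    ring
  simp only [e]
  have i1 : Integrable (fun p : EuclideanSpace ℝ (Fin m) × EuclideanSpace ℝ (Fin m) =>
      u i p.1 * u j p.1) (μ.prod ν) := ((hu i).integrable_mul (hu j)).comp_fst ν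
  have i2 : Integrable (fun p : EuclideanSpace ℝ (Fin m) × EuclideanSpace ℝ (Fin m) =>
      w i p.2 * w j p.2) (μ.prod ν) := ((hw i).integrable_mul (hw j)).comp_snd μ
  have i3 : ∀ i j, Integrable (fun p : EuclideanSpace ℝ (Fin m) × EuclideanSpace ℝ (Fin m) =>
      u i p.1 * w j p.2) (μ.prod ν) := fun i j => (hu1 i).mul_prod (hw1 j)
  have i4 : Integrable (fun p : EuclideanSpace ℝ (Fin m) × EuclideanSpace ℝ (Fin m) =>
      u i p.1 * u j p.1 + w i p.2 * w j p.2) (μ.prod ν) := i1.add i2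
  have i5 : Integrable (fun p : EuclideanSpace ℝ (Fin m) × EuclideanSpace ℝ (Fin m) =>
      u i p.1 * w j p.2 + u j p.1 * w i p.2) (μ.prod ν) := (i3 i j).add (i3 j i)
  rw [integral_add i4 i5, integral_add i1 i2, integral_add (i3 i j) (i3 j i),
    integral_prod_mul, integral_prod_mul, hu0, hu0, integral_fun_fst fun x => u i x * u j x,
    integral_fun_snd fun x => w i x * w j x]
  simp [u, w]

/-- The affine map `x ↦ A x + c`. -/
def affMap (A : Matrix (Fin m) (Fin m) ℝ) (c x : EuclideanSpace ℝ (Fin m)) :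
    EuclideanSpace ℝ (Fin m) := WithLp.toLp 2 (A.mulVec x.ofLp) + c

theorem affMap_apply (A : Matrix (Fin m) (Fin m) ℝ) (c x : EuclideanSpace ℝ (Fin m))
    (i : Fin m) : affMap A c x i = ∑ j, A i j * x j + c i := rfl

theorem measurable_affMap (A : Matrix (Fin m) (Fin m) ℝ) (c : EuclideanSpace ℝ (Fin m)) :
    Measurable (affMap A c) := by
  have : Continuous (affMap A c) := by
    unfold affMap
    fun_prop
  exact this.measurable

theorem mean_aff (hμ : MemLp (fun x => x) 2 μ) (A : Matrix (Fin m) (Fin m) ℝ)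
    (c : EuclideanSpace ℝ (Fin m)) (i : Fin m) :
    ∫ x, x i ∂(μ.map (affMap A c)) = ∑ j, A i j * ∫ x, x j ∂μ + c i := by
  rw [integral_map (measurable_affMap A c).aemeasurable (by fun_prop)]
  simp only [affMap_apply]
  have h : ∀ j, Integrable (fun x : EuclideanSpace ℝ (Fin m) => A i j * x j) μ := fun j =>
    ((memLp_coord hμ j).integrable one_le_two).const_mul _
  rw [integral_add (integrable_finsetSum _ fun j _ => h j) (integrable_const _),
    integral_finsetSum _ fun j _ => h j]
  simp [integral_const_mul]

theorem covM_aff (hμ : MemLp (fun x => x) 2 μ) (A : Matrix (Fin m) (Fin m) ℝ)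
    (c : EuclideanSpace ℝ (Fin m)) : covM (μ.map (affMap A c)) = A * covM μ * A.transpose := by
  ext i j
  simp only [covM, Matrix.of_apply, mean_aff hμ]
  rw [integral_map (measurable_affMap A c).aemeasurable (by fun_prop)]
  set u : Fin m → EuclideanSpace ℝ (Fin m) → ℝ := fun i x => x i - ∫ y, y i ∂μ with hudef
  have hu : ∀ i, MemLp (u i) 2 μ := fun i => (memLp_coord hμ i).sub (memLp_const _)
  have e : ∀ x i, affMap A c x i - (∑ j, A i j * ∫ x, x j ∂μ + c i) = ∑ k, A i k * u k x := by
    intro x i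
    simp only [affMap_apply, u, mul_sub, Finset.sum_sub_distrib]
    ring
  simp only [e, Finset.sum_mul_sum]
  have h : ∀ k l, Integrable (fun x => A i k * u k x * (A j l * u l x)) μ := fun k l => by
    have := ((hu k).integrable_mul (hu l)).const_mul (A i k * A j l)
    refine this.congr (.of_forall fun x => ?_)
    simp only [Pi.mul_apply]; ring
  rw [integral_finsetSum _ fun k _ => integrable_finsetSum _ fun l _ => h k l]
  simp only [integral_finsetSum _ fun l _ => h _ l]
  simp only [Matrix.mul_apply, Matrix.of_apply, Matrix.transpose_apply, Finset.sum_mul]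
  rw [Finset.sum_comm]
  refine Finset.sum_congr rfl fun k _ => Finset.sum_congr rfl fun l _ => ?_
  rw [mul_right_comm, ← integral_const_mul]
  refine integral_congr_ae (.of_forall fun x => ?_)
  simp only [hudef]; ring

/-- The mean minimizes the mean square deviation, which handles the diagonal; off the diagonal a
product is at most half the sum of the squares. -/
theorem covM_abs_le (hμ : MemLp (fun x => x) 2 μ) (θ : EuclideanSpace ℝ (Fin m)) (i j : Fin m) :
    |covM μ i j| ≤ ∫ x, ‖x - θ‖ ^ 2 ∂μ := by
  have hc : ∀ i (c : ℝ), MemLp (fun x : EuclideanSpace ℝ (Fin m) => x i - c) 2 μ :=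
    fun i c => (memLp_coord hμ i).sub (memLp_const _)
  have hθ : Integrable (fun x => ‖x - θ‖ ^ 2) μ :=
    (hμ.sub (memLp_const θ)).integrable_norm_pow two_ne_zero
  have hsq : ∀ i (c : ℝ), Integrable (fun x : EuclideanSpace ℝ (Fin m) => (x i - c) ^ 2) μ :=
    fun i c => (hc i c).integrable_sq
  have key : ∀ i, ∫ x, (x i - ∫ y, y i ∂μ) ^ 2 ∂μ ≤ ∫ x, ‖x - θ‖ ^ 2 ∂μ := by
    intro i
    have h1 : ∫ x, (x i - ∫ y, y i ∂μ) ^ 2 ∂μ ≤ ∫ x, (x i - θ i) ^ 2 ∂μ := by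
      have hi := (memLp_coord hμ i).integrable one_le_two
      set a := ∫ y, y i ∂μ with ha
      have : ∀ x : EuclideanSpace ℝ (Fin m), (x i - θ i) ^ 2 =
          (x i - a) ^ 2 + (2 * (a - θ i) * (x i - a) + (a - θ i) ^ 2) := fun x => by ring
      simp only [this]
      have j1 : Integrable (fun x : EuclideanSpace ℝ (Fin m) => 2 * (a - θ i) * (x i - a)) μ :=
        (hi.sub (integrable_const a)).const_mul _
      have j2 : Integrable (fun x : EuclideanSpace ℝ (Fin m) =>
        2 * (a - θ i) * (x i - a) + (a - θ i) ^ 2) μ := j1.add (integrable_const _)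
      rw [integral_add (hsq i a) j2, integral_add j1
        (integrable_const _), integral_const_mul, integral_sub hi (integrable_const a)]
      simp [← ha, sq_nonneg]
    refine h1.trans (integral_mono (hsq i _) hθ fun x => ?_)
    have := coord_abs_le (x - θ) i
    exact sq_le_sq.2 (by simpa using this)
  rw [covM, Matrix.of_apply]
  rw [← Real.norm_eq_abs]
  refine (norm_integral_le_integral_norm (μ := μ) _).trans ?_
  have h2 : ∀ x : EuclideanSpace ℝ (Fin m), ‖(x i - ∫ y, y i ∂μ) * (x j - ∫ y, y j ∂μ)‖ ≤
      ((x i - ∫ y, y i ∂μ) ^ 2 + (x j - ∫ y, y j ∂μ) ^ 2) / 2 := fun x => by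
    rw [Real.norm_eq_abs, abs_mul]
    nlinarith [sq_nonneg (|x i - ∫ y, y i ∂μ| - |x j - ∫ y, y j ∂μ|),
      sq_abs (x i - ∫ y, y i ∂μ), sq_abs (x j - ∫ y, y j ∂μ)]
  refine (integral_mono ((hc i _).integrable_mul (hc j _)).norm
    (((hsq i _).add (hsq j _)).div_const 2) h2).trans ?_
  rw [integral_div, integral_add' (hsq i _) (hsq j _)]
  linarith [key i, key j]

/-- The decomposition of the error into variance and squared bias; the cross terms integrate to
zero. -/
theorem mse_eq (hμ : MemLp (fun x => x) 2 μ) (θ : EuclideanSpace ℝ (Fin m)) :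
    (Matrix.of fun i j => ∫ x, (x i - θ i) * (x j - θ j) ∂μ) =
      covM μ + Matrix.of fun i j => (∫ x, x i ∂μ - θ i) * (∫ x, x j ∂μ - θ j) := by
  ext i j
  simp only [covM, Matrix.of_apply, Matrix.add_apply]
  have hi : ∀ i, Integrable (fun x : EuclideanSpace ℝ (Fin m) => x i) μ := fun i =>
    (memLp_coord hμ i).integrable one_le_two
  set a := fun i => ∫ y, y i ∂μ with ha
  have hc : ∀ i, MemLp (fun x : EuclideanSpace ℝ (Fin m) => x i - a i) 2 μ :=
    fun i => (memLp_coord hμ i).sub (memLp_const _)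
  have e : ∀ x : EuclideanSpace ℝ (Fin m), (x i - θ i) * (x j - θ j) =
      (x i - a i) * (x j - a j) + ((a j - θ j) * (x i - a i) + ((a i - θ i) * (x j - a j) +
        (a i - θ i) * (a j - θ j))) := fun x => by ring
  have hs : ∀ i, Integrable (fun x : EuclideanSpace ℝ (Fin m) => x i - a i) μ := fun i =>
    (hc i).integrable one_le_two
  have h0 : ∀ i, ∫ x, (x i - a i) ∂μ = 0 := fun i => by
    rw [integral_sub (hi i) (integrable_const _)]; simp [ha]
  rw [integral_congr_ae (.of_forall e)]
  have j1 : ∀ i (c : ℝ), Integrable (fun x : EuclideanSpace ℝ (Fin m) => c * (x i - a i)) μ :=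
    fun i c => (hs i).const_mul _
  have j2 : Integrable (fun x : EuclideanSpace ℝ (Fin m) => (a i - θ i) * (x j - a j) +
        (a i - θ i) * (a j - θ j)) μ := (j1 j _).add (integrable_const _)
  have j3 : Integrable (fun x : EuclideanSpace ℝ (Fin m) => (a j - θ j) * (x i - a i) +
      ((a i - θ i) * (x j - a j) + (a i - θ i) * (a j - θ j))) μ := (j1 i _).add j2
  have j4 : Integrable (fun x : EuclideanSpace ℝ (Fin m) => (x i - a i) * (x j - a j)) μ :=
    (hc i).integrable_mul (hc j)
  rw [integral_add j4 j3, integral_add (j1 i _) j2, integral_add (j1 j _)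
    (integrable_const _), integral_const_mul, integral_const_mul, h0, h0]
  simp
  rfl

end Moments

/-! ### Moments and moment conditions of estimators in terms of the distribution of the estimate -/

section EstimatorMoments

variable {ι H : Type*} [NormedAddCommGroup H] [InnerProductSpace ℂ H]

theorem Estimator.integral_distOp {n m : ℕ} (E : Estimator ι n m)
    (τ : TensorPower ι n →L[ℂ] TensorPower ι n) (g : EuclideanSpace ℝ (Fin m) → ℝ)
    (hg : Measurable g) :
    ∫ x, g x ∂(E.distOp τ) = ∫ ω, g (E.T ω) ∂(E.M.law (tensorBasis ι n) τ) :=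
  integral_map E.measurable_T.aemeasurable hg.aestronglyMeasurable

theorem Estimator.comp_dist (b : HilbertBasis ι ℂ H) {n m : ℕ} (E : Estimator ι n m)
    (φ : EuclideanSpace ℝ (Fin m) → EuclideanSpace ℝ (Fin m)) (hφ : Measurable φ)
    (σ : H →L[ℂ] H) : (E.comp φ hφ).dist b σ = (E.dist b σ).map φ :=
  E.comp_distOp φ hφ _

theorem Estimator.mean_eq (b : HilbertBasis ι ℂ H) {n m : ℕ} (E : Estimator ι n m)
    (σ : H →L[ℂ] H) (i : Fin m) : E.mean b σ i = ∫ x, x i ∂(E.dist b σ) :=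
  (E.integral_distOp _ (fun x => x i) (by fun_prop)).symm

theorem Estimator.cov_eq (b : HilbertBasis ι ℂ H) {n m : ℕ} (E : Estimator ι n m)
    (σ : H →L[ℂ] H) : E.cov b σ = covM (E.dist b σ) := by
  ext i j
  rw [Estimator.cov, covM, Matrix.of_apply, Matrix.of_apply, ← E.mean_eq, ← E.mean_eq]
  exact (E.integral_distOp _ (fun x => (x i - E.mean b σ i) * (x j - E.mean b σ j))
    (by fun_prop)).symm

theorem Estimator.mse_eq_dist (b : HilbertBasis ι ℂ H) {n m : ℕ} (E : Estimator ι n m)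
    (σ : H →L[ℂ] H) (θ : EuclideanSpace ℝ (Fin m)) :
    E.mse b σ θ = Matrix.of fun i j => ∫ x, (x i - θ i) * (x j - θ j) ∂(E.dist b σ) := by
  ext i j
  exact (E.integral_distOp _ (fun x => (x i - θ i) * (x j - θ j)) (by fun_prop)).symm

variable [CompleteSpace H] {m : ℕ}

/-- Condition (E) involves the estimator only through the distributions of the estimate, so it can
be checked on convolutions and images. -/
theorem condE_iff (b : HilbertBasis ι ℂ H) (ρ : EuclideanSpace ℝ (Fin m) → H →L[ℂ] H)
    (Θ : Set (EuclideanSpace ℝ (Fin m))) {n : ℕ} (E : Estimator ι n m) :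
    CondE b ρ Θ E ↔ ∃ (a₁ : ℝ≥0) (a₂ : ℝ) (Dia : Fin m → EuclideanSpace ℝ (Fin m) → H →L[ℂ] H),
      0 < a₂ ∧ IsDiamond b ρ Θ a₁ a₂ Dia ∧ ∃ a₄ : ℝ≥0, ∀ θ ∈ Θ,
        (∀ i, ∫⁻ x, ‖x - θ‖ₑ ∂(E.distOp (tensorSum b n (ρ θ) (Dia i θ))) ≤ n * a₁ * a₄) ∧
        ∫⁻ x, ‖x - θ‖ₑ ^ 2 ∂(E.dist b (ρ θ)) ≤ n * a₄ ^ 2 := by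
  have h1 : ∀ (τ : TensorPower ι n →L[ℂ] TensorPower ι n) (θ : EuclideanSpace ℝ (Fin m)),
      ∫⁻ x, ‖x - θ‖ₑ ∂(E.distOp τ) = ∫⁻ ω, ‖E.T ω - θ‖ₑ ∂(E.M.law (tensorBasis ι n) τ) :=
    fun τ θ => lintegral_map (by fun_prop) E.measurable_T
  have h2 : ∀ (τ : TensorPower ι n →L[ℂ] TensorPower ι n) (θ : EuclideanSpace ℝ (Fin m)),
      ∫⁻ x, ‖x - θ‖ₑ ^ 2 ∂(E.distOp τ) = ∫⁻ ω, ‖E.T ω - θ‖ₑ ^ 2 ∂(E.M.law (tensorBasis ι n) τ) :=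
    fun τ θ => lintegral_map (by fun_prop) E.measurable_T
  simp only [h1, h2]
  rfl

theorem IsDiamond.nonneg {b : HilbertBasis ι ℂ H} {ρ : EuclideanSpace ℝ (Fin m) → H →L[ℂ] H}
    {Θ : Set (EuclideanSpace ℝ (Fin m))} {a₁ : ℝ≥0} {a₂ : ℝ}
    {Dia : Fin m → EuclideanSpace ℝ (Fin m) → H →L[ℂ] H} (h : IsDiamond b ρ Θ a₁ a₂ Dia)
    (ha : 0 < a₂) {θ : EuclideanSpace ℝ (Fin m)} (hθ : θ ∈ Θ) (i : Fin m) :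
    CFC.abs (traceDeriv b ρ i θ) ≤ Dia i θ ∧ 0 ≤ Dia i θ := by
  have := (h i θ hθ).2 θ hθ (by simpa) (fun _ _ => rfl)
  exact ⟨this, (CFC.abs_nonneg _).trans this⟩

theorem lintegral_conv_enorm_le (μ ν : Measure (EuclideanSpace ℝ (Fin m))) [SFinite ν]
    {K : ℝ≥0} (hK : ∀ᵐ y ∂ν, ‖y‖ₑ ≤ K) (θ : EuclideanSpace ℝ (Fin m)) :
    ∫⁻ z, ‖z - θ‖ₑ ∂((μ.prod ν).map fun p => p.1 + p.2) ≤
      (∫⁻ x, ‖x - θ‖ₑ ∂μ + K * μ Set.univ) * ν Set.univ := by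
  rw [lintegral_map (by fun_prop) measurable_addPair, lintegral_prod _ (by fun_prop),
    ← lintegral_const (μ := μ) (K : ℝ≥0∞), ← lintegral_add_right _ measurable_const,
    ← lintegral_mul_const _ (by fun_prop)]
  refine lintegral_mono fun x => ?_
  rw [← lintegral_const]
  refine lintegral_mono_ae (hK.mono fun y hy => ?_)
  rw [show x + y - θ = (x - θ) + y by abel]
  exact (enorm_add_le _ _).trans (by gcongr)

theorem lintegral_conv_enorm_sq_le (μ ν : Measure (EuclideanSpace ℝ (Fin m))) [SFinite ν]
    {K : ℝ≥0} (hK : ∀ᵐ y ∂ν, ‖y‖ₑ ≤ K) (θ : EuclideanSpace ℝ (Fin m)) :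
    ∫⁻ z, ‖z - θ‖ₑ ^ 2 ∂((μ.prod ν).map fun p => p.1 + p.2) ≤
      (2 * ∫⁻ x, ‖x - θ‖ₑ ^ 2 ∂μ + 2 * K ^ 2 * μ Set.univ) * ν Set.univ := by
  rw [lintegral_map (by fun_prop) measurable_addPair, lintegral_prod _ (by fun_prop),
    ← lintegral_const (μ := μ) (2 * (K : ℝ≥0∞) ^ 2), ← lintegral_const_mul _ (by fun_prop),
    ← lintegral_add_right _ measurable_const, ← lintegral_mul_const _ (by fun_prop)]
  refine lintegral_mono fun x => ?_
  rw [← lintegral_const]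
  refine lintegral_mono_ae (hK.mono fun y hy => ?_)
  rw [show x + y - θ = (x - θ) + y by abel]
  refine (pow_le_pow_left' (enorm_add_le _ _) 2).trans ((enn_add_sq_le _ _).trans ?_)
  gcongr

theorem Estimator.ae_distOp_of_forall {n : ℕ} (E : Estimator ι n m) {K : ℝ≥0}
    (h : ∀ ω, ‖E.T ω‖ ≤ K) (τ : TensorPower ι n →L[ℂ] TensorPower ι n) :
    ∀ᵐ y ∂(E.distOp τ), ‖y‖ₑ ≤ K := by
  rw [Estimator.distOp, ae_map_iff E.measurable_T.aemeasurable
    (measurableSet_le (by fun_prop) measurable_const)]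
  refine .of_forall fun ω => ?_
  have : ‖E.T ω‖₊ ≤ K := h ω
  exact_mod_cast this

/-- The same operators `◇` serve. The part of the sum coming from `F` is bounded, and only the
constant `a₄` has to grow. -/
theorem CondE.add {b : HilbertBasis ι ℂ H} {ρ : EuclideanSpace ℝ (Fin m) → H →L[ℂ] H}
    {Θ : Set (EuclideanSpace ℝ (Fin m))} (hρ : ∀ θ ∈ Θ, IsDensity b (ρ θ)) {a c : ℕ}
    (ha : 1 ≤ a) {E : Estimator ι a m} (hE : CondE b ρ Θ E) (F : Estimator ι c m)
    (hF : F.IsFinite) : CondE b ρ Θ (E.add F hF) := by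
  rw [condE_iff] at hE ⊢
  obtain ⟨a₁, a₂, Dia, h0, hD, a₄, hE⟩ := hE
  obtain ⟨K', hK'⟩ := hF.exists_bound
  set K : ℝ≥0 := K'.toNNReal
  have hK : ∀ ω, ‖F.T ω‖ ≤ K := fun ω => (hK' ω).trans (Real.le_coe_toNNReal K')
  -- In the new constant `K` bounds `F`, and `1 + a * a₄ ^ 2` bounds the first moment of `E` by
  -- means of `t ≤ 1 + t ^ 2`. The factor 2 absorbs the constants of `(s + t) ^ 2 ≤ 2 * s ^ 2 + 2 *
  -- t ^ 2`.
  refine ⟨a₁, a₂, Dia, h0, hD, 2 * (a₄ + K + 1 + a * a₄ ^ 2), fun θ hθ => ⟨fun i => ?_, ?_⟩⟩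
  · obtain ⟨_, hpos⟩ := hD.nonneg h0 hθ i
    have htr := (hD i θ hθ).1
    have hfin : traceE b (Dia i θ) ≠ ∞ := ne_top_of_le_ne_top (by simp) htr
    have hσ := hρ θ hθ
    have iF := F.isProbabilityMeasure_dist b hσ
    have iE := E.isProbabilityMeasure_dist b hσ
    have uS : ∀ {d : ℕ} (F : Estimator ι d m),
        F.distOp (tensorSum b d (ρ θ) (Dia i θ)) Set.univ ≤ d * a₁ := fun F => by
      rw [F.distOp_univ (tensorSum_nonneg b hσ.1 hpos), traceE_tensorSum b hσ hpos]
      gcongr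
    have iS : IsFiniteMeasure (F.distOp (tensorSum b c (ρ θ) (Dia i θ))) :=
      ⟨(uS F).trans_lt (by finiteness)⟩
    rw [E.add_distOp_tensorSum b F hF hσ hpos hfin, lintegral_add_measure]
    refine (add_le_add (lintegral_conv_enorm_le _ _ (F.ae_distOp_of_forall hK _) θ)
      (lintegral_conv_enorm_le _ _ (F.ae_distOp_of_forall hK _) θ)).trans ?_
    have h1 : ∫⁻ x, ‖x - θ‖ₑ ∂(E.dist b (ρ θ)) ≤ 1 + a * a₄ ^ 2 := by
      calc ∫⁻ x, ‖x - θ‖ₑ ∂(E.dist b (ρ θ)) ≤ ∫⁻ x, (1 + ‖x - θ‖ₑ ^ 2) ∂(E.dist b (ρ θ)) := by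
            refine lintegral_mono fun x => ?_
            rcases le_total ‖x - θ‖ₑ 1 with h | h
            · exact h.trans le_self_add
            · exact (le_self_pow h two_ne_zero).trans le_add_self
        _ = 1 + ∫⁻ x, ‖x - θ‖ₑ ^ 2 ∂(E.dist b (ρ θ)) := by
            rw [lintegral_add_left measurable_const]; simp
        _ ≤ _ := by gcongr; exact (hE θ hθ).2
    calc _ ≤ (a * a₁ * a₄ + K * (a * a₁)) * 1 + ((1 + a * a₄ ^ 2) + K * 1) * (c * a₁ : ℝ≥0∞) := by
          gcongr
          · exact (hE θ hθ).1 i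
          · exact uS E
          · rw [measure_univ]
          · rw [measure_univ]
          · exact uS F
      _ ≤ _ := by
          norm_cast
          calc _ ≤ (a * a₁) * (a₄ + K + 1 + a * a₄ ^ 2) + c * a₁ * (a₄ + K + 1 + a * a₄ ^ 2) := by
                rw [← NNReal.coe_le_coe]
                push_cast
                have : 0 ≤ (a : ℝ) * a₁ * (1 + a * a₄ ^ 2) := by positivity
                have : 0 ≤ (c : ℝ) * a₁ * a₄ := by positivity
                nlinarith
            _ = ((a + c : ℕ) : ℝ≥0) * a₁ * (a₄ + K + 1 + a * a₄ ^ 2) := by push_cast; ring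
            _ ≤ _ := by
                gcongr
                exact le_mul_of_one_le_left' one_le_two
  · have hσ := hρ θ hθ
    have iF := F.isProbabilityMeasure_dist b hσ
    have iE := E.isProbabilityMeasure_dist b hσ
    rw [E.add_dist b F hF hσ]
    refine (lintegral_conv_enorm_sq_le _ _ (F.ae_distOp_of_forall hK _) θ).trans ?_
    simp only [measure_univ, mul_one]
    calc _ ≤ 2 * (a * a₄ ^ 2) + 2 * (K : ℝ≥0∞) ^ 2 := by gcongr; exact (hE θ hθ).2
      _ ≤ _ := by
          norm_cast
          rw [← NNReal.coe_le_coe]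
          push_cast
          have h1 : (1 : ℝ) ≤ a := by exact_mod_cast ha
          have h2 : 0 ≤ (c : ℝ) * (2 * (a₄ + K + 1 + a * a₄ ^ 2)) ^ 2 := by positivity
          have h3 : (a₄ : ℝ) ^ 2 + K ^ 2 ≤ (a₄ + K + 1 + a * a₄ ^ 2) ^ 2 := by
            have h : ∀ x y z : ℝ, 0 ≤ x → 0 ≤ y → 0 ≤ z → x ^ 2 + y ^ 2 ≤ (x + y + 1 + z) ^ 2 :=
              fun x y z hx hy hz => by
                nlinarith [mul_nonneg hx hy, mul_nonneg hx hz, mul_nonneg hy hz]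
            exact h _ _ _ a₄.coe_nonneg K.coe_nonneg (by positivity)
          have h4 : (a : ℝ) * (a₄ ^ 2 + K ^ 2) ≤ a * (a₄ + K + 1 + a * a₄ ^ 2) ^ 2 := by gcongr
          have h5 : (K : ℝ) ^ 2 ≤ a * K ^ 2 := le_mul_of_one_le_left (by positivity) h1
          nlinarith [sq_nonneg (a₄ : ℝ)]

/-- A displacement of the estimate by at most `K` changes first moments by at most `K` times the
total mass, and second moments by a bounded factor and summand. -/
theorem CondE.comp {b : HilbertBasis ι ℂ H} {ρ : EuclideanSpace ℝ (Fin m) → H →L[ℂ] H}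
    {Θ : Set (EuclideanSpace ℝ (Fin m))} (hρ : ∀ θ ∈ Θ, IsDensity b (ρ θ)) {n : ℕ}
    (hn : 1 ≤ n) {E : Estimator ι n m} (hE : CondE b ρ Θ E)
    (φ : EuclideanSpace ℝ (Fin m) → EuclideanSpace ℝ (Fin m)) (hφ : Measurable φ) {K : ℝ≥0}
    (hK : ∀ x, ‖φ x - x‖ ≤ K) : CondE b ρ Θ (E.comp φ hφ) := by
  rw [condE_iff] at hE ⊢
  obtain ⟨a₁, a₂, Dia, h0, hD, a₄, hE⟩ := hE
  have hKe : ∀ x, ‖φ x - x‖ₑ ≤ K := fun x => by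
    have : ‖φ x - x‖₊ ≤ K := hK x
    exact_mod_cast this
  have hle : ∀ x θ, ‖φ x - θ‖ₑ ≤ ‖x - θ‖ₑ + K := fun x θ => by
    rw [show φ x - θ = (x - θ) + (φ x - x) by abel]
    exact (enorm_add_le _ _).trans (by gcongr; exact hKe x)
  refine ⟨a₁, a₂, Dia, h0, hD, 2 * (a₄ + K), fun θ hθ => ⟨fun i => ?_, ?_⟩⟩
  · obtain ⟨_, hpos⟩ := hD.nonneg h0 hθ i
    have hσ := hρ θ hθ
    rw [E.comp_distOp, lintegral_map (by fun_prop) hφ]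
    refine (lintegral_mono fun x => hle x θ).trans ?_
    rw [lintegral_add_right _ measurable_const, lintegral_const,
      E.distOp_univ (tensorSum_nonneg b hσ.1 hpos), traceE_tensorSum b hσ hpos]
    calc _ ≤ (n * a₁ * a₄ + K * (n * a₁) : ℝ≥0∞) := by
          gcongr
          · exact (hE θ hθ).1 i
          · exact (hD i θ hθ).1
      _ = n * a₁ * (a₄ + K) := by ring
      _ ≤ _ := by
        push_cast
        gcongr
        exact le_mul_of_one_le_left' one_le_two
  · have hσ := hρ θ hθ
    have iE := E.isProbabilityMeasure_dist b hσ
    rw [E.comp_dist, lintegral_map (by fun_prop) hφ]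
    refine (lintegral_mono fun x => (pow_le_pow_left' (hle x θ) 2).trans
      (enn_add_sq_le _ _)).trans ?_
    rw [lintegral_add_right _ measurable_const, lintegral_const, measure_univ, mul_one,
      lintegral_const_mul _ (by fun_prop)]
    calc _ ≤ 2 * (n * a₄ ^ 2) + 2 * (K : ℝ≥0∞) ^ 2 := by gcongr; exact (hE θ hθ).2
      _ ≤ _ := by
          norm_cast
          rw [← NNReal.coe_le_coe]
          push_cast
          have h1 : (1 : ℝ) ≤ n := by exact_mod_cast hn
          have h5 : (K : ℝ) ^ 2 ≤ n * K ^ 2 := le_mul_of_one_le_left (by positivity) h1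
          have h6 : (0 : ℝ) ≤ n * (a₄ * K) := by positivity
          have h7 : (0 : ℝ) ≤ n * a₄ ^ 2 := by positivity
          nlinarith

end EstimatorMoments

/-! ### The normed space of self-adjoint trace class operators -/

section TraceClass

variable {κ K : Type*} [NormedAddCommGroup K] [InnerProductSpace ℂ K] [CompleteSpace K]

/-- Expand `A x` in the basis and apply Cauchy-Schwarz to the pairings of `x` with the images of the
basis under the adjoint. -/
theorem enorm_le_hsq (b : HilbertBasis κ ℂ K) (A : K →L[ℂ] K) : ‖A‖ₑ ^ 2 ≤ hsq b A := by
  by_cases h : hsq b A = ∞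
  · simp [h]
  have key : ∀ x, ‖A x‖ₑ ^ 2 ≤ hsq b A * ‖x‖ₑ ^ 2 := by
    intro x
    rw [basis_enorm_sq b, ← hsq_star, hsq, ← ENNReal.tsum_mul_right]
    refine ENNReal.tsum_le_tsum fun i => ?_
    rw [← ContinuousLinearMap.adjoint_inner_left, ← ContinuousLinearMap.star_eq_adjoint, ← mul_pow]
    refine pow_le_pow_left' ?_ 2
    simp only [← ofReal_norm]
    rw [← ENNReal.ofReal_mul (norm_nonneg _)]
    exact ENNReal.ofReal_le_ofReal (norm_inner_le_norm _ _)
  have h2 : ‖A‖ ≤ √(hsq b A).toReal := by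
    refine A.opNorm_le_bound (Real.sqrt_nonneg _) fun x => ?_
    have := ENNReal.toReal_mono (by finiteness) (key x)
    rw [ENNReal.toReal_mul, ENNReal.toReal_pow, ENNReal.toReal_pow, toReal_enorm, toReal_enorm] at this
    rw [← Real.sqrt_sq (norm_nonneg x), ← Real.sqrt_mul ENNReal.toReal_nonneg]
    exact Real.le_sqrt_of_sq_le this
  rw [← ofReal_norm, ← ENNReal.ofReal_pow (norm_nonneg _), ← ENNReal.ofReal_toReal h]
  refine ENNReal.ofReal_le_ofReal ?_
  calc ‖A‖ ^ 2 ≤ √(hsq b A).toReal ^ 2 := by gcongr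
    _ = _ := Real.sq_sqrt ENNReal.toReal_nonneg

theorem enorm_le_traceE (b : HilbertBasis κ ℂ K) {P : K →L[ℂ] K} (hP : 0 ≤ P) :
    ‖P‖ₑ ≤ traceE b P := by
  rw [traceE_eq_hsq_sqrt b hP]
  refine le_trans ?_ (enorm_le_hsq b _)
  nth_rw 1 [← CFC.sqrt_mul_sqrt_self P hP]
  rw [sq]
  simp only [enorm_eq_nnnorm]
  exact_mod_cast norm_mul_le (CFC.sqrt P) (CFC.sqrt P)

theorem enorm_le_traceNorm (b : HilbertBasis κ ℂ K) (A : K →L[ℂ] K) : ‖A‖ₑ ≤ traceNorm b A := by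
  have := enorm_le_traceE b (CFC.abs_nonneg A)
  rwa [← ofReal_norm, CFC.norm_abs, ofReal_norm] at this

/-- `A = P - Q` with positive trace class operators `P` and `Q`. -/
structure IsDecomp (b : HilbertBasis κ ℂ K) (A P Q : K →L[ℂ] K) : Prop where
  pos : 0 ≤ P
  pos' : 0 ≤ Q
  fin : traceE b P ≠ ∞
  fin' : traceE b Q ≠ ∞
  eq : A = P - Q

theorem IsDecomp.add {b : HilbertBasis κ ℂ K} {A P Q A' P' Q' : K →L[ℂ] K}
    (h : IsDecomp b A P Q) (h' : IsDecomp b A' P' Q') :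
    IsDecomp b (A + A') (P + P') (Q + Q') where
  pos := add_nonneg h.pos h'.pos
  pos' := add_nonneg h.pos' h'.pos'
  fin := by rw [traceE_add b h.pos h'.pos]; exact ENNReal.add_ne_top.2 ⟨h.fin, h'.fin⟩
  fin' := by rw [traceE_add b h.pos' h'.pos']; exact ENNReal.add_ne_top.2 ⟨h.fin', h'.fin'⟩
  eq := by rw [h.eq, h'.eq]; abel

theorem IsDecomp.neg {b : HilbertBasis κ ℂ K} {A P Q : K →L[ℂ] K} (h : IsDecomp b A P Q) :
    IsDecomp b (-A) Q P := ⟨h.pos', h.pos, h.fin', h.fin, by rw [h.eq]; abel⟩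

theorem IsDecomp.smul {b : HilbertBasis κ ℂ K} {A P Q : K →L[ℂ] K} (h : IsDecomp b A P Q)
    {c : ℝ} (hc : 0 ≤ c) : IsDecomp b (c • A) (c • P) (c • Q) where
  pos := smul_nonneg hc h.pos
  pos' := smul_nonneg hc h.pos'
  fin := by rw [traceE_smul b hc]; exact ENNReal.mul_ne_top ENNReal.ofReal_ne_top h.fin
  fin' := by rw [traceE_smul b hc]; exact ENNReal.mul_ne_top ENNReal.ofReal_ne_top h.fin'
  eq := by rw [h.eq, smul_sub]

theorem IsDecomp.of_nonneg {b : HilbertBasis κ ℂ K} {P : K →L[ℂ] K} (hP : 0 ≤ P)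
    (h : traceE b P ≠ ∞) : IsDecomp b P P 0 :=
  ⟨hP, le_rfl, h, by simp [traceE], by simp⟩

theorem traceE_posPart_add_negPart (b : HilbertBasis κ ℂ K) {A : K →L[ℂ] K}
    (hA : IsSelfAdjoint A) : traceE b A⁺ + traceE b A⁻ = traceNorm b A := by
  rw [traceNorm, ← CFC.posPart_add_negPart A hA, traceE_add b (CFC.posPart_nonneg A)
    (CFC.negPart_nonneg A)]

theorem IsDecomp.of_selfAdjoint {b : HilbertBasis κ ℂ K} {A : K →L[ℂ] K} (hA : IsSelfAdjoint A)
    (h : traceNorm b A ≠ ∞) : IsDecomp b A A⁺ A⁻ := by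
  rw [← traceE_posPart_add_negPart b hA, ENNReal.add_ne_top] at h
  exact ⟨CFC.posPart_nonneg A, CFC.negPart_nonneg A, h.1, h.2, (CFC.posPart_sub_negPart A hA).symm⟩

theorem IsDecomp.isSelfAdjoint {b : HilbertBasis κ ℂ K} {A P Q : K →L[ℂ] K}
    (h : IsDecomp b A P Q) : IsSelfAdjoint A := by
  rw [h.eq]
  exact (IsSelfAdjoint.of_nonneg h.pos).sub (IsSelfAdjoint.of_nonneg h.pos')

/-- The real vector space of self-adjoint trace class operators. -/
def tcSub (b : HilbertBasis κ ℂ K) : Submodule ℝ (K →L[ℂ] K) where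
  carrier := {A | ∃ P Q, IsDecomp b A P Q}
  add_mem' := by
    rintro A A' ⟨P, Q, h⟩ ⟨P', Q', h'⟩
    exact ⟨_, _, h.add h'⟩
  zero_mem' := ⟨0, 0, .of_nonneg le_rfl (by simp [traceE])⟩
  smul_mem' := by
    rintro c A ⟨P, Q, h⟩
    rcases le_total 0 c with hc | hc
    · exact ⟨_, _, h.smul hc⟩
    · have := (h.smul (neg_nonneg.2 hc)).neg
      rw [neg_smul, neg_neg] at this
      exact ⟨_, _, this⟩

theorem IsDecomp.mem {b : HilbertBasis κ ℂ K} {A P Q : K →L[ℂ] K} (h : IsDecomp b A P Q) :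
    A ∈ tcSub b := ⟨P, Q, h⟩

/-- The self-adjoint trace class operators, with a norm equivalent to the trace norm. -/
def TC (b : HilbertBasis κ ℂ K) : Type _ := tcSub b

namespace TC

variable {b : HilbertBasis κ ℂ K}

instance : AddCommGroup (TC b) := inferInstanceAs (AddCommGroup (tcSub b))

instance : Module ℝ (TC b) := inferInstanceAs (Module ℝ (tcSub b))

/-- The underlying operator. -/
def val : TC b →ₗ[ℝ] (K →L[ℂ] K) := (tcSub b).subtype

theorem val_injective : Function.Injective (val : TC b → K →L[ℂ] K) := Subtype.val_injective

theorem val_mem (τ : TC b) : τ.val ∈ tcSub b := τ.2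

theorem exists_decomp (τ : TC b) : ∃ P Q, IsDecomp b τ.val P Q := τ.2

/-- The sizes of the decompositions of `τ`. -/
def sizes (τ : TC b) : Set ℝ :=
  {r | ∃ P Q, IsDecomp b τ.val P Q ∧ r = (traceE b P).toReal + (traceE b Q).toReal}

theorem sizes_nonempty (τ : TC b) : τ.sizes.Nonempty := by
  obtain ⟨P, Q, h⟩ := τ.exists_decomp
  exact ⟨_, P, Q, h, rfl⟩

theorem sizes_nonneg (τ : TC b) : ∀ r ∈ τ.sizes, 0 ≤ r := by
  rintro r ⟨P, Q, -, rfl⟩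
  positivity

theorem sizes_bdd (τ : TC b) : BddBelow τ.sizes := ⟨0, τ.sizes_nonneg⟩

theorem sInf_sizes_le {τ : TC b} {P Q : K →L[ℂ] K} (h : IsDecomp b τ.val P Q) :
    sInf τ.sizes ≤ (traceE b P).toReal + (traceE b Q).toReal :=
  csInf_le τ.sizes_bdd ⟨P, Q, h, rfl⟩

theorem exists_lt (τ : TC b) {ε : ℝ} (hε : 0 < ε) : ∃ P Q, IsDecomp b τ.val P Q ∧
    (traceE b P).toReal + (traceE b Q).toReal < sInf τ.sizes + ε := by
  obtain ⟨r, ⟨P, Q, h, rfl⟩, hr⟩ := exists_lt_of_csInf_lt τ.sizes_nonempty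
    (lt_add_of_pos_right (sInf τ.sizes) hε)
  exact ⟨P, Q, h, hr⟩

theorem norm_val_le_of_decomp {A P Q : K →L[ℂ] K} (h : IsDecomp b A P Q) :
    ‖A‖ ≤ (traceE b P).toReal + (traceE b Q).toReal := by
  have h1 : ∀ {P : K →L[ℂ] K}, 0 ≤ P → traceE b P ≠ ∞ → ‖P‖ ≤ (traceE b P).toReal := by
    intro P hP hf
    have := ENNReal.toReal_mono hf (enorm_le_traceE b hP)
    rwa [toReal_enorm] at this
  rw [h.eq]
  exact (norm_sub_le _ _).trans (add_le_add (h1 h.pos h.fin) (h1 h.pos' h.fin'))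

/-- The norm is the infimum of `tr P + tr Q` over decompositions `P - Q` into positive trace class
operators. For this norm the triangle inequality is immediate, since decompositions add;
definiteness holds because it dominates the operator norm. -/
instance : NormedAddCommGroup (TC b) := AddGroupNorm.toNormedAddCommGroup
  { toFun := fun τ => sInf τ.sizes
    map_zero' := by
      refine le_antisymm ?_ (le_csInf (sizes_nonempty _) (sizes_nonneg _))
      refine csInf_le (sizes_bdd _) ⟨0, 0, ⟨le_rfl, le_rfl, ?_, ?_, ?_⟩, ?_⟩ <;> simp [traceE]
    add_le' := by
      intro σ τ
      refine le_of_forall_pos_le_add fun ε hε => ?_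
      obtain ⟨P, Q, h, h'⟩ := σ.exists_lt (half_pos hε)
      obtain ⟨P', Q', k, k'⟩ := τ.exists_lt (half_pos hε)
      have hd : IsDecomp b (σ + τ).val (P + P') (Q + Q') := by
        rw [map_add]; exact h.add k
      refine (sInf_sizes_le hd).trans ?_
      rw [traceE_add b h.pos k.pos, traceE_add b h.pos' k.pos', ENNReal.toReal_add h.fin k.fin,
        ENNReal.toReal_add h.fin' k.fin']
      linarith
    neg' := by
      have key : ∀ τ : TC b, (-τ).sizes ⊆ τ.sizes := by
        rintro τ r ⟨P, Q, h, rfl⟩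
        refine ⟨Q, P, ?_, add_comm _ _⟩
        have := h.neg
        rwa [map_neg, neg_neg] at this
      intro τ
      have h2 := key (-τ)
      rw [neg_neg] at h2
      rw [subset_antisymm (key τ) h2]
    eq_zero_of_map_eq_zero' := by
      intro τ hτ
      apply val_injective
      rw [map_zero, ← norm_le_zero_iff]
      refine le_of_forall_pos_le_add fun ε hε => ?_
      obtain ⟨P, Q, h, h'⟩ := τ.exists_lt hε
      change sInf τ.sizes = 0 at hτ
      rw [hτ] at h'
      exact (norm_val_le_of_decomp h).trans h'.le }

theorem norm_le {τ : TC b} {P Q : K →L[ℂ] K} (h : IsDecomp b τ.val P Q) :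
    ‖τ‖ ≤ (traceE b P).toReal + (traceE b Q).toReal := sInf_sizes_le h

theorem exists_decomp_lt (τ : TC b) {ε : ℝ} (hε : 0 < ε) : ∃ P Q, IsDecomp b τ.val P Q ∧
    (traceE b P).toReal + (traceE b Q).toReal < ‖τ‖ + ε := τ.exists_lt hε

instance : NormedSpace ℝ (TC b) where
  norm_smul_le := by
    have key : ∀ (c : ℝ), 0 ≤ c → ∀ τ : TC b, ‖c • τ‖ ≤ c * ‖τ‖ := by
      intro c hc τ
      rcases hc.eq_or_lt with rfl | hc'
      · simp
      refine le_of_forall_pos_le_add fun ε hε => ?_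
      obtain ⟨P, Q, h, h'⟩ := τ.exists_decomp_lt (div_pos hε hc')
      have hd : IsDecomp b (c • τ).val (c • P) (c • Q) := by
        rw [map_smul]; exact h.smul hc
      refine (norm_le hd).trans ?_
      rw [traceE_smul b hc, traceE_smul b hc, ENNReal.toReal_mul, ENNReal.toReal_mul,
        ENNReal.toReal_ofReal hc, ← mul_add]
      calc _ ≤ c * (‖τ‖ + ε / c) := by gcongr
        _ = _ := by field_simp
    intro c τ
    rcases le_total 0 c with hc | hc
    · rw [Real.norm_of_nonneg hc]; exact key c hc τ
    · rw [Real.norm_of_nonpos hc, ← norm_neg, ← neg_smul]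
      exact key _ (neg_nonneg.2 hc) τ

/-- A self-adjoint trace class operator as an element of `TC b`. -/
def mk (A : K →L[ℂ] K) (h : A ∈ tcSub b) : TC b := (⟨A, h⟩ : tcSub b)

theorem val_mk (A : K →L[ℂ] K) (h : A ∈ tcSub b) : (mk A h).val = A := rfl

/-- An operator as an element of `TC b` (`0` if it is not trace class). -/
def ofOp (b : HilbertBasis κ ℂ K) (A : K →L[ℂ] K) : TC b :=
  open Classical in if h : A ∈ tcSub b then mk A h else 0

theorem val_ofOp {A P Q : K →L[ℂ] K} (h : IsDecomp b A P Q) : (ofOp b A).val = A := by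
  have : A ∈ tcSub b := ⟨P, Q, h⟩
  rw [ofOp, dif_pos this, val_mk]

/-- The positive and negative parts are one admissible decomposition, and their traces add up to the
trace norm. Only this inequality is needed to pass from trace norm limits to limits in `TC b`. -/
theorem norm_le_traceNorm {τ : TC b} (h : traceNorm b τ.val ≠ ∞) :
    ‖τ‖ ≤ (traceNorm b τ.val).toReal := by
  obtain ⟨P, Q, hd⟩ := τ.exists_decomp
  have hsa := hd.isSelfAdjoint
  have h2 := IsDecomp.of_selfAdjoint hsa h
  refine (norm_le h2).trans_eq ?_
  rw [← ENNReal.toReal_add h2.fin h2.fin', traceE_posPart_add_negPart b hsa]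

section Lin

variable {X : Type*} [MeasurableSpace X]

/-- The expectation of `u` in the (signed) state `τ`. -/
def expect (M : POVM X K) (u : X → ℝ) (τ : TC b) : ℝ :=
  ∫ x, u x ∂(M.law b τ.exists_decomp.choose) -
    ∫ x, u x ∂(M.law b τ.exists_decomp.choose_spec.choose)

theorem integrable_of_bdd {μ : Measure X} [IsFiniteMeasure μ] {u : X → ℝ} (hu : Measurable u)
    {C : ℝ} (hC : ∀ x, |u x| ≤ C) : Integrable u μ :=
  Integrable.of_bound hu.aestronglyMeasurable C (.of_forall hC)

variable (M : POVM X K) {u : X → ℝ} (hu : Measurable u) {C : ℝ} (hC : ∀ x, |u x| ≤ C)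
include hu hC

theorem integral_law_add {P Q : K →L[ℂ] K} (hP : 0 ≤ P) (hQ : 0 ≤ Q) (hP' : traceE b P ≠ ∞)
    (hQ' : traceE b Q ≠ ∞) : ∫ x, u x ∂(M.law b (P + Q)) =
      ∫ x, u x ∂(M.law b P) + ∫ x, u x ∂(M.law b Q) := by
  have := isFiniteMeasure_law b M hP hP'
  have := isFiniteMeasure_law b M hQ hQ'
  rw [M.law_add b hP hQ, integral_add_measure (integrable_of_bdd hu hC) (integrable_of_bdd hu hC)]

/-- Two decompositions satisfy `P + Q' = P' + Q`, and laws are additive on positive operators, so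
the difference of the integrals is the same for both. -/
theorem expect_eq {τ : TC b} {P Q : K →L[ℂ] K} (h : IsDecomp b τ.val P Q) :
    expect M u τ = ∫ x, u x ∂(M.law b P) - ∫ x, u x ∂(M.law b Q) := by
  have key : ∀ P' Q', IsDecomp b τ.val P' Q' →
      ∫ x, u x ∂(M.law b P') - ∫ x, u x ∂(M.law b Q') =
        ∫ x, u x ∂(M.law b P) - ∫ x, u x ∂(M.law b Q) := by
    intro P' Q' h'
    have e : P + Q' = P' + Q := by
      have := h.eq.symm.trans h'.eq
      rw [sub_eq_sub_iff_add_eq_add] at this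
      exact this
    have := congrArg (fun T => ∫ x, u x ∂(M.law b T)) e
    simp only [integral_law_add M hu hC h.pos h'.pos' h.fin h'.fin',
      integral_law_add M hu hC h'.pos h.pos' h'.fin h.fin'] at this
    linarith
  exact key _ _ τ.exists_decomp.choose_spec.choose_spec

theorem expect_of_nonneg {τ : TC b} (h : 0 ≤ τ.val) (h' : traceE b τ.val ≠ ∞) :
    expect M u τ = ∫ x, u x ∂(M.law b τ.val) := by
  rw [expect_eq M hu hC (IsDecomp.of_nonneg h h'), POVM.law_zero]
  simp

theorem expect_add (σ τ : TC b) : expect M u (σ + τ) = expect M u σ + expect M u τ := by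
  obtain ⟨P, Q, h⟩ := σ.exists_decomp
  obtain ⟨P', Q', h'⟩ := τ.exists_decomp
  have hd : IsDecomp b (σ + τ).val (P + P') (Q + Q') := by rw [map_add]; exact h.add h'
  rw [expect_eq M hu hC hd, expect_eq M hu hC h, expect_eq M hu hC h',
    integral_law_add M hu hC h.pos h'.pos h.fin h'.fin,
    integral_law_add M hu hC h.pos' h'.pos' h.fin' h'.fin']
  ring

theorem expect_neg (τ : TC b) : expect M u (-τ) = -expect M u τ := by
  obtain ⟨P, Q, h⟩ := τ.exists_decomp
  have hd : IsDecomp b (-τ).val Q P := by rw [map_neg]; exact h.neg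
  rw [expect_eq M hu hC hd, expect_eq M hu hC h]
  ring

theorem expect_smul (c : ℝ) (τ : TC b) : expect M u (c • τ) = c * expect M u τ := by
  have key : ∀ c : ℝ, 0 ≤ c → expect M u (c • τ) = c * expect M u τ := by
    intro c hc
    obtain ⟨P, Q, h⟩ := τ.exists_decomp
    have hd : IsDecomp b (c • τ).val (c • P) (c • Q) := by rw [map_smul]; exact h.smul hc
    rw [expect_eq M hu hC hd, expect_eq M hu hC h, M.law_smul b h.pos hc, M.law_smul b h.pos' hc,
      integral_smul_measure, integral_smul_measure, ENNReal.toReal_ofReal hc]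
    simp only [smul_eq_mul]
    ring
  rcases le_total 0 c with hc | hc
  · exact key c hc
  · have := key (-c) (neg_nonneg.2 hc)
    rw [neg_smul, expect_neg M hu hC] at this
    linarith

theorem abs_expect_le (τ : TC b) : |expect M u τ| ≤ C * ‖τ‖ := by
  -- Without outcomes `C` might be negative. In that case every positive operator with a law has
  -- trace zero, being the total mass of an empty space, so `τ` has norm zero.
  rcases isEmpty_or_nonempty X with hX | ⟨⟨x₀⟩⟩
  · have : ∀ μ : Measure X, ∫ x, u x ∂μ = 0 := fun μ => by
      rw [Measure.eq_zero_of_isEmpty μ]; simp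
    obtain ⟨P, Q, h⟩ := τ.exists_decomp
    have h2 := norm_le h
    have huniv : ∀ {P : K →L[ℂ] K}, 0 ≤ P → traceE b P = 0 := fun hP => by
      rw [← M.law_univ b hP, Measure.eq_zero_of_isEmpty (M.law b _)]; simp
    rw [huniv h.pos, huniv h.pos'] at h2
    have h3 : ‖τ‖ = 0 := le_antisymm (by simpa using h2) (norm_nonneg _)
    rw [expect, this, this, h3]
    simp
  have hC0 : 0 ≤ C := (abs_nonneg _).trans (hC x₀)
  refine le_of_forall_pos_le_add fun ε hε => ?_
  -- Dividing by `C + 1` rather than `C` covers the case `C = 0`.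
  obtain ⟨P, Q, h, h'⟩ := τ.exists_decomp_lt (div_pos hε (by positivity : 0 < C + 1))
  rw [expect_eq M hu hC h]
  have key : ∀ {P : K →L[ℂ] K}, 0 ≤ P → traceE b P ≠ ∞ →
      |∫ x, u x ∂(M.law b P)| ≤ C * (traceE b P).toReal := by
    intro P hP hf
    have := isFiniteMeasure_law b M hP hf
    have := norm_integral_le_of_norm_le_const (μ := M.law b P) (.of_forall hC : ∀ᵐ x ∂_, ‖u x‖ ≤ C)
    rwa [Measure.real, M.law_univ b hP] at this
  calc _ ≤ |∫ x, u x ∂(M.law b P)| + |∫ x, u x ∂(M.law b Q)| := abs_sub _ _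
    _ ≤ C * (traceE b P).toReal + C * (traceE b Q).toReal :=
        add_le_add (key h.pos h.fin) (key h.pos' h.fin')
    _ = C * ((traceE b P).toReal + (traceE b Q).toReal) := by ring
    _ ≤ C * (‖τ‖ + ε / (C + 1)) := by gcongr
    _ = C * ‖τ‖ + ε * (C / (C + 1)) := by ring
    _ ≤ C * ‖τ‖ + ε * 1 := by
        gcongr
        rw [div_le_one (by positivity)]
        linarith
    _ = _ := by ring

/-- The expectation as a bounded linear functional of the state. -/
def expectCLM : TC b →L[ℝ] ℝ :=
  LinearMap.mkContinuous
    { toFun := expect M u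
      map_add' := expect_add M hu hC
      map_smul' := expect_smul M hu hC } C (abs_expect_le M hu hC)

end Lin

end TC

end TraceClass

/-! ### Tensor powers of trace class operators and differentiation -/

section TensorTC

variable {ι H : Type*} [NormedAddCommGroup H] [InnerProductSpace ℂ H]

/-- `tensorOp` as a multilinear map. -/
def tensorML (b : HilbertBasis ι ℂ H) (n : ℕ) :
    MultilinearMap ℝ (fun _ : Fin n => H →L[ℂ] H) (TensorPower ι n →L[ℂ] TensorPower ι n) where
  toFun := tensorOp b
  map_update_add' {inst} A k B C := by
    rw [Subsingleton.elim inst (instDecidableEqFin n)]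
    exact tensorOp_update_add b A k B C
  map_update_smul' {inst} A k c B := by
    rw [Subsingleton.elim inst (instDecidableEqFin n)]
    exact tensorOp_update_smul b A k c B

theorem tensorOp_sub_expand (b : HilbertBasis ι ℂ H) {n : ℕ} (P Q : Fin n → H →L[ℂ] H) :
    tensorOp b (fun k => P k - Q k) =
      ∑ s : Finset (Fin n), (∏ _k ∈ sᶜ, (-1 : ℝ)) • tensorOp b (s.piecewise P Q) := by
  have h1 : (fun k => P k - Q k) = P + fun k => (-1 : ℝ) • Q k := by
    ext1 k
    simp [sub_eq_add_neg]
  change tensorML b n _ = _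
  rw [h1, MultilinearMap.map_add_univ]
  refine Finset.sum_congr rfl fun s _ => ?_
  change _ = _ • tensorML b n _
  rw [← MultilinearMap.map_piecewise_smul]
  congr 1
  ext1 k
  by_cases h : k ∈ s <;> simp [h]

variable [CompleteSpace H] {b : HilbertBasis ι ℂ H}

theorem isDecomp_tensorOp {n : ℕ} {P : Fin n → H →L[ℂ] H} (hP : ∀ k, 0 ≤ P k)
    (hP' : ∀ k, traceE b (P k) ≠ ∞) :
    IsDecomp (tensorBasis ι n) (tensorOp b P) (tensorOp b P) 0 :=
  IsDecomp.of_nonneg (tensorOp_nonneg b hP) (by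
    rw [traceE_tensorOp b hP]
    exact ENNReal.prod_ne_top fun k _ => hP' k)

theorem piecewise_pos {n : ℕ} {A P Q : Fin n → H →L[ℂ] H} (h : ∀ k, IsDecomp b (A k) (P k) (Q k))
    (s : Finset (Fin n)) (k : Fin n) :
    0 ≤ s.piecewise P Q k ∧ traceE b (s.piecewise P Q k) ≠ ∞ := by
  by_cases hk : k ∈ s
  · simpa [hk] using ⟨(h k).pos, (h k).fin⟩
  · simpa [hk] using ⟨(h k).pos', (h k).fin'⟩

theorem tensorOp_mem {n : ℕ} {A : Fin n → H →L[ℂ] H} (h : ∀ k, A k ∈ tcSub b) :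
    tensorOp b A ∈ tcSub (tensorBasis ι n) := by
  choose P Q h using h
  rw [show A = fun k => P k - Q k from funext fun k => (h k).eq, tensorOp_sub_expand]
  refine Submodule.sum_mem _ fun s _ => Submodule.smul_mem _ _ (isDecomp_tensorOp
    (fun k => (piecewise_pos h s k).1) fun k => (piecewise_pos h s k).2).mem

/-- Expanding a product of differences gives a signed sum of positive tensor products, one for each
subset of the slots. Their traces are multiplicative and sum back to the product on the right. -/
theorem norm_tensorOp_le {n : ℕ} {A P Q : Fin n → H →L[ℂ] H}
    (h : ∀ k, IsDecomp b (A k) (P k) (Q k)) {τ : TC (tensorBasis ι n)}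
    (hτ : τ.val = tensorOp b A) :
    ‖τ‖ ≤ ∏ k, ((traceE b (P k)).toReal + (traceE b (Q k)).toReal) := by
  have hd : ∀ s : Finset (Fin n), IsDecomp (tensorBasis ι n) (tensorOp b (s.piecewise P Q))
      (tensorOp b (s.piecewise P Q)) 0 := fun s => isDecomp_tensorOp
    (fun k => (piecewise_pos h s k).1) fun k => (piecewise_pos h s k).2
  have e : τ = ∑ s : Finset (Fin n), (∏ _k ∈ sᶜ, (-1 : ℝ)) •
      TC.mk (tensorOp b (s.piecewise P Q)) (hd s).mem := by
    apply TC.val_injective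
    rw [hτ, map_sum, show A = fun k => P k - Q k from funext fun k => (h k).eq,
      tensorOp_sub_expand]
    refine Finset.sum_congr rfl fun s _ => ?_
    rw [map_smul, TC.val_mk]
  rw [e]
  refine (norm_sum_le _ _).trans ?_
  have h2 : ∏ k, ((traceE b (P k)).toReal + (traceE b (Q k)).toReal) =
      ∑ s : Finset (Fin n), ∏ k, s.piecewise (fun k => (traceE b (P k)).toReal)
        (fun k => (traceE b (Q k)).toReal) k := by
    have := (MultilinearMap.mkPiAlgebra ℝ (Fin n) ℝ).map_add_univ
      (fun k => (traceE b (P k)).toReal) (fun k => (traceE b (Q k)).toReal)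
    simpa using this
  rw [h2]
  refine Finset.sum_le_sum fun s _ => ?_
  rw [norm_smul]
  have h3 : ‖∏ _k ∈ sᶜ, (-1 : ℝ)‖ = 1 := by simp
  rw [h3, one_mul]
  refine (TC.norm_le (hd s)).trans_eq ?_
  rw [traceE_tensorOp b fun k => (piecewise_pos h s k).1, ENNReal.toReal_prod]
  simp only [traceE, zero_apply, inner_zero_right, Complex.zero_re, ENNReal.ofReal_zero,
    tsum_zero, ENNReal.toReal_zero, add_zero]
  refine Finset.prod_congr rfl fun k _ => ?_
  by_cases hk : k ∈ s <;> simp [hk]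

/-- The tensor product of self-adjoint trace class operators. -/
def TC.tensor (b : HilbertBasis ι ℂ H) (n : ℕ) :
    ContinuousMultilinearMap ℝ (fun _ : Fin n => TC b) (TC (tensorBasis ι n)) :=
  MultilinearMap.mkContinuous
    { toFun := fun τ => TC.mk (tensorOp b fun k => (τ k).val)
        (tensorOp_mem fun k => (τ k).val_mem)
      map_update_add' := by
        intro inst A k B C
        obtain rfl : inst = instDecidableEqFin n := Subsingleton.elim _ _
        apply TC.val_injective
        rw [map_add, TC.val_mk, TC.val_mk, TC.val_mk]
        change tensorOp b (fun l => TC.val (Function.update A k (B + C) l)) =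
          tensorOp b (fun l => TC.val (Function.update A k B l)) +
          tensorOp b (fun l => TC.val (Function.update A k C l))
        have e : ∀ B : TC b, (fun l => TC.val (Function.update A k B l)) =
            Function.update (fun l => (A l).val) k B.val := fun B =>
          funext fun l => Function.apply_update (fun _ => TC.val) A k B l
        rw [e, e, e, map_add]
        exact tensorOp_update_add b _ k _ _
      map_update_smul' := by
        intro inst A k c B
        obtain rfl : inst = instDecidableEqFin n := Subsingleton.elim _ _
        apply TC.val_injective
        rw [map_smul, TC.val_mk, TC.val_mk]
        change tensorOp b (fun l => TC.val (Function.update A k (c • B) l)) =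
          c • tensorOp b (fun l => TC.val (Function.update A k B l))
        have e : ∀ B : TC b, (fun l => TC.val (Function.update A k B l)) =
            Function.update (fun l => (A l).val) k B.val := fun B =>
          funext fun l => Function.apply_update (fun _ => TC.val) A k B l
        rw [e, e, map_smul]
        exact tensorOp_update_smul b _ k _ _ } 1
    (by
      intro τ
      rw [one_mul]
      -- The infimum in the norm need not be attained, so near-optimal decompositions are used in
      -- every slot and `ε` is sent to zero.
      have key : ∀ ε > 0, ‖TC.mk (tensorOp b fun k => (τ k).val)
          (tensorOp_mem fun k => (τ k).val_mem)‖ ≤ ∏ k, (‖τ k‖ + ε) := by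
        intro ε hε
        choose P Q h h' using fun k => (τ k).exists_decomp_lt hε
        refine (norm_tensorOp_le h (TC.val_mk _ _)).trans ?_
        exact Finset.prod_le_prod (fun k _ => by positivity) fun k _ => (h' k).le
      have hc : Tendsto (fun ε : ℝ => ∏ k, (‖τ k‖ + ε)) (𝓝[>] 0) (𝓝 (∏ k, ‖τ k‖)) := by
        have : Continuous fun ε : ℝ => ∏ k, (‖τ k‖ + ε) := by fun_prop
        have := this.tendsto 0
        simp only [add_zero] at this
        exact this.mono_left nhdsWithin_le_nhds
      exact ge_of_tendsto hc (eventually_mem_nhdsWithin.mono fun ε hε => key ε hε))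

theorem TC.val_tensor {n : ℕ} (τ : Fin n → TC b) :
    (TC.tensor b n τ).val = tensorOp b fun k => (τ k).val := rfl

/-- The derivative of the tensor power. -/
def TC.tensorDeriv (n : ℕ) (r d : TC b) : TC (tensorBasis ι n) :=
  ∑ k : Fin n, TC.tensor b n (Function.update (fun _ => r) k d)

theorem TC.val_tensorDeriv {n : ℕ} (r d : TC b) :
    (TC.tensorDeriv n r d).val = tensorSum b n r.val d.val := by
  rw [TC.tensorDeriv, map_sum, tensorSum]
  refine Finset.sum_congr rfl fun k _ => ?_
  rw [TC.val_tensor]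
  congr 1
  exact funext fun l => Function.apply_update (fun _ => TC.val) _ k d l

theorem TC.hasDerivAt_tensor {n : ℕ} {r : ℝ → TC b} {d : TC b} {s : ℝ} (h : HasDerivAt r d s) :
    HasDerivAt (fun t => TC.tensor b n fun _ => r t) (TC.tensorDeriv n (r s) d) s := by
  have h1 := (TC.tensor b n).hasFDerivAt fun _ => r s
  have h2 : HasDerivAt (fun t => (fun _ : Fin n => r t)) (fun _ => d) s :=
    hasDerivAt_pi.2 fun _ => h
  have := h1.comp_hasDerivAt s h2
  simpa [TC.tensorDeriv, Function.comp_def] using this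

theorem TC.differentiableAt_tensorDeriv {n : ℕ} {r d : ℝ → TC b} {s : ℝ}
    (hr : DifferentiableAt ℝ r s) (hd : DifferentiableAt ℝ d s) :
    DifferentiableAt ℝ (fun t => TC.tensorDeriv n (r t) (d t)) s := by
  unfold TC.tensorDeriv
  refine DifferentiableAt.fun_sum fun k _ => ?_
  have h1 := ((TC.tensor b n).hasFDerivAt (Function.update (fun _ => r s) k (d s))).differentiableAt
  refine h1.comp s (f := fun t => Function.update (fun _ => r t) k (d t)) ?_
  refine differentiableAt_pi.2 fun l => ?_
  by_cases h : l = k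
  · subst h; simpa
  · simpa [h]

/-- Subtract the quadratic Taylor polynomial. The derivative of the difference at `t` is the first
order error of `f'`, hence small compared with `t`, and the mean value inequality integrates it. The
derivative `f'` need be differentiable at 0 only. -/
theorem peano_second_order {V : Type*} [NormedAddCommGroup V] [NormedSpace ℝ V] {f f' : ℝ → V}
    {f'' : V} (h1 : ∀ᶠ s in 𝓝 0, HasDerivAt f (f' s) s) (h2 : HasDerivAt f' f'' 0) {ε : ℝ}
    (hε : 0 < ε) : ∀ᶠ s in 𝓝 0,
      ‖f s - f 0 - s • f' 0 - (s ^ 2 / 2) • f''‖ ≤ ε * s ^ 2 := by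
  rw [hasDerivAt_iff_isLittleO] at h2
  obtain ⟨δ, hδ, hball⟩ := Metric.eventually_nhds_iff_ball.1 (h1.and (h2.def hε))
  filter_upwards [Metric.ball_mem_nhds (0 : ℝ) hδ] with s hs
  set g : ℝ → V := fun t => f t - t • f' 0 - (t ^ 2 / 2) • f''
  have hg : ∀ t ∈ segment ℝ 0 s, HasDerivWithinAt g (f' t - f' 0 - t • f'') (segment ℝ 0 s) t := by
    intro t ht
    have htb : t ∈ Metric.ball (0 : ℝ) δ :=
      (convex_ball (0 : ℝ) δ).segment_subset (Metric.mem_ball_self hδ) hs ht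
    have e1 : HasDerivAt (fun t : ℝ => t • f' 0) (f' 0) t := by
      simpa using (hasDerivAt_id t).smul_const (f' 0)
    have e2 : HasDerivAt (fun t : ℝ => (t ^ 2 / 2) • f'') (t • f'') t := by
      have : HasDerivAt (fun t : ℝ => t ^ 2 / 2) t t := by
        simpa using (hasDerivAt_pow 2 t).div_const 2
      exact this.smul_const f''
    exact ((((hball t htb).1).sub e1).sub e2).hasDerivWithinAt
  have hb : ∀ t ∈ segment ℝ 0 s, ‖f' t - f' 0 - t • f''‖ ≤ ε * |s| := by
    intro t ht
    have htb : t ∈ Metric.ball (0 : ℝ) δ :=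
      (convex_ball (0 : ℝ) δ).segment_subset (Metric.mem_ball_self hδ) hs ht
    have h := (hball t htb).2
    simp only [sub_zero] at h
    refine h.trans ?_
    rw [Real.norm_eq_abs]
    refine mul_le_mul_of_nonneg_left ?_ hε.le
    obtain ⟨a, ha, rfl⟩ := (segment_eq_image ℝ (0 : ℝ) s) ▸ ht
    change |(1 - a) • (0 : ℝ) + a • s| ≤ |s|
    rw [smul_zero, zero_add, smul_eq_mul, abs_mul, abs_of_nonneg ha.1]
    exact mul_le_of_le_one_left (abs_nonneg s) ha.2
  have := (convex_segment (0 : ℝ) s).norm_image_sub_le_of_norm_hasDerivWithin_le hg hb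
    (left_mem_segment ℝ 0 s) (right_mem_segment ℝ 0 s)
  simp only [g, sub_zero, zero_smul, ne_eq, OfNat.ofNat_ne_zero, not_false_eq_true, zero_pow,
    zero_div, Real.norm_eq_abs] at this
  calc _ = ‖f s - s • f' 0 - (s ^ 2 / 2) • f'' - f 0‖ := by congr 1; abel
    _ ≤ ε * |s| * |s| := this
    _ = _ := by rw [mul_assoc, abs_mul_abs_self, sq]

end TensorTC

/-! ### The model as a differentiable curve of trace class operators -/

section ModelCalculus

variable {ι H : Type*} [NormedAddCommGroup H] [InnerProductSpace ℂ H] [CompleteSpace H]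
  {b : HilbertBasis ι ℂ H} {m : ℕ} {ρ : EuclideanSpace ℝ (Fin m) → H →L[ℂ] H}

/-- The point `θ + t e_i`. -/
abbrev shift (θ : EuclideanSpace ℝ (Fin m)) (i : Fin m) (t : ℝ) : EuclideanSpace ℝ (Fin m) :=
  θ + t • EuclideanSpace.single i 1

theorem shift_zero (θ : EuclideanSpace ℝ (Fin m)) (i : Fin m) : shift θ i 0 = θ := by
  simp

/-- Trace norm convergence implies operator norm convergence, and self-adjoint operators form a
closed set. -/
theorem HasTraceDeriv.isSelfAdjoint {i : Fin m} {θ : EuclideanSpace ℝ (Fin m)} {D : H →L[ℂ] H}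
    (h : HasTraceDeriv b ρ i θ D) (hs : ∀ᶠ t in 𝓝 (0 : ℝ), IsSelfAdjoint (ρ (shift θ i t))) :
    IsSelfAdjoint D := by
  have h0 : IsSelfAdjoint (ρ θ) := by
    have := hs.self_of_nhds
    rwa [shift_zero] at this
  have h1 : Tendsto (fun t : ℝ => t⁻¹ • (ρ (shift θ i t) - ρ θ)) (𝓝[≠] 0) (𝓝 D) := by
    rw [tendsto_iff_norm_sub_tendsto_zero]
    have : Tendsto (fun t : ℝ => ‖t⁻¹ • (ρ (shift θ i t) - ρ θ) - D‖ₑ) (𝓝[≠] 0) (𝓝 0) :=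
      tendsto_of_tendsto_of_tendsto_of_le_of_le tendsto_const_nhds h (fun _ => bot_le)
        fun t => enorm_le_traceNorm b _
    simpa [Function.comp_def] using (ENNReal.tendsto_toReal ENNReal.zero_ne_top).comp this
  have hcl : IsClosed {A : H →L[ℂ] H | IsSelfAdjoint A} :=
    isClosed_eq continuous_star continuous_id
  refine hcl.mem_of_tendsto h1 ((hs.filter_mono nhdsWithin_le_nhds).mono fun t ht => ?_)
  exact (IsSelfAdjoint.all (t⁻¹ : ℝ)).smul (ht.sub h0)

theorem HasTraceDeriv.hasDerivAt {i : Fin m} {θ : EuclideanSpace ℝ (Fin m)} {D : H →L[ℂ] H}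
    (h : HasTraceDeriv b ρ i θ D) {R : ℝ → TC b} {d : TC b} (hd : d.val = D)
    (hR : ∀ᶠ t in 𝓝 (0 : ℝ), (R t).val = ρ (shift θ i t)) : HasDerivAt R d 0 := by
  have h0 : (R 0).val = ρ θ := by
    have := hR.self_of_nhds
    rwa [shift_zero] at this
  rw [hasDerivAt_iff_tendsto_slope_zero, tendsto_iff_norm_sub_tendsto_zero]
  have h1 := (ENNReal.tendsto_toReal ENNReal.zero_ne_top).comp h
  have hfin : ∀ᶠ t in 𝓝[≠] (0 : ℝ),
      traceNorm b (t⁻¹ • (ρ (shift θ i t) - ρ θ) - D) < 1 := h.eventually_lt_const (by simp)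
  refine squeeze_zero' (.of_forall fun t => norm_nonneg _) ?_ h1
  filter_upwards [hfin, hR.filter_mono nhdsWithin_le_nhds] with t ht hRt
  have e : (t⁻¹ • (R (0 + t) - R 0) - d).val = t⁻¹ • (ρ (shift θ i t) - ρ θ) - D := by
    rw [map_sub, map_smul, map_sub, zero_add, hRt, h0, hd]
  have := TC.norm_le_traceNorm (τ := t⁻¹ • (R (0 + t) - R 0) - d) (by
    rw [e]; exact ne_top_of_lt ht)
  rwa [e] at this

theorem traceDeriv_spec {i : Fin m} {θ : EuclideanSpace ℝ (Fin m)}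
    (h : ∃ D, HasTraceDeriv b ρ i θ D) : HasTraceDeriv b ρ i θ (traceDeriv b ρ i θ) := by
  rw [traceDeriv, dif_pos h]
  exact h.choose_spec

theorem continuous_shift (θ : EuclideanSpace ℝ (Fin m)) (i : Fin m) : Continuous (shift θ i) := by
  unfold shift
  fun_prop

theorem eventually_shift_mem {Θ : Set (EuclideanSpace ℝ (Fin m))} (hΘ : IsOpen Θ)
    {θ : EuclideanSpace ℝ (Fin m)} (hθ : θ ∈ Θ) (i : Fin m) :
    ∀ᶠ t in 𝓝 (0 : ℝ), shift θ i t ∈ Θ :=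
  (continuous_shift θ i).continuousAt.eventually_mem
    (by rw [shift_zero]; exact hΘ.mem_nhds hθ)

section Smooth

variable {Θ : Set (EuclideanSpace ℝ (Fin m))} (hΘ : IsOpen Θ)
  (hρ : ∀ θ ∈ Θ, IsDensity b (ρ θ)) (h1 : CondM1 b ρ Θ)
include hΘ hρ h1

theorem traceDeriv_selfAdjoint {θ : EuclideanSpace ℝ (Fin m)} (hθ : θ ∈ Θ) (i : Fin m) :
    IsSelfAdjoint (traceDeriv b ρ i θ) :=
  (traceDeriv_spec (h1.exists_fst θ hθ i)).isSelfAdjoint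
    ((eventually_shift_mem hΘ hθ i).mono fun _ ht => IsSelfAdjoint.of_nonneg (hρ _ ht).1)

theorem traceDeriv_decomp {θ : EuclideanSpace ℝ (Fin m)} (hθ : θ ∈ Θ) (i : Fin m) :
    IsDecomp b (traceDeriv b ρ i θ) (traceDeriv b ρ i θ)⁺ (traceDeriv b ρ i θ)⁻ := by
  obtain ⟨a₁, ha⟩ := h1.bound
  exact .of_selfAdjoint (traceDeriv_selfAdjoint hΘ hρ h1 hθ i)
    (ne_top_of_le_ne_top (by simp) ((ha θ hθ).1 i))

theorem traceDeriv2_decomp {θ : EuclideanSpace ℝ (Fin m)} (hθ : θ ∈ Θ) (i j : Fin m) :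
    IsDecomp b (traceDeriv b (traceDeriv b ρ j) i θ) (traceDeriv b (traceDeriv b ρ j) i θ)⁺
      (traceDeriv b (traceDeriv b ρ j) i θ)⁻ := by
  obtain ⟨a₁, ha⟩ := h1.bound
  exact .of_selfAdjoint ((traceDeriv_spec (h1.exists_snd θ hθ i j)).isSelfAdjoint
    ((eventually_shift_mem hΘ hθ i).mono fun t ht => traceDeriv_selfAdjoint hΘ hρ h1 ht j))
    (ne_top_of_le_ne_top (by simp) ((ha θ hθ).2 i j))

omit hΘ h1 in
theorem val_state {θ : EuclideanSpace ℝ (Fin m)} (hθ : θ ∈ Θ) :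
    (TC.ofOp b (ρ θ)).val = ρ θ :=
  TC.val_ofOp (.of_nonneg (hρ θ hθ).1 (by rw [(hρ θ hθ).2]; simp))

theorem val_traceDeriv {θ : EuclideanSpace ℝ (Fin m)} (hθ : θ ∈ Θ) (i : Fin m) :
    (TC.ofOp b (traceDeriv b ρ i θ)).val = traceDeriv b ρ i θ :=
  TC.val_ofOp (traceDeriv_decomp hΘ hρ h1 hθ i)

/-- The trace derivative gives differentiability at parameter 0 of the line through any point;
translation along the line moves it to `s`. Outside `Θ` the curve may take the default value of
`TC.ofOp`, which is harmless as `Θ` is open. -/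
theorem hasDerivAt_state {θ : EuclideanSpace ℝ (Fin m)} (i : Fin m) {s : ℝ}
    (hθ : shift θ i s ∈ Θ) : HasDerivAt (fun t => TC.ofOp b (ρ (shift θ i t)))
      (TC.ofOp b (traceDeriv b ρ i (shift θ i s))) s := by
  have h := (traceDeriv_spec (h1.exists_fst _ hθ i)).hasDerivAt
    (R := fun t => TC.ofOp b (ρ (shift (shift θ i s) i t))) (val_traceDeriv hΘ hρ h1 hθ i)
    ((eventually_shift_mem hΘ hθ i).mono fun t ht => val_state hρ ht)
  have e : ∀ t, shift (shift θ i s) i t = shift θ i (s + t) := fun t => by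
    simp [shift, add_smul, add_assoc]
  simp only [e] at h
  have h' := HasDerivAt.comp_sub_const s s (f := fun t => TC.ofOp b (ρ (shift θ i (s + t))))
    (by simpa using h)
  simpa using h'

theorem hasDerivAt_traceDeriv {θ : EuclideanSpace ℝ (Fin m)} (i j : Fin m) {s : ℝ}
    (hθ : shift θ i s ∈ Θ) : HasDerivAt (fun t => TC.ofOp b (traceDeriv b ρ j (shift θ i t)))
      (TC.ofOp b (traceDeriv b (traceDeriv b ρ j) i (shift θ i s))) s := by
  have h := (traceDeriv_spec (h1.exists_snd _ hθ i j)).hasDerivAt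
    (R := fun t => TC.ofOp b (traceDeriv b ρ j (shift (shift θ i s) i t)))
    (TC.val_ofOp (traceDeriv2_decomp hΘ hρ h1 hθ i j))
    ((eventually_shift_mem hΘ hθ i).mono fun t ht => val_traceDeriv hΘ hρ h1 ht j)
  have e : ∀ t, shift (shift θ i s) i t = shift θ i (s + t) := fun t => by
    simp [shift, add_smul, add_assoc]
  simp only [e] at h
  have h' := HasDerivAt.comp_sub_const s s
    (f := fun t => TC.ofOp b (traceDeriv b ρ j (shift θ i (s + t)))) (by simpa using h)
  simpa using h'

theorem exists_norm_bound : ∃ C : ℝ, ∀ θ ∈ Θ, (∀ i, ‖TC.ofOp b (traceDeriv b ρ i θ)‖ ≤ C) ∧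
    ∀ i j, ‖TC.ofOp b (traceDeriv b (traceDeriv b ρ j) i θ)‖ ≤ C := by
  obtain ⟨a₁, ha⟩ := h1.bound
  refine ⟨a₁, fun θ hθ => ⟨fun i => ?_, fun i j => ?_⟩⟩
  · have e := val_traceDeriv hΘ hρ h1 hθ i
    have hb := (ha θ hθ).1 i
    rw [← e] at hb
    exact (TC.norm_le_traceNorm (ne_top_of_le_ne_top (by simp) hb)).trans
      (ENNReal.toReal_mono (by simp) hb)
  · have e := TC.val_ofOp (traceDeriv2_decomp hΘ hρ h1 hθ i j)
    have hb := (ha θ hθ).2 i j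
    rw [← e] at hb
    exact (TC.norm_le_traceNorm (ne_top_of_le_ne_top (by simp) hb)).trans
      (ENNReal.toReal_mono (by simp) hb)

/-- Second order expansion of the `n`-fold state along a coordinate line. -/
theorem exists_tensor_expansion (n : ℕ) {θ : EuclideanSpace ℝ (Fin m)} (hθ : θ ∈ Θ) (i : Fin m) :
    ∃ τ₂ : TC (tensorBasis ι n), ∀ ε > 0, ∀ᶠ s in 𝓝 (0 : ℝ),
      ‖(TC.tensor b n fun _ => TC.ofOp b (ρ (shift θ i s))) -
        (TC.tensor b n fun _ => TC.ofOp b (ρ θ)) -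
        s • TC.tensorDeriv n (TC.ofOp b (ρ θ)) (TC.ofOp b (traceDeriv b ρ i θ)) -
        (s ^ 2 / 2) • τ₂‖ ≤ ε * s ^ 2 := by
  -- The first derivative of the tensor power is multilinear in the state and its derivative. Both
  -- are differentiable at 0, the latter by the existence of second derivatives in (M.1).
  have hd : DifferentiableAt ℝ (fun s => TC.tensorDeriv n (TC.ofOp b (ρ (shift θ i s)))
      (TC.ofOp b (traceDeriv b ρ i (shift θ i s)))) 0 :=
    TC.differentiableAt_tensorDeriv
      (hasDerivAt_state hΘ hρ h1 i (by rwa [shift_zero])).differentiableAt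
      (hasDerivAt_traceDeriv hΘ hρ h1 i i (by rwa [shift_zero])).differentiableAt
  obtain ⟨τ₂, h2⟩ : ∃ τ₂, HasDerivAt (fun s => TC.tensorDeriv n (TC.ofOp b (ρ (shift θ i s)))
      (TC.ofOp b (traceDeriv b ρ i (shift θ i s)))) τ₂ 0 := ⟨_, hd.hasDerivAt⟩
  refine ⟨τ₂, fun ε hε => ?_⟩
  have := peano_second_order (f := fun s => TC.tensor b n fun _ => TC.ofOp b (ρ (shift θ i s)))
    ((eventually_shift_mem hΘ hθ i).mono fun s hs =>
      TC.hasDerivAt_tensor (hasDerivAt_state hΘ hρ h1 i hs)) h2 hε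
  simpa only [shift_zero] using this

end Smooth

end ModelCalculus

/-! ### Cauchy-Schwarz and differentiation under the expectation -/

section MeasureLemmas

variable {X : Type*} [MeasurableSpace X]

/-- Cauchy-Schwarz inequality for measures that satisfy it on every measurable set. -/
theorem sq_integral_sub_le {p p₁ p₁' q : Measure X} [IsFiniteMeasure p] [IsFiniteMeasure p₁]
    [IsFiniteMeasure p₁'] [IsFiniteMeasure q]
    (H : ∀ A, MeasurableSet A → (p₁.real A - p₁'.real A) ^ 2 ≤ p.real A * q.real A)
    {u : X → ℝ} (hu : Measurable u) (h2 : MemLp u 2 p) (h1 : Integrable u p₁)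
    (h1' : Integrable u p₁') :
    (∫ x, u x ∂p₁ - ∫ x, u x ∂p₁') ^ 2 ≤ q.real Set.univ * ∫ x, u x ^ 2 ∂p := by
  have hs : ∀ f : SimpleFunc X ℝ,
      (∫ x, f x ∂p₁ - ∫ x, f x ∂p₁') ^ 2 ≤ q.real Set.univ * ∫ x, f x ^ 2 ∂p := by
    intro f
    have hi : ∀ (μ : Measure X) [IsFiniteMeasure μ] (g : SimpleFunc X ℝ), Integrable g μ :=
      fun μ _ g => SimpleFunc.integrable_of_isFiniteMeasure g
    have e : ∀ (μ : Measure X) [IsFiniteMeasure μ], ∫ x, f x ∂μ =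
        ∑ y ∈ f.range, μ.real (f ⁻¹' {y}) * y := fun μ _ => by
      rw [SimpleFunc.integral_eq_sum f (hi μ f)]; rfl
    have hq : q.real Set.univ = ∑ y ∈ f.range, q.real (f ⁻¹' {y}) := by
      rw [measureReal_def, ← SimpleFunc.sum_range_measure_preimage_singleton f q,
        ENNReal.toReal_sum (fun _ _ => measure_ne_top _ _)]
      rfl
    have hp : ∫ x, f x ^ 2 ∂p = ∑ y ∈ f.range, y ^ 2 * p.real (f ⁻¹' {y}) := by
      have h1 : ∀ x, f x ^ 2 = ∑ y ∈ f.range, (f ⁻¹' {y}).indicator (fun _ => y ^ 2) x := by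
        intro x
        rw [Finset.sum_eq_single (f x)]
        · simp
        · intro y _ hy
          rw [Set.indicator_of_notMem]
          simpa using hy.symm
        · intro h; exact absurd (SimpleFunc.mem_range_self f x) h
      simp_rw [h1]
      rw [integral_finsetSum _ fun y _ =>
        (integrable_const _).indicator (f.measurableSet_preimage _)]
      refine Finset.sum_congr rfl fun y _ => ?_
      rw [integral_indicator (f.measurableSet_preimage _), setIntegral_const, smul_eq_mul, mul_comm]
    rw [e p₁, e p₁', hq, hp, ← Finset.sum_sub_distrib, mul_comm]
    -- Cauchy-Schwarz for the sum over the values of the simple function; the hypothesis `H` on each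
    -- fibre provides the bound term by term.
    refine Finset.sum_sq_le_sum_mul_sum_of_sq_le_mul _ (fun y _ => by positivity)
      (fun y _ => by positivity) fun y _ => ?_
    have := H _ (f.measurableSet_preimage {y})
    rw [← sub_mul, mul_pow]
    nlinarith [sq_nonneg y]
  let f := fun n => SimpleFunc.approxOn u hu Set.univ 0 (Set.mem_univ _) n
  have hf : ∀ x, Tendsto (fun n => f n x) atTop (𝓝 (u x)) := fun x =>
    SimpleFunc.tendsto_approxOn hu _ (by simp)
  have hb : ∀ n x, ‖f n x‖ ≤ 2 * ‖u x‖ := fun n x => by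
    have := SimpleFunc.norm_approxOn_zero_le hu (Set.mem_univ (0 : ℝ)) x n
    linarith
  have t1 : ∀ {μ : Measure X}, Integrable u μ →
      Tendsto (fun n => ∫ x, f n x ∂μ) atTop (𝓝 (∫ x, u x ∂μ)) := fun hμ =>
    tendsto_integral_of_dominated_convergence (fun x => 2 * ‖u x‖)
      (fun n => (f n).measurable.aestronglyMeasurable) (hμ.norm.const_mul 2)
      (fun n => .of_forall (hb n)) (.of_forall hf)
  have t2 : Tendsto (fun n => ∫ x, f n x ^ 2 ∂p) atTop (𝓝 (∫ x, u x ^ 2 ∂p)) :=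
    tendsto_integral_of_dominated_convergence (fun x => 4 * u x ^ 2)
      (fun n => ((f n).measurable.pow_const 2).aestronglyMeasurable)
      (h2.integrable_sq.const_mul 4)
      (fun n => .of_forall fun x => by
        have := pow_le_pow_left₀ (norm_nonneg _) (hb n x) 2
        rw [norm_pow]
        refine this.trans_eq ?_
        rw [mul_pow, Real.norm_eq_abs, sq_abs]
        norm_num)
      (.of_forall fun x => (hf x).pow 2)
  exact le_of_tendsto_of_tendsto' (((t1 h1).sub (t1 h1')).pow 2) (t2.const_mul _) fun n => hs (f n)

/-- The function `y` clipped to the interval `[-1, 1]`. -/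
def clip (y : ℝ) : ℝ := max (-1) (min 1 y)

theorem measurable_clip : Measurable clip := by unfold clip; fun_prop

theorem continuous_clip : Continuous clip := by unfold clip; fun_prop

theorem abs_clip_le_one (y : ℝ) : |clip y| ≤ 1 := by
  rw [clip, abs_le]
  exact ⟨le_max_left _ _, max_le (by norm_num) (min_le_left _ _)⟩

theorem clip_eq {y : ℝ} (h : |y| ≤ 1) : clip y = y := by
  rw [abs_le] at h
  rw [clip, min_eq_right h.2, max_eq_right h.1]

theorem abs_clip_le (y : ℝ) : |clip y| ≤ |y| := by
  rcases le_total |y| 1 with h | h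
  · rw [clip_eq h]
  · exact (abs_clip_le_one y).trans h

/-- The error of clipping is zero unless `|y| > 1`, where `|y| ≤ y ^ 2`. In this form second moments
control truncation errors. -/
theorem abs_sub_clip_le (y : ℝ) : |y - clip y| ≤ y ^ 2 := by
  rcases le_total |y| 1 with h | h
  · rw [clip_eq h, sub_self, abs_zero]; positivity
  · have h3 : |y| ≤ y ^ 2 := by rw [← sq_abs]; nlinarith
    refine le_trans ?_ h3
    rcases abs_cases y with ⟨h1, h2⟩ | ⟨h1, h2⟩ <;> rw [h1] at h ⊢
    · rw [clip, min_eq_left h, max_eq_right (by norm_num), abs_le]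
      constructor <;> linarith
    · rw [clip, min_eq_right (by linarith), max_eq_left (by linarith), abs_le]
      constructor <;> linarith

theorem integrable_of_lintegral_sq {μ : Measure X} [IsFiniteMeasure μ] {u : X → ℝ}
    (hu : Measurable u) {C : ℝ≥0} (hC : ∫⁻ x, ‖u x‖ₑ ^ 2 ∂μ ≤ C) : MemLp u 2 μ := by
  refine ⟨hu.aestronglyMeasurable, ?_⟩
  rw [eLpNorm_lt_top_iff_lintegral_rpow_enorm_lt_top (by norm_num) (by norm_num)]
  have : ∫⁻ x, ‖u x‖ₑ ^ 2 ∂μ < ∞ := hC.trans_lt (by simp)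
  simpa using this

theorem integral_sq_le_of_lintegral {μ : Measure X} {u : X → ℝ}
    {C : ℝ≥0} (hC : ∫⁻ x, ‖u x‖ₑ ^ 2 ∂μ ≤ C) : ∫ x, u x ^ 2 ∂μ ≤ C := by
  by_cases hi : AEStronglyMeasurable (fun x => u x ^ 2) μ
  · rw [integral_eq_lintegral_of_nonneg_ae (.of_forall fun x => sq_nonneg _) hi]
    have e : ∀ x, ENNReal.ofReal (u x ^ 2) = ‖u x‖ₑ ^ 2 := fun x => by
      rw [← sq_abs, ENNReal.ofReal_pow (abs_nonneg _), ← Real.norm_eq_abs, ofReal_norm]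
    simp_rw [e]
    exact ENNReal.toReal_mono (by simp) hC
  · rw [integral_non_aestronglyMeasurable hi]
    exact C.2

/-- Differentiation under the expectation, for an unbounded observable with locally bounded second
moments, along a curve of probability measures with a second order expansion in total variation. -/
theorem hasDerivAt_integral_of_expansion {p : ℝ → Measure X} {p₁ p₁' p₂ p₂' : Measure X}
    [IsFiniteMeasure p₁] [IsFiniteMeasure p₁'] [IsFiniteMeasure p₂] [IsFiniteMeasure p₂']
    (hp : ∀ᶠ s in 𝓝 0, IsProbabilityMeasure (p s))
    (hexp : ∀ ε > 0, ∀ᶠ s in 𝓝 (0 : ℝ), ∀ v : X → ℝ, Measurable v → (∀ x, |v x| ≤ 1) →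
      |∫ x, v x ∂(p s) - ∫ x, v x ∂(p 0) - s * (∫ x, v x ∂p₁ - ∫ x, v x ∂p₁') -
        s ^ 2 / 2 * (∫ x, v x ∂p₂ - ∫ x, v x ∂p₂')| ≤ ε * s ^ 2)
    {u : X → ℝ} (hu : Measurable u) {C : ℝ≥0} (hC : ∀ᶠ s in 𝓝 0, ∫⁻ x, ‖u x‖ₑ ^ 2 ∂(p s) ≤ C)
    (h1 : Integrable u p₁) (h1' : Integrable u p₁') :
    HasDerivAt (fun s => ∫ x, u x ∂(p s)) (∫ x, u x ∂p₁ - ∫ x, u x ∂p₁') 0 := by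
  rw [hasDerivAt_iff_isLittleO, Asymptotics.isLittleO_iff]
  intro η hη
  set d := ∫ x, u x ∂p₁ - ∫ x, u x ∂p₁' with hd
  -- The observable is truncated at height `Λ / |s|`. By the second moment bound the truncation
  -- changes each of the two expectations by at most `C * |s| / Λ`; the choice of `Λ` makes the
  -- total at most `η * |s| / 4`.
  obtain ⟨Λ, hΛ, hΛC⟩ : ∃ Λ : ℝ, 0 < Λ ∧ 2 * C / Λ ≤ η / 4 := by
    refine ⟨8 * C / η + 1, by positivity, ?_⟩
    rw [div_le_div_iff₀ (by positivity) (by norm_num)]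
    have : η * (8 * C / η + 1) = 8 * C + η := by field_simp
    linarith
  -- This is the truncated observable rescaled by `|s| / Λ` so as to be bounded by 1. Undoing the
  -- scaling costs a factor `Λ / |s|`, which is why the expansion is required with error `o(s ^ 2)`:
  -- an error `o(s)` would not survive.
  let w : ℝ → X → ℝ := fun s x => clip (|s| / Λ * u x)
  have hwm : ∀ s, Measurable (w s) := fun s => measurable_clip.comp (hu.const_mul _)
  have hw1 : ∀ s x, |w s x| ≤ 1 := fun s x => abs_clip_le_one _
  have hw0 : ∀ x, Tendsto (fun s => w s x) (𝓝 0) (𝓝 0) := fun x => by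
    have : Continuous fun s => w s x := continuous_clip.comp (by fun_prop)
    simpa [w, clip] using this.tendsto 0
  have t2 : ∀ (μ : Measure X) [IsFiniteMeasure μ],
      Tendsto (fun s => ∫ x, w s x ∂μ) (𝓝 0) (𝓝 0) := fun μ _ => by
    simpa using tendsto_integral_filter_of_dominated_convergence (μ := μ) (F := w)
      (f := fun _ => 0) (fun _ => (1 : ℝ))
      (.of_forall fun s => (hwm s).aestronglyMeasurable) (.of_forall fun s => .of_forall (hw1 s))
      (integrable_const _) (.of_forall hw0)
  have t1 : ∀ {μ : Measure X}, Integrable u μ →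
      Tendsto (fun s => ∫ x, (|s| / Λ)⁻¹ * w s x ∂μ) (𝓝[≠] 0) (𝓝 (∫ x, u x ∂μ)) := by
    intro μ hμ
    refine tendsto_integral_filter_of_dominated_convergence (fun x => |u x|)
      (.of_forall fun s => ((hwm s).const_mul _).aestronglyMeasurable) ?_ hμ.abs ?_
    · filter_upwards [self_mem_nhdsWithin] with s hs
      refine .of_forall fun x => ?_
      have hs' : 0 < |s| / Λ := div_pos (abs_pos.2 hs) hΛ
      rw [norm_mul, norm_inv, Real.norm_eq_abs, Real.norm_eq_abs, abs_of_pos hs',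
        inv_mul_le_iff₀ hs']
      refine (abs_clip_le _).trans_eq ?_
      rw [abs_mul, abs_of_pos hs']
    · refine .of_forall fun x => ?_
      have hc : ∀ᶠ s in 𝓝[≠] (0 : ℝ), |(|s| / Λ * u x)| < 1 := by
        have : Tendsto (fun s : ℝ => |(|s| / Λ * u x)|) (𝓝 0) (𝓝 0) := by
          have : Continuous fun s : ℝ => |(|s| / Λ * u x)| := by fun_prop
          simpa using this.tendsto 0
        exact (this.mono_left nhdsWithin_le_nhds).eventually_lt_const one_pos
      refine tendsto_const_nhds.congr' ?_
      filter_upwards [hc, self_mem_nhdsWithin] with s hs h0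
      have hs' : 0 < |s| / Λ := div_pos (abs_pos.2 h0) hΛ
      change u x = _ * clip _
      rw [clip_eq hs.le, inv_mul_cancel_left₀ hs'.ne']
  have T1 : ∀ᶠ s in 𝓝[≠] 0, |∫ x, (|s| / Λ)⁻¹ * w s x ∂p₁ - ∫ x, (|s| / Λ)⁻¹ * w s x ∂p₁' - d|
      < η / 4 := by
    have := ((t1 h1).sub (t1 h1')).sub_const d
    rw [← hd, sub_self] at this
    exact (tendsto_zero_iff_abs_tendsto_zero _ |>.1 this).eventually_lt_const (by positivity)
  -- The second order term, after the scaling is undone, is `|s| * Λ / 2` times the integrals of `w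
  -- s`, and these tend to zero because `w s` is bounded and tends to zero pointwise.
  have T2 : ∀ᶠ s in 𝓝 0, |∫ x, w s x ∂p₂ - ∫ x, w s x ∂p₂'| < η / (4 * Λ) := by
    have := (t2 p₂).sub (t2 p₂')
    rw [sub_zero] at this
    exact (tendsto_zero_iff_abs_tendsto_zero _ |>.1 this).eventually_lt_const (by positivity)
  have main : ∀ᶠ s in 𝓝[≠] 0, ‖∫ x, u x ∂(p s) - ∫ x, u x ∂(p 0) - (s - 0) • d‖ ≤ η * ‖s - 0‖ := by
    filter_upwards [T1, nhdsWithin_le_nhds T2, nhdsWithin_le_nhds (hexp (η / (4 * Λ)) (by positivity)),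
      nhdsWithin_le_nhds hp, nhdsWithin_le_nhds hC, self_mem_nhdsWithin]
      with s hT1 hT2 hE hps hCs hs
    have hp0 : IsProbabilityMeasure (p 0) := hp.self_of_nhds
    have hs' : 0 < |s| := abs_pos.2 hs
    set a := |s| / Λ with ha
    have ha0 : 0 < a := div_pos hs' hΛ
    have tail : ∀ (μ : Measure X) [IsProbabilityMeasure μ], ∫⁻ x, ‖u x‖ₑ ^ 2 ∂μ ≤ C →
        |a * ∫ x, u x ∂μ - ∫ x, w s x ∂μ| ≤ a ^ 2 * C := by
      intro μ _ hμ
      have hL := integrable_of_lintegral_sq hu hμ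
      have hi := hL.integrable one_le_two
      have hwi : Integrable (w s) μ :=
        Integrable.of_bound (hwm s).aestronglyMeasurable 1 (.of_forall (hw1 s))
      rw [← integral_const_mul, ← integral_sub (hi.const_mul a) hwi]
      calc _ ≤ ∫ x, |a * u x - w s x| ∂μ := abs_integral_le_integral_abs
        _ ≤ ∫ x, a ^ 2 * u x ^ 2 ∂μ := by
          refine integral_mono ((hi.const_mul a).sub hwi).abs (hL.integrable_sq.const_mul _)
            fun x => ?_
          have := abs_sub_clip_le (a * u x)
          rwa [mul_pow] at this
        _ = a ^ 2 * ∫ x, u x ^ 2 ∂μ := integral_const_mul _ _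
        _ ≤ _ := by gcongr; exact integral_sq_le_of_lintegral hμ
    have e1 := tail (p s) hCs
    have e2 := tail (p 0) hC.self_of_nhds
    have e3 := hE (w s) (hwm s) (hw1 s)
    rw [integral_const_mul, integral_const_mul, ← mul_sub] at hT1
    set W1 := ∫ x, w s x ∂p₁ - ∫ x, w s x ∂p₁'
    set W2 := ∫ x, w s x ∂p₂ - ∫ x, w s x ∂p₂'
    have e4 : |W1 - a * d| ≤ a * (η / 4) := by
      have : W1 - a * d = a * (a⁻¹ * W1 - d) := by field_simp
      rw [this, abs_mul, abs_of_pos ha0]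
      gcongr
    have e5 : |s * (W1 - a * d)| ≤ |s| * (a * (η / 4)) := by rw [abs_mul]; gcongr
    have e6 : |s ^ 2 / 2 * W2| ≤ s ^ 2 / 2 * (η / (4 * Λ)) := by
      rw [abs_mul, abs_of_nonneg (by positivity)]; gcongr
    have hsa : |s| = a * Λ := by rw [ha]; field_simp
    have hs2 : s ^ 2 = |s| * (a * Λ) := by rw [← hsa, ← sq, sq_abs]
    have e7 : s ^ 2 * (η / (4 * Λ)) = |s| * a * (η / 4) := by rw [hs2]; field_simp
    have e8 : a ^ 2 * (2 * C) ≤ |s| * a * (η / 4) := by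
      rw [div_le_iff₀ hΛ] at hΛC
      calc a ^ 2 * (2 * C) ≤ a ^ 2 * (η / 4 * Λ) := by gcongr
        _ = _ := by rw [hsa]; ring
    rw [sub_zero, Real.norm_eq_abs, Real.norm_eq_abs, smul_eq_mul]
    -- In units of `a * η * |s|` the errors are `1/4` from the two truncations, `1/4` from the
    -- expansion, `1/4` from the first order term and `1/8` from the second order term.
    have key : a * |∫ x, u x ∂(p s) - ∫ x, u x ∂(p 0) - s * d| ≤ a * (η * |s|) := by
      rw [← abs_of_pos ha0, ← abs_mul, abs_of_pos ha0]
      rw [abs_le] at e1 e2 e3 e5 e6 ⊢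
      have hpos : 0 ≤ |s| * a * (η / 4) := by positivity
      constructor <;> nlinarith
    exact le_of_mul_le_mul_left key ha0
  rw [eventually_nhdsWithin_iff] at main
  filter_upwards [main] with s hs
  by_cases h0 : s = 0
  · subst h0; simp
  · exact hs h0

end MeasureLemmas

/-! ### The information inequality for operators -/

section Fisher

/-- The measurement with a single outcome. -/
def POVM.trivial (K : Type*) [NormedAddCommGroup K] [InnerProductSpace ℂ K] [CompleteSpace K] :
    POVM Unit K :=
  POVM.ofDiag (fun Δ => (Measure.dirac () Δ).toReal • 1)
    (fun Δ _ => smul_nonneg ENNReal.toReal_nonneg zero_le_one) (by simp)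
    (by
      intro Δ hm hd φ
      have e : ∀ Δ : Set Unit, ENNReal.ofReal (⟪φ, ((Measure.dirac () Δ).toReal •
          (1 : K →L[ℂ] K)) φ⟫_ℂ).re = Measure.dirac () Δ * ‖φ‖ₑ ^ 2 := by
        intro Δ
        rw [smul_apply, ← Complex.coe_smul, inner_smul_right,
          Complex.re_ofReal_mul, ENNReal.ofReal_mul ENNReal.toReal_nonneg,
          ENNReal.ofReal_toReal (measure_ne_top _ _)]
        congr 1
        exact ofReal_inner_self φ
      simp_rw [e]
      rw [ENNReal.tsum_mul_right, measure_iUnion hd hm])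

variable {ι H : Type*} [NormedAddCommGroup H] [InnerProductSpace ℂ H] [CompleteSpace H]
  {b : HilbertBasis ι ℂ H}

theorem hasSum_trace {P : H →L[ℂ] H} (hP : 0 ≤ P) (h : traceE b P ≠ ∞) :
    HasSum (fun j => (⟪b j, P (b j)⟫_ℂ).re) (traceE b P).toReal := by
  have h0 : ∀ j, 0 ≤ (⟪b j, P (b j)⟫_ℂ).re := fun j => re_inner_nonneg_op hP _
  have hs : Summable fun j => (⟪b j, P (b j)⟫_ℂ).re := by
    have := ENNReal.summable_toReal h
    simpa only [ENNReal.toReal_ofReal (h0 _)] using this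
  rw [traceE, ← ENNReal.ofReal_tsum_of_nonneg h0 hs, ENNReal.toReal_ofReal (tsum_nonneg h0)]
  exact hs.hasSum

theorem enorm_sq_eq_ofReal {V : Type*} [NormedAddCommGroup V] (x : V) :
    ‖x‖ₑ ^ 2 = ENNReal.ofReal (‖x‖ ^ 2) := by
  rw [ENNReal.ofReal_pow (norm_nonneg _), ofReal_norm]

theorem summable_norm_sq {A : H →L[ℂ] H} (hA : hsq b A ≠ ∞) :
    Summable fun j => ‖A (b j)‖ ^ 2 := by
  have := ENNReal.summable_toReal hA
  simpa only [enorm_sq_eq_ofReal, ENNReal.toReal_ofReal (sq_nonneg _)] using this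

theorem summable_inner_hsq {A B : H →L[ℂ] H} (hA : hsq b A ≠ ∞) (hB : hsq b B ≠ ∞) :
    Summable fun j => ‖⟪A (b j), B (b j)⟫_ℂ‖ := by
  refine Summable.of_nonneg_of_le (fun _ => norm_nonneg _) (fun j => ?_)
    ((summable_norm_sq hA).add (summable_norm_sq hB))
  refine (norm_inner_le_norm _ _).trans ?_
  nlinarith [sq_nonneg (‖A (b j)‖ - ‖B (b j)‖), sq_nonneg ‖A (b j)‖, sq_nonneg ‖B (b j)‖]

theorem tsum_inner_self {A : H →L[ℂ] H} (hA : hsq b A ≠ ∞) :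
    ∑' j, ⟪A (b j), A (b j)⟫_ℂ = ((hsq b A).toReal : ℂ) := by
  have h1 : hsq b A = ENNReal.ofReal (∑' j, ‖A (b j)‖ ^ 2) := by
    rw [ENNReal.ofReal_tsum_of_nonneg (fun _ => sq_nonneg _) (summable_norm_sq hA)]
    exact tsum_congr fun j => enorm_sq_eq_ofReal _
  rw [h1, ENNReal.toReal_ofReal (tsum_nonneg fun _ => sq_nonneg _), Complex.ofReal_tsum]
  refine tsum_congr fun j => ?_
  rw [inner_self_eq_norm_sq_to_K]
  norm_cast

/-- If `W` is orthogonal to the unit vector `S` in the Hilbert-Schmidt inner product, the summands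
of `tensorSum S W` are orthogonal to one another. -/
theorem hsq_tensorSum {S W : H →L[ℂ] H} (hS : hsq b S = 1) (hW : hsq b W ≠ ∞)
    (h0 : ∑' j, ⟪W (b j), S (b j)⟫_ℂ = 0) (n : ℕ) :
    hsq (tensorBasis ι n) (tensorSum b n S W) = n * hsq b W := by
  have hS' : hsq b S ≠ ∞ := by simp [hS]
  let U : Fin n → Fin n → H →L[ℂ] H := fun k => Function.update (fun _ => S) k W
  have hU : ∀ k l, hsq b (U k l) ≠ ∞ := by
    intro k l
    by_cases h : l = k
    · subst h; simpa [U] using hW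
    · simpa [U, h] using hS'
  -- The pairing is a product over the slots of Hilbert-Schmidt pairings. For `k ≠ l` slot `k` pairs
  -- `W` with `S` and gives zero; for `k = l` slot `k` gives the squared norm of `W` and all others
  -- give 1.
  have hpair : ∀ k l, HasSum (fun i : Fin n → ι => ⟪tprod b fun r => U k r (b (i r)),
      tprod b fun r => U l r (b (i r))⟫_ℂ) (if k = l then ((hsq b W).toReal : ℂ) else 0) := by
    intro k l
    have hs : ∀ r, Summable fun j => ‖⟪U k r (b j), U l r (b j)⟫_ℂ‖ := fun r =>
      summable_inner_hsq (hU k r) (hU l r)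
    have h1 := (summable_norm_prod_pi (fun r j => ⟪U k r (b j), U l r (b j)⟫_ℂ) hs).of_norm.hasSum
    rw [tsum_prod_pi _ hs] at h1
    simp only [inner_tprod]
    suffices e : ∏ r, ∑' j, ⟪U k r (b j), U l r (b j)⟫_ℂ =
        if k = l then ((hsq b W).toReal : ℂ) else 0 by rwa [e] at h1
    split_ifs with hkl
    · subst hkl
      rw [Finset.prod_eq_single k]
      · simp only [U, Function.update_self]; exact tsum_inner_self hW
      · intro r _ hr
        simp only [U, Function.update_of_ne hr]
        rw [tsum_inner_self hS', hS]; simp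
      · simp
    · rw [Finset.prod_eq_zero (Finset.mem_univ k)]
      simp only [U, Function.update_self, Function.update_of_ne hkl]
      exact h0
  have hv : ∀ i : Fin n → ι, tensorSum b n S W (tensorBasis ι n i) =
      ∑ k, tprod b fun r => U k r (b (i r)) := by
    intro i
    rw [tensorSum, sum_apply, tensorBasis_apply b]
    exact Finset.sum_congr rfl fun k _ => tensorOp_tprod b _ _
  have hsum : HasSum (fun i : Fin n → ι => ((‖tensorSum b n S W (tensorBasis ι n i)‖ ^ 2 : ℝ) : ℂ))
      ((n * (hsq b W).toReal : ℝ) : ℂ) := by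
    have := hasSum_sum fun k (_ : k ∈ Finset.univ) => hasSum_sum fun l (_ : l ∈ Finset.univ) =>
      hpair k l
    convert this using 1
    · ext1 i
      rw [hv]
      simp_rw [← inner_sum, ← sum_inner]
      rw [inner_self_eq_norm_sq_to_K]
      norm_cast
    · simp
  rw [Complex.hasSum_ofReal] at hsum
  have : hsq (tensorBasis ι n) (tensorSum b n S W) =
      ENNReal.ofReal (∑' i, ‖tensorSum b n S W (tensorBasis ι n i)‖ ^ 2) := by
    rw [ENNReal.ofReal_tsum_of_nonneg (fun _ => sq_nonneg _) hsum.summable]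
    exact tsum_congr fun j => enorm_sq_eq_ofReal _
  rw [this, hsum.tsum_eq, ENNReal.ofReal_mul (by positivity), ENNReal.ofReal_toReal hW,
    ENNReal.ofReal_natCast]

/-- The operator `W` is the adjoint of `L √σ`. The latter is defined everywhere and has a closed
graph, since pairing with the dense domain of the symmetric `L` determines its limits; hence it is
bounded. It is Hilbert-Schmidt by the finite second moment, and so is its adjoint. All later steps
use bounded operators only. -/
theorem HasSLD.exists_factor {σ D : H →L[ℂ] H} (hσ : 0 ≤ σ) (h : HasSLD b σ D) :
    ∃ W : H →L[ℂ] H, hsq b W ≠ ∞ ∧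
      D = (1 / 2 : ℝ) • (star W * CFC.sqrt σ + CFC.sqrt σ * W) := by
  obtain ⟨L, hd, hL, hs, hσ', hD, hfin⟩ := h
  let S := CFC.sqrt σ
  let Λ₀ : H →ₗ[ℂ] H :=
    { toFun := fun x => L ⟨S x, hs x⟩
      map_add' := fun x y => by
        rw [← L.map_add]; congr 1; ext; simp
      map_smul' := fun c x => by
        rw [RingHom.id_apply, ← L.map_smul]; congr 1; ext; simp }
  have hcont : Continuous Λ₀ := by
    refine LinearMap.continuous_of_seq_closed_graph Λ₀ fun u x y hu hy => ?_
    refine hd.eq_of_inner_left (𝕜 := ℂ) fun z hz => ?_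
    lift z to L.domain using hz
    have e : ∀ v, ⟪Λ₀ v, (z : H)⟫_ℂ = ⟪S v, L z⟫_ℂ := fun v => hL ⟨S v, hs v⟩ z
    have l1 : Tendsto (fun n => ⟪Λ₀ (u n), (z : H)⟫_ℂ) atTop (𝓝 ⟪y, (z : H)⟫_ℂ) :=
      hy.inner tendsto_const_nhds
    have l2 : Tendsto (fun n => ⟪Λ₀ (u n), (z : H)⟫_ℂ) atTop (𝓝 ⟪S x, L z⟫_ℂ) := by
      simp_rw [e]
      exact ((S.continuous.tendsto x).comp hu).inner tendsto_const_nhds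
    rw [e]
    exact tendsto_nhds_unique l1 l2
  let Λ : H →L[ℂ] H := ⟨Λ₀, hcont⟩
  refine ⟨star Λ, by rw [hsq_star]; exact hfin, ?_⟩
  rw [star_star]
  have hSS : ∀ x, σ x = S (S x) := fun x => by
    conv_lhs => rw [← CFC.sqrt_mul_sqrt_self σ hσ]
    rfl
  have hΛ : ∀ x, L ⟨σ x, hσ' x⟩ = Λ (S x) := fun x => by
    change _ = L ⟨S (S x), _⟩
    congr 1
    ext
    exact hSS x
  refine ContinuousLinearMap.ext fun y => ext_inner_left ℂ fun x => ?_
  rw [hD, hΛ, hΛ]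
  rw [smul_apply, ← Complex.coe_smul, inner_smul_right,
    add_apply, inner_add_right]
  have e2 : ⟪Λ (S x), y⟫_ℂ = ⟪x, (S * star Λ) y⟫_ℂ := by
    rw [mul_apply_eq_comp, ← ContinuousLinearMap.adjoint_inner_right]
    rw [ContinuousLinearMap.star_eq_adjoint]
    have : ContinuousLinearMap.adjoint S = S := star_sqrt σ
    conv_lhs => rw [← this]
    rw [ContinuousLinearMap.adjoint_inner_left]
  rw [e2]
  have e3 : (Λ * CFC.sqrt σ) y = Λ (S y) := rfl
  rw [e3]
  push_cast
  ring

/-- The factor can be chosen orthogonal to the square root of the state. -/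
theorem HasSLD.exists_orthogonal_factor {σ D P Q : H →L[ℂ] H} (hσ : IsDensity b σ)
    (h : HasSLD b σ D) (hd : IsDecomp b D P Q) (htr : traceE b P = traceE b Q) :
    ∃ W : H →L[ℂ] H, hsq b W ≠ ∞ ∧
      D = (1 / 2 : ℝ) • (star W * CFC.sqrt σ + CFC.sqrt σ * W) ∧
      ∑' j, ⟪W (b j), CFC.sqrt σ (b j)⟫_ℂ = 0 := by
  obtain ⟨W, hW, hD⟩ := h.exists_factor hσ.1
  set S := CFC.sqrt σ with hS
  have hS1 : hsq b S = 1 := by rw [← traceE_eq_hsq_sqrt b hσ.1, hσ.2]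
  have hSf : hsq b S ≠ ∞ := by simp [hS1]
  have hSs : star S = S := star_sqrt σ
  have hc := (summable_inner_hsq hW hSf).of_norm.hasSum
  set c := ∑' j, ⟪W (b j), S (b j)⟫_ℂ
  -- The real part of the pairing of `W` with `√σ` is the trace of `D`, which vanishes because `P`
  -- and `Q` have equal traces.
  have hre : c.re = 0 := by
    have h1 := Complex.hasSum_re hc
    have h2 : HasSum (fun j => (⟪b j, D (b j)⟫_ℂ).re) 0 := by
      have := (hasSum_trace hd.pos hd.fin).sub (hasSum_trace hd.pos' hd.fin')
      rw [htr, sub_self] at this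
      simpa only [hd.eq, sub_apply, inner_sub_right, Complex.sub_re] using this
    refine h1.unique (h2.congr_fun ?_)
    intro j
    rw [hD, smul_apply, ← Complex.coe_smul, inner_smul_right,
      add_apply, inner_add_right, Complex.re_ofReal_mul, Complex.add_re]
    have e1 : ⟪b j, (star W * S) (b j)⟫_ℂ = ⟪W (b j), S (b j)⟫_ℂ := by
      rw [mul_apply_eq_comp, ContinuousLinearMap.star_eq_adjoint,
        ContinuousLinearMap.adjoint_inner_right]
    have e2 : ⟪b j, (S * W) (b j)⟫_ℂ = ⟪S (b j), W (b j)⟫_ℂ := by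
      rw [mul_apply_eq_comp]
      conv_lhs => rw [← hSs]
      rw [ContinuousLinearMap.star_eq_adjoint, ContinuousLinearMap.adjoint_inner_right]
    rw [e1, e2, ← inner_conj_symm (S (b j)), Complex.conj_re]
    ring
  have hcc : starRingEnd ℂ c = -c := by
    apply Complex.ext <;> simp [hre]
  have hSS : ∑' j, ⟪S (b j), S (b j)⟫_ℂ = 1 := by rw [tsum_inner_self hSf, hS1]; simp
  -- As `c` is purely imaginary, adding `c • S` leaves `W* S + S W` unchanged, and it shifts the
  -- pairing with the unit vector `S` from `c` to `c + conj c = 0`.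
  refine ⟨W + c • S, ?_, ?_, ?_⟩
  · have hle : hsq b (W + c • S) ≤ 2 * hsq b W + 2 * (‖c‖ₑ ^ 2 * hsq b S) := by
      simp only [hsq, ← ENNReal.tsum_mul_left]
      rw [← ENNReal.tsum_add]
      refine ENNReal.tsum_le_tsum fun j => ?_
      refine (pow_le_pow_left' (enorm_add_le _ _) 2).trans ((enn_add_sq_le _ _).trans_eq ?_)
      change _ + 2 * ‖c • S (b j)‖ₑ ^ 2 = _
      rw [enorm_smul, mul_pow]
      rfl
    refine ne_top_of_le_ne_top ?_ hle
    rw [hS1]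
    finiteness
  · have : star (W + c • S) * S + S * (W + c • S) = star W * S + S * W := by
      rw [star_add, star_smul, hSs, add_mul, mul_add, smul_mul_assoc, mul_smul_comm]
      have : star c = -c := hcc
      rw [this, neg_smul]
      abel
    rw [this, hD]
  · have hsum : HasSum (fun j => ⟪(W + c • S) (b j), S (b j)⟫_ℂ) (c + -c * 1) := by
      have h2 := ((summable_inner_hsq hSf hSf).of_norm.hasSum).mul_left (-c)
      rw [hSS] at h2
      refine (hc.add h2).congr_fun fun j => ?_
      rw [add_apply, smul_apply, inner_add_left, inner_smul_left, hcc]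
    rw [hsum.tsum_eq]
    ring

/-- The information inequality at the level of operators; `J` is the Fisher information of the
model consisting of a single system. -/
theorem HasSLD.exists_fisher {σ D P Q : H →L[ℂ] H} (hσ : IsDensity b σ)
    (h : HasSLD b σ D) (hd : IsDecomp b D P Q) (htr : traceE b P = traceE b Q) :
    ∃ J : ℝ≥0, ∀ n : ℕ, ∃ F : TensorPower ι n →L[ℂ] TensorPower ι n, 0 ≤ F ∧
      traceE (tensorBasis ι n) F = n * J ∧
      ∀ t : ℝ, 0 ≤ t ^ 2 • tensorOp b (fun _ => σ) + (2 * t) • tensorSum b n σ D + F := by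
  obtain ⟨W, hW, hD, h0⟩ := h.exists_orthogonal_factor hσ hd htr
  set S := CFC.sqrt σ with hS
  have hS1 : hsq b S = 1 := by rw [← traceE_eq_hsq_sqrt b hσ.1, hσ.2]
  have hSs : star S = S := star_sqrt σ
  have hSS : S * S = σ := CFC.sqrt_mul_sqrt_self σ hσ.1
  lift hsq b W to ℝ≥0 using hW with J hJ
  refine ⟨J, fun n => ?_⟩
  set Wn := tensorSum b n S W with hWn
  set R := tensorOp b (fun _ : Fin n => S) with hR
  have hRs : star R = R := by rw [hR, star_tensorOp]; simp only [hSs]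
  have hRR : R * R = tensorOp b fun _ => σ := by rw [hR, tensorOp_mul]; simp only [hSS]
  have hupd : ∀ (A B : H →L[ℂ] H) (k : Fin n), (fun l => Function.update (fun _ => S) k A l *
      Function.update (fun _ => S) k B l) = Function.update (fun _ => σ) k (A * B) := by
    intro A B k
    ext1 l
    by_cases hl : l = k
    · subst hl; simp
    · simp [hl, hSS]
  have h1 : Wn = tensorSum b n S W := rfl
  have hWs : star Wn = tensorSum b n S (star W) := by
    rw [h1, tensorSum, tensorSum, star_sum]
    refine Finset.sum_congr rfl fun k _ => ?_
    rw [star_tensorOp]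
    congr 1
    ext1 l
    by_cases hl : l = k
    · subst hl; simp
    · simp [hl, hSs]
  have hRc : ∀ k : Fin n, R = tensorOp b (Function.update (fun _ => S) k S) := fun k => by
    rw [hR]; congr 1; ext1 l; by_cases hl : l = k
    · subst hl; simp
    · simp [hl]
  have e1 : star Wn * R = tensorSum b n σ (star W * S) := by
    rw [hWs, tensorSum, Finset.sum_mul, tensorSum]
    refine Finset.sum_congr rfl fun k _ => ?_
    rw [hRc k, tensorOp_mul, hupd]
  have e2 : R * Wn = tensorSum b n σ (S * W) := by
    rw [h1, tensorSum, Finset.mul_sum, tensorSum]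
    refine Finset.sum_congr rfl fun k _ => ?_
    rw [hRc k, tensorOp_mul, hupd]
  have e3 : (2 : ℝ) • tensorSum b n σ D = star Wn * R + R * Wn := by
    rw [e1, e2, ← tensorSum_add, hD, tensorSum, Finset.smul_sum, tensorSum]
    refine Finset.sum_congr rfl fun k _ => ?_
    rw [tensorOp_update_smul, smul_smul]
    norm_num
  -- With `R` the tensor power of `√σ`, the quadratic polynomial in `t` is the square `(t R + Wn)*
  -- (t R + Wn)`. The trace of `Wn* Wn` is `n` times that for a single system by orthogonality of
  -- the slots.
  refine ⟨star Wn * Wn, star_mul_self_nonneg _, ?_, fun t => ?_⟩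
  · rw [traceE_star_mul, h1, hsq_tensorSum hS1 (by rw [← hJ]; simp) h0, hJ]
  · have hts : star (t • R) = t • R := by
      have e : t • R = (t : ℂ) • R := ContinuousLinearMap.ext fun x => (Complex.coe_smul t (R x)).symm
      rw [e, star_smul, hRs, Complex.star_def, Complex.conj_ofReal]
    have : t ^ 2 • tensorOp b (fun _ => σ) + (2 * t) • tensorSum b n σ D + star Wn * Wn =
        star (t • R + Wn) * (t • R + Wn) := by
      rw [mul_comm, mul_smul, e3, ← hRR, star_add, hts, add_mul, mul_add,
        mul_add, smul_mul_smul_comm, smul_mul_assoc, mul_smul_comm, smul_add, sq]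
      abel
    rw [this]
    exact star_mul_self_nonneg _

end Fisher

/-! ### Derivatives of expectations of estimates -/

section Differentiation

variable {ι H : Type*} [NormedAddCommGroup H] [InnerProductSpace ℂ H] [CompleteSpace H]
  {b : HilbertBasis ι ℂ H} {m : ℕ}

/-- The expectation of `v` of the estimate as a bounded linear functional. -/
def Estimator.expect {n : ℕ} (E : Estimator ι n m) {v : EuclideanSpace ℝ (Fin m) → ℝ}
    (hv : Measurable v) {C : ℝ} (hC : ∀ x, |v x| ≤ C) : TC (tensorBasis ι n) →L[ℝ] ℝ :=
  TC.expectCLM E.M (hv.comp E.measurable_T) fun ω => hC (E.T ω)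

theorem Estimator.expect_eq {n : ℕ} (E : Estimator ι n m) {v : EuclideanSpace ℝ (Fin m) → ℝ}
    (hv : Measurable v) {C : ℝ} (hC : ∀ x, |v x| ≤ C) {τ : TC (tensorBasis ι n)}
    {P Q : TensorPower ι n →L[ℂ] TensorPower ι n} (h : IsDecomp (tensorBasis ι n) τ.val P Q) :
    E.expect hv hC τ = ∫ x, v x ∂(E.distOp P) - ∫ x, v x ∂(E.distOp Q) := by
  rw [E.integral_distOp _ v hv, E.integral_distOp _ v hv]
  exact TC.expect_eq E.M (hv.comp E.measurable_T) (fun ω => hC (E.T ω)) h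

theorem Estimator.abs_expect_le {n : ℕ} (E : Estimator ι n m)
    {v : EuclideanSpace ℝ (Fin m) → ℝ}
    (hv : Measurable v) {C : ℝ} (hC : ∀ x, |v x| ≤ C) (τ : TC (tensorBasis ι n)) :
    |E.expect hv hC τ| ≤ C * ‖τ‖ :=
  TC.abs_expect_le E.M (hv.comp E.measurable_T) (fun ω => hC (E.T ω)) τ

theorem Estimator.expect_of_nonneg {n : ℕ} (E : Estimator ι n m)
    {v : EuclideanSpace ℝ (Fin m) → ℝ}
    (hv : Measurable v) {C : ℝ} (hC : ∀ x, |v x| ≤ C) {τ : TC (tensorBasis ι n)}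
    (h : 0 ≤ τ.val) : E.expect hv hC τ = ∫ x, v x ∂(E.distOp τ.val) := by
  obtain ⟨P, Q, hd⟩ := τ.exists_decomp
  have hP : τ.val ≤ P := by rw [hd.eq]; exact sub_le_self _ hd.pos'
  rw [E.integral_distOp _ v hv]
  exact TC.expect_of_nonneg E.M (hv.comp E.measurable_T) (fun ω => hC (E.T ω)) h
    (ne_top_of_le_ne_top hd.fin (traceE_mono _ h hP))

theorem isDecomp_tensorSum (n : ℕ) {σ D P Q : H →L[ℂ] H} (hσ : IsDensity b σ)
    (h : IsDecomp b D P Q) : IsDecomp (tensorBasis ι n) (tensorSum b n σ D)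
      (tensorSum b n σ P) (tensorSum b n σ Q) where
  pos := tensorSum_nonneg b hσ.1 h.pos
  pos' := tensorSum_nonneg b hσ.1 h.pos'
  fin := by rw [traceE_tensorSum b hσ h.pos]; exact ENNReal.mul_ne_top (by simp) h.fin
  fin' := by rw [traceE_tensorSum b hσ h.pos']; exact ENNReal.mul_ne_top (by simp) h.fin'
  eq := by
    rw [eq_sub_iff_add_eq, ← tensorSum_add, h.eq, sub_add_cancel]

theorem Estimator.isFiniteMeasure_distOp {n : ℕ} (E : Estimator ι n m)
    {τ : TensorPower ι n →L[ℂ] TensorPower ι n} (hτ : 0 ≤ τ)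
    (h : traceE (tensorBasis ι n) τ ≠ ∞) : IsFiniteMeasure (E.distOp τ) :=
  ⟨by rw [E.distOp_univ hτ]; exact h.lt_top⟩

variable {ρ : EuclideanSpace ℝ (Fin m) → H →L[ℂ] H}

/-- The positive part of the `i`-th derivative of the distribution of the estimate. -/
abbrev Estimator.dPos (b : HilbertBasis ι ℂ H) (ρ : EuclideanSpace ℝ (Fin m) → H →L[ℂ] H) {n : ℕ}
    (E : Estimator ι n m) (θ : EuclideanSpace ℝ (Fin m)) (i : Fin m) :
    Measure (EuclideanSpace ℝ (Fin m)) :=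
  E.distOp (tensorSum b n (ρ θ) (traceDeriv b ρ i θ)⁺)

/-- The negative part of the `i`-th derivative of the distribution of the estimate. -/
abbrev Estimator.dNeg (b : HilbertBasis ι ℂ H) (ρ : EuclideanSpace ℝ (Fin m) → H →L[ℂ] H) {n : ℕ}
    (E : Estimator ι n m) (θ : EuclideanSpace ℝ (Fin m)) (i : Fin m) :
    Measure (EuclideanSpace ℝ (Fin m)) :=
  E.distOp (tensorSum b n (ρ θ) (traceDeriv b ρ i θ)⁻)

/-- The derivative of the expectation of `φ` of the estimate. -/
def Estimator.dInt (b : HilbertBasis ι ℂ H) (ρ : EuclideanSpace ℝ (Fin m) → H →L[ℂ] H) {n : ℕ}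
    (E : Estimator ι n m) (θ : EuclideanSpace ℝ (Fin m)) (i : Fin m)
    (φ : EuclideanSpace ℝ (Fin m) → ℝ) : ℝ :=
  ∫ x, φ x ∂(E.dPos b ρ θ i) - ∫ x, φ x ∂(E.dNeg b ρ θ i)

/-- The estimator has locally bounded second moments, and the derivatives of its distribution have
first moments. -/
structure Estimator.Tame (b : HilbertBasis ι ℂ H) (ρ : EuclideanSpace ℝ (Fin m) → H →L[ℂ] H)
    {n : ℕ} (E : Estimator ι n m) (θ : EuclideanSpace ℝ (Fin m)) : Prop where
  bound : ∃ C : ℝ≥0, ∀ᶠ x in 𝓝 θ, ∫⁻ y, ‖y‖ₑ ^ 2 ∂(E.dist b (ρ x)) ≤ C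
  pos : ∀ i, ∫⁻ y, ‖y‖ₑ ∂(E.dPos b ρ θ i) ≠ ∞
  neg : ∀ i, ∫⁻ y, ‖y‖ₑ ∂(E.dNeg b ρ θ i) ≠ ∞

variable {Θ : Set (EuclideanSpace ℝ (Fin m))} (hΘ : IsOpen Θ)
  (hρ : ∀ θ ∈ Θ, IsDensity b (ρ θ)) (h1 : CondM1 b ρ Θ)
  {θ : EuclideanSpace ℝ (Fin m)} (hθ : θ ∈ Θ)
include hΘ hρ h1 hθ

theorem isFiniteMeasure_dPos {n : ℕ} (E : Estimator ι n m) (i : Fin m) :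
    IsFiniteMeasure (E.dPos b ρ θ i) :=
  E.isFiniteMeasure_distOp (isDecomp_tensorSum n (hρ θ hθ) (traceDeriv_decomp hΘ hρ h1 hθ i)).pos
    (isDecomp_tensorSum n (hρ θ hθ) (traceDeriv_decomp hΘ hρ h1 hθ i)).fin

theorem isFiniteMeasure_dNeg {n : ℕ} (E : Estimator ι n m) (i : Fin m) :
    IsFiniteMeasure (E.dNeg b ρ θ i) :=
  E.isFiniteMeasure_distOp (isDecomp_tensorSum n (hρ θ hθ) (traceDeriv_decomp hΘ hρ h1 hθ i)).pos'
    (isDecomp_tensorSum n (hρ θ hθ) (traceDeriv_decomp hΘ hρ h1 hθ i)).fin'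

theorem Estimator.Tame.of_bounded {n : ℕ} {E : Estimator ι n m} {K : ℝ≥0}
    (hE : ∀ ω, ‖E.T ω‖ ≤ K) : E.Tame b ρ θ where
  bound := by
    refine ⟨K ^ 2, (hΘ.eventually_mem hθ).mono fun x hx => ?_⟩
    have := E.isProbabilityMeasure_dist b (hρ x hx)
    calc _ ≤ ∫⁻ _, (K : ℝ≥0∞) ^ 2 ∂(E.dist b (ρ x)) :=
          lintegral_mono_ae ((E.ae_distOp_of_forall hE _).mono fun y hy => pow_le_pow_left' hy 2)
      _ = _ := by simp
  pos i := by
    have := isFiniteMeasure_dPos hΘ hρ h1 hθ E i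
    refine ne_top_of_le_ne_top (b := ∫⁻ _, (K : ℝ≥0∞) ∂(E.dPos b ρ θ i)) ?_
      (lintegral_mono_ae (E.ae_distOp_of_forall hE _))
    rw [lintegral_const]
    exact ENNReal.mul_ne_top (by simp) (measure_ne_top _ _)
  neg i := by
    have := isFiniteMeasure_dNeg hΘ hρ h1 hθ E i
    refine ne_top_of_le_ne_top (b := ∫⁻ _, (K : ℝ≥0∞) ∂(E.dNeg b ρ θ i)) ?_
      (lintegral_mono_ae (E.ae_distOp_of_forall hE _))
    rw [lintegral_const]
    exact ENNReal.mul_ne_top (by simp) (measure_ne_top _ _)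

/-- The positive and negative parts of the derivative of the state are both dominated by `◇`, so
their laws inherit its first moments. The bound on second moments in (E) is uniform in the
parameter, hence locally uniform after recentring. -/
theorem Estimator.Tame.of_condE {n : ℕ} {E : Estimator ι n m} (hE : CondE b ρ Θ E) :
    E.Tame b ρ θ := by
  obtain ⟨a₁, a₂, Dia, ha₂, hD, a₄, h⟩ := (condE_iff b ρ Θ E).1 hE
  have hfst : ∀ (i : Fin m) {P : H →L[ℂ] H}, 0 ≤ P → P ≤ Dia i θ → traceE b P ≠ ∞ →
      ∫⁻ y, ‖y‖ₑ ∂(E.distOp (tensorSum b n (ρ θ) P)) ≠ ∞ := by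
    intro i P hP hPD hPf
    have hfin : IsFiniteMeasure (E.distOp (tensorSum b n (ρ θ) P)) :=
      E.isFiniteMeasure_distOp (tensorSum_nonneg b (hρ θ hθ).1 hP) (by
        rw [traceE_tensorSum b (hρ θ hθ) hP]; exact ENNReal.mul_ne_top (by simp) hPf)
    have hle : E.distOp (tensorSum b n (ρ θ) P) ≤ E.distOp (tensorSum b n (ρ θ) (Dia i θ)) := by
      have e : tensorSum b n (ρ θ) (Dia i θ) = tensorSum b n (ρ θ) P +
          tensorSum b n (ρ θ) (Dia i θ - P) := by rw [← tensorSum_add]; congr 1; abel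
      rw [e, E.distOp_add (tensorSum_nonneg b (hρ θ hθ).1 hP)
        (tensorSum_nonneg b (hρ θ hθ).1 (sub_nonneg.2 hPD))]
      exact Measure.le_add_right le_rfl
    refine LT.lt.ne ?_
    calc ∫⁻ y, ‖y‖ₑ ∂(E.distOp (tensorSum b n (ρ θ) P))
        ≤ ∫⁻ y, (‖y - θ‖ₑ + ‖θ‖ₑ) ∂(E.distOp (tensorSum b n (ρ θ) P)) := by
          refine lintegral_mono fun y => ?_
          calc ‖y‖ₑ = ‖(y - θ) + θ‖ₑ := by rw [sub_add_cancel]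
            _ ≤ _ := enorm_add_le _ _
      _ = ∫⁻ y, ‖y - θ‖ₑ ∂(E.distOp (tensorSum b n (ρ θ) P)) +
          ‖θ‖ₑ * E.distOp (tensorSum b n (ρ θ) P) Set.univ := by
          rw [lintegral_add_right _ measurable_const, lintegral_const]
      _ ≤ n * a₁ * a₄ + ‖θ‖ₑ * E.distOp (tensorSum b n (ρ θ) P) Set.univ := by
          gcongr
          exact (lintegral_mono' hle le_rfl).trans ((h θ hθ).1 i)
      _ < ∞ := by
          have := measure_lt_top (E.distOp (tensorSum b n (ρ θ) P)) Set.univ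
          finiteness
  have hd := traceDeriv_decomp hΘ hρ h1 hθ
  have habs : ∀ i, (traceDeriv b ρ i θ)⁺ + (traceDeriv b ρ i θ)⁻ ≤ Dia i θ := fun i => by
    rw [CFC.posPart_add_negPart _ (hd i).isSelfAdjoint]
    exact (hD.nonneg ha₂ hθ i).1
  refine ⟨?_, fun i => hfst i (hd i).pos
    ((le_add_of_nonneg_right (hd i).pos').trans (habs i)) (hd i).fin, fun i => hfst i (hd i).pos'
    ((le_add_of_nonneg_left (hd i).pos).trans (habs i)) (hd i).fin'⟩
  refine ⟨2 * (n * a₄ ^ 2) + 2 * (‖θ‖₊ + 1) ^ 2, ?_⟩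
  filter_upwards [hΘ.eventually_mem hθ, Metric.ball_mem_nhds θ one_pos] with x hx hx1
  have := E.isProbabilityMeasure_dist b (hρ x hx)
  have hxn : ‖x‖ₑ ≤ (‖θ‖₊ + 1 : ℝ≥0) := by
    rw [enorm_eq_nnnorm]
    norm_cast
    change ‖x‖ ≤ ‖θ‖ + 1
    have h1 := norm_add_le (x - θ) θ
    rw [sub_add_cancel] at h1
    rw [mem_ball_iff_norm] at hx1
    linarith
  calc ∫⁻ y, ‖y‖ₑ ^ 2 ∂(E.dist b (ρ x))
      ≤ ∫⁻ y, (2 * ‖y - x‖ₑ ^ 2 + 2 * ‖x‖ₑ ^ 2) ∂(E.dist b (ρ x)) := by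
        refine lintegral_mono fun y => le_trans (pow_le_pow_left' ?_ 2) (enn_add_sq_le _ _)
        calc ‖y‖ₑ = ‖(y - x) + x‖ₑ := by rw [sub_add_cancel]
          _ ≤ _ := enorm_add_le _ _
    _ = 2 * ∫⁻ y, ‖y - x‖ₑ ^ 2 ∂(E.dist b (ρ x)) + 2 * ‖x‖ₑ ^ 2 := by
        rw [lintegral_add_right _ measurable_const, lintegral_const_mul _ (by fun_prop)]
        simp
    _ ≤ 2 * (n * a₄ ^ 2) + 2 * (‖θ‖₊ + 1 : ℝ≥0) ^ 2 := by
        gcongr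
        exact (h x hx).2
    _ = _ := by push_cast; ring

/-- The trace of the derivative of a family of states vanishes. -/
theorem traceE_traceDeriv (i : Fin m) :
    traceE b (traceDeriv b ρ i θ)⁺ = traceE b (traceDeriv b ρ i θ)⁻ := by
  have hd := traceDeriv_decomp hΘ hρ h1 hθ i
  have hC : ∀ x : Unit, |(fun _ => (1 : ℝ)) x| ≤ 1 := by simp
  -- The trace is the expectation of 1 in the measurement with one outcome, hence a bounded
  -- functional; it is constant along the model, so its derivative is zero.
  let Ψ := TC.expectCLM (b := b) (POVM.trivial H) measurable_const hC
  have hs := Ψ.hasFDerivAt.comp_hasDerivAt (0 : ℝ)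
    (hasDerivAt_state hΘ hρ h1 i (θ := θ) (s := 0) (by rwa [shift_zero]))
  have hint : ∀ {P : H →L[ℂ] H}, 0 ≤ P →
      ∫ _, (1 : ℝ) ∂((POVM.trivial H).law b P) = (traceE b P).toReal := fun hP => by
    rw [integral_const, smul_eq_mul, mul_one, Measure.real, POVM.law_univ _ _ hP]
  have hc : (Ψ ∘ fun t => TC.ofOp b (ρ (shift θ i t))) =ᶠ[𝓝 0] fun _ => 1 := by
    filter_upwards [eventually_shift_mem hΘ hθ i] with t ht
    change TC.expect _ _ _ = 1
    have hv := val_state hρ ht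
    rw [TC.expect_of_nonneg _ measurable_const hC (by rw [hv]; exact (hρ _ ht).1)
      (by rw [hv, (hρ _ ht).2]; simp), hv, hint (hρ _ ht).1, (hρ _ ht).2]
    simp
  have h0 := (hs.congr_of_eventuallyEq hc.symm).unique (hasDerivAt_const _ _)
  change TC.expect _ _ _ = 0 at h0
  simp only [shift_zero] at h0
  rw [TC.expect_eq _ measurable_const hC
    (show IsDecomp b (TC.ofOp b (traceDeriv b ρ i θ)).val _ _ by
      rw [val_traceDeriv hΘ hρ h1 hθ]; exact hd), hint hd.pos, hint hd.pos', sub_eq_zero] at h0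
  exact (ENNReal.toReal_eq_toReal_iff' hd.fin hd.fin').1 h0

omit h1 in
theorem integrable_of_growth {n : ℕ} {τ : TensorPower ι n →L[ℂ] TensorPower ι n}
    {E : Estimator ι n m} (hfin : IsFiniteMeasure (E.distOp τ))
    (h : ∫⁻ y, ‖y‖ₑ ∂(E.distOp τ) ≠ ∞) {φ : EuclideanSpace ℝ (Fin m) → ℝ} (hφ : Measurable φ)
    {a c : ℝ} (hb : ∀ x, |φ x| ≤ a + c * ‖x‖) : Integrable φ (E.distOp τ) := by
  have hi : Integrable (fun x : EuclideanSpace ℝ (Fin m) => x) (E.distOp τ) :=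
    ⟨by fun_prop, h.lt_top⟩
  exact ((integrable_const a).add (hi.norm.const_mul c)).mono' hφ.aestronglyMeasurable
    (.of_forall hb)

/-- Functions of linear growth have locally bounded second moments and are integrable against the
derivative measures, so the truncation argument applies. The expansion in total variation comes from
that of the tensor power, as measuring does not increase the norm of `TC`. -/
theorem Estimator.Tame.hasDerivAt {n : ℕ} {E : Estimator ι n m} (hE : E.Tame b ρ θ)
    {φ : EuclideanSpace ℝ (Fin m) → ℝ} (hφ : Measurable φ) {a c : ℝ}
    (hb : ∀ x, |φ x| ≤ a + c * ‖x‖) (i : Fin m) :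
    HasDerivAt (fun t => ∫ x, φ x ∂(E.dist b (ρ (shift θ i t)))) (E.dInt b ρ θ i φ) 0 := by
  obtain ⟨C, hC⟩ := hE.bound
  obtain ⟨τ₂, hτ⟩ := exists_tensor_expansion hΘ hρ h1 n hθ i
  obtain ⟨P₂, Q₂, h₂⟩ := τ₂.exists_decomp
  have := isFiniteMeasure_dPos hΘ hρ h1 hθ E i
  have := isFiniteMeasure_dNeg hΘ hρ h1 hθ E i
  have := E.isFiniteMeasure_distOp h₂.pos h₂.fin
  have := E.isFiniteMeasure_distOp h₂.pos' h₂.fin'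
  have hst : ∀ {x}, x ∈ Θ → ∀ {v : EuclideanSpace ℝ (Fin m) → ℝ} (hv : Measurable v)
      (hv1 : ∀ y, |v y| ≤ 1), E.expect hv hv1 (TC.tensor b n fun _ => TC.ofOp b (ρ x)) =
        ∫ y, v y ∂(E.dist b (ρ x)) := fun {x} hx v hv hv1 => by
    have e : (TC.tensor b n fun _ => TC.ofOp b (ρ x)).val = tensorOp b fun _ => ρ x := by
      rw [TC.val_tensor, val_state hρ hx]
    rw [E.expect_of_nonneg hv hv1 (by rw [e]; exact tensorOp_nonneg b fun _ => (hρ x hx).1), e]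
  have hmem := eventually_shift_mem hΘ hθ i
  refine hasDerivAt_integral_of_expansion (p := fun t => E.dist b (ρ (shift θ i t)))
    (p₂ := E.distOp P₂) (p₂' := E.distOp Q₂)
    (hmem.mono fun t ht => E.isProbabilityMeasure_dist b (hρ _ ht)) ?_ hφ
    (C := 2 * ‖a‖₊ ^ 2 + 2 * (‖c‖₊ ^ 2 * C)) ?_
    (integrable_of_growth hΘ hρ hθ inferInstance (hE.pos i) hφ hb)
    (integrable_of_growth hΘ hρ hθ inferInstance (hE.neg i) hφ hb)
  · intro ε hε
    filter_upwards [hτ ε hε, hmem] with s hs hsΘ v hv hv1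
    have hle := (E.abs_expect_le hv hv1 _).trans ((one_mul _).trans_le hs)
    simp only [map_sub, map_smul, smul_eq_mul] at hle
    rw [hst hsΘ hv hv1, hst hθ hv hv1, E.expect_eq hv hv1 h₂] at hle
    rw [E.expect_eq hv hv1 (show IsDecomp _ (TC.tensorDeriv n (TC.ofOp b (ρ θ))
      (TC.ofOp b (traceDeriv b ρ i θ))).val _ _ by
        rw [TC.val_tensorDeriv, val_state hρ hθ, val_traceDeriv hΘ hρ h1 hθ]
        exact isDecomp_tensorSum n (hρ θ hθ) (traceDeriv_decomp hΘ hρ h1 hθ i))] at hle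
    simpa only [shift_zero] using hle
  · have hcont : Tendsto (shift θ i) (𝓝 0) (𝓝 θ) := by
      have := (continuous_shift θ i).tendsto 0
      rwa [shift_zero] at this
    filter_upwards [hcont.eventually hC, hmem] with s hs hsΘ
    have := E.isProbabilityMeasure_dist b (hρ _ hsΘ)
    calc ∫⁻ y, ‖φ y‖ₑ ^ 2 ∂(E.dist b (ρ (shift θ i s)))
        ≤ ∫⁻ y, (2 * ‖a‖ₑ ^ 2 + 2 * (‖c‖ₑ ^ 2 * ‖y‖ₑ ^ 2)) ∂(E.dist b (ρ (shift θ i s))) := by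
          refine lintegral_mono fun y => le_trans (pow_le_pow_left' (b := ‖a‖ₑ + ‖c‖ₑ * ‖y‖ₑ) ?_ 2)
            ((enn_add_sq_le _ _).trans_eq (by rw [mul_pow]))
          have : ‖φ y‖ ≤ ‖a‖ + ‖c‖ * ‖y‖ := (hb y).trans (by
            gcongr <;> exact le_abs_self _)
          rw [enorm_eq_nnnorm, enorm_eq_nnnorm, enorm_eq_nnnorm, enorm_eq_nnnorm]
          exact_mod_cast this
      _ = 2 * ‖a‖ₑ ^ 2 + 2 * (‖c‖ₑ ^ 2 * ∫⁻ y, ‖y‖ₑ ^ 2 ∂(E.dist b (ρ (shift θ i s)))) := by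
          rw [lintegral_add_left measurable_const, lintegral_const, measure_univ, mul_one,
            lintegral_const_mul 2 (by fun_prop),
            lintegral_const_mul (‖c‖ₑ ^ 2) (by fun_prop)]
      _ ≤ 2 * ‖a‖ₑ ^ 2 + 2 * (‖c‖ₑ ^ 2 * C) := by gcongr
      _ = _ := by simp [enorm_eq_nnnorm]

/-- The information inequality: the derivative of an expectation is controlled by the second moment
and the Fisher information, which is additive. -/
theorem exists_fisher_bound (h2 : CondM2 b ρ Θ) (i : Fin m) : ∃ J : ℝ≥0, ∀ (n : ℕ)
    (E : Estimator ι n m) (φ : EuclideanSpace ℝ (Fin m) → ℝ), Measurable φ →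
    MemLp φ 2 (E.dist b (ρ θ)) → Integrable φ (E.dPos b ρ θ i) → Integrable φ (E.dNeg b ρ θ i) →
    E.dInt b ρ θ i φ ^ 2 ≤ n * J * ∫ x, φ x ^ 2 ∂(E.dist b (ρ θ)) := by
  have hd := traceDeriv_decomp hΘ hρ h1 hθ i
  obtain ⟨J, hJ⟩ := (h2 θ hθ i).exists_fisher (hρ θ hθ) hd (traceE_traceDeriv hΘ hρ h1 hθ i)
  refine ⟨J, fun n E φ hφ hL hp hn => ?_⟩
  obtain ⟨F, hF, hFt, hpos⟩ := hJ n
  have hFf : traceE (tensorBasis ι n) F ≠ ∞ := by rw [hFt]; finiteness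
  have := E.isProbabilityMeasure_dist b (hρ θ hθ)
  have := isFiniteMeasure_dPos hΘ hρ h1 hθ E i
  have := isFiniteMeasure_dNeg hΘ hρ h1 hθ E i
  have := E.isFiniteMeasure_distOp hF hFf
  have huniv : (E.distOp F).real Set.univ = n * J := by
    rw [Measure.real, E.distOp_univ hF, hFt]; simp
  rw [← huniv]
  refine sq_integral_sub_le (fun A hA => ?_) hφ hL hp hn
  -- Testing with the indicator of `A` turns the operator inequality into one between the masses
  -- that the measures give to `A`.
  let v : EuclideanSpace ℝ (Fin m) → ℝ := A.indicator 1
  have hv : Measurable v := measurable_one.indicator hA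
  have hv1 : ∀ x, |v x| ≤ 1 := fun x => by
    by_cases hx : x ∈ A <;> simp [v, hx]
  have hvi : ∀ μ : Measure (EuclideanSpace ℝ (Fin m)), ∫ x, v x ∂μ = μ.real A := fun μ =>
    integral_indicator_one hA
  have hP0 : 0 ≤ tensorOp b fun _ : Fin n => ρ θ := tensorOp_nonneg b fun _ => (hρ θ hθ).1
  have dP := IsDecomp.of_nonneg (b := tensorBasis ι n) hP0
    (by rw [traceE_tensorOp_density b (hρ θ hθ)]; simp)
  have dD := isDecomp_tensorSum n (hρ θ hθ) hd
  have dF := IsDecomp.of_nonneg hF hFf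
  have eP := E.expect_eq hv hv1 (τ := TC.ofOp _ (tensorOp b fun _ : Fin n => ρ θ))
    (by rw [TC.val_ofOp dP]; exact dP)
  have eD := E.expect_eq hv hv1 (τ := TC.ofOp _ (tensorSum b n (ρ θ) (traceDeriv b ρ i θ)))
    (by rw [TC.val_ofOp dD]; exact dD)
  have eF := E.expect_eq hv hv1 (τ := TC.ofOp _ F) (by rw [TC.val_ofOp dF]; exact dF)
  have h0 : E.distOp (0 : TensorPower ι n →L[ℂ] TensorPower ι n) = 0 := by
    rw [Estimator.distOp, POVM.law_zero, Measure.map_zero]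
  simp only [hvi, h0, measureReal_zero, Pi.zero_apply, sub_zero] at eP eD eF
  -- The positive operator polynomial gives `A` nonnegative mass for every real `t`. The resulting
  -- quadratic polynomial has nonpositive discriminant, and this is the setwise Cauchy-Schwarz
  -- inequality.
  have hdisc := discrim_le_zero (a := (E.dist b (ρ θ)).real A)
    (b := 2 * ((E.dPos b ρ θ i).real A - (E.dNeg b ρ θ i).real A)) (c := (E.distOp F).real A) (by
      intro t
      have hval : (t ^ 2 • TC.ofOp (tensorBasis ι n) (tensorOp b fun _ : Fin n => ρ θ) + (2 * t) •
          TC.ofOp _ (tensorSum b n (ρ θ) (traceDeriv b ρ i θ)) + TC.ofOp _ F).val =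
          t ^ 2 • tensorOp b (fun _ => ρ θ) + (2 * t) • tensorSum b n (ρ θ) (traceDeriv b ρ i θ) +
            F := by
        rw [map_add, map_add, map_smul, map_smul, TC.val_ofOp dP, TC.val_ofOp dD, TC.val_ofOp dF]
      have hge := E.expect_of_nonneg hv hv1 (τ := t ^ 2 • TC.ofOp (tensorBasis ι n)
        (tensorOp b fun _ : Fin n => ρ θ) + (2 * t) •
          TC.ofOp _ (tensorSum b n (ρ θ) (traceDeriv b ρ i θ)) + TC.ofOp _ F)
        (by rw [hval]; exact hpos t)
      rw [hvi, map_add, map_add, map_smul, map_smul, eP, eD, eF] at hge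
      have : 0 ≤ t ^ 2 • (E.dist b (ρ θ)).real A + (2 * t) •
          ((E.dPos b ρ θ i).real A - (E.dNeg b ρ θ i).real A) + (E.distOp F).real A := by
        rw [hge]; exact measureReal_nonneg
      simp only [smul_eq_mul] at this
      linarith)
  rw [discrim] at hdisc
  linarith

end Differentiation

/-! ### Taylor estimates for the model and for means of bounded estimators -/

section Taylor

variable {m : ℕ} {V : Type*} [NormedAddCommGroup V] [NormedSpace ℝ V]

theorem shift_apply (θ : EuclideanSpace ℝ (Fin m)) (i j : Fin m) (t : ℝ) :
    shift θ i t j = θ j + if j = i then t else 0 := by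
  simp [shift]

theorem shift_shift (θ : EuclideanSpace ℝ (Fin m)) (i : Fin m) (s t : ℝ) :
    shift (shift θ i s) i t = shift θ i (s + t) := by
  simp [shift, add_smul, add_assoc]

theorem norm_le_of_coord {x y : EuclideanSpace ℝ (Fin m)} (h : ∀ i, |x i| ≤ |y i|) :
    ‖x‖ ≤ ‖y‖ := by
  rw [EuclideanSpace.norm_eq, EuclideanSpace.norm_eq]
  refine Real.sqrt_le_sqrt (Finset.sum_le_sum fun i _ => ?_)
  exact pow_le_pow_left₀ (norm_nonneg _) (h i) 2

/-- Mean value inequality for a function with bounded partial derivatives. -/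
theorem norm_sub_le_of_partial {F : EuclideanSpace ℝ (Fin m) → V}
    {F' : Fin m → EuclideanSpace ℝ (Fin m) → V} {θ x : EuclideanSpace ℝ (Fin m)} {C : ℝ}
    (hF : ∀ y, ‖y - θ‖ ≤ ‖x - θ‖ → ∀ i, HasDerivAt (fun t => F (shift y i t)) (F' i y) 0)
    (hC : ∀ y, ‖y - θ‖ ≤ ‖x - θ‖ → ∀ i, ‖F' i y‖ ≤ C) :
    ‖F x - F θ‖ ≤ m * C * ‖x - θ‖ := by
  classical
  -- The points `p s` form a staircase from `θ` to `x` that changes one coordinate at a time. Every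
  -- coordinate of `y - θ` stays bounded by that of `x - θ`, so the path remains in the ball where
  -- the hypotheses hold.
  let p : Finset (Fin m) → EuclideanSpace ℝ (Fin m) := fun s =>
    WithLp.toLp 2 fun i => if i ∈ s then x i else θ i
  have hstep : ∀ (s : Finset (Fin m)) (i : Fin m), i ∉ s →
      ‖F (p (insert i s)) - F (p s)‖ ≤ C * ‖x - θ‖ := by
    intro s i hi
    have hpi : p (insert i s) = shift (p s) i (x i - θ i) := by
      ext j
      rw [shift_apply]
      by_cases hj : j = i
      · subst hj; simp [p, hi]
      · simp [p, hj]
    have hin : ∀ t ∈ Set.uIcc 0 (x i - θ i), ‖shift (p s) i t - θ‖ ≤ ‖x - θ‖ := by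
      intro t ht
      refine norm_le_of_coord fun j => ?_
      rw [PiLp.sub_apply, PiLp.sub_apply, shift_apply]
      by_cases hj : j = i
      · subst hj
        simp only [p, hi, if_false, if_true, add_sub_cancel_left]
        have := Set.abs_sub_left_of_mem_uIcc ht
        simpa using this
      · by_cases hjs : j ∈ s <;> simp [p, hj, hjs]
    have hd : ∀ t ∈ Set.uIcc 0 (x i - θ i), HasDerivWithinAt (fun t => F (shift (p s) i t))
        (F' i (shift (p s) i t)) (Set.uIcc 0 (x i - θ i)) t := by
      intro t ht
      have h := hF _ (hin t ht) i
      simp only [shift_shift] at h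
      have h' := HasDerivAt.comp_sub_const t t (f := fun u => F (shift (p s) i (t + u)))
        (by simpa using h)
      simpa using h'.hasDerivWithinAt
    have := (convex_uIcc 0 (x i - θ i)).norm_image_sub_le_of_norm_hasDerivWithin_le hd
      (fun t ht => hC _ (hin t ht) i) Set.left_mem_uIcc Set.right_mem_uIcc
    rw [shift_zero, ← hpi, sub_zero] at this
    have hC0 : 0 ≤ C := (norm_nonneg _).trans (hC θ (by simp) i)
    refine this.trans (mul_le_mul_of_nonneg_left ?_ hC0)
    have := coord_abs_le (x - θ) i
    rwa [PiLp.sub_apply] at this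
  have hall : ∀ s : Finset (Fin m), ‖F (p s) - F θ‖ ≤ s.card * (C * ‖x - θ‖) := by
    intro s
    induction s using Finset.induction_on with
    | empty =>
      have : p ∅ = θ := by ext j; simp [p]
      simp [this]
    | insert i s hi ih =>
      rw [Finset.card_insert_of_notMem hi]
      calc _ ≤ ‖F (p (insert i s)) - F (p s)‖ + ‖F (p s) - F θ‖ := norm_sub_le_norm_sub_add_norm_sub _ _ _
        _ ≤ C * ‖x - θ‖ + s.card * (C * ‖x - θ‖) := add_le_add (hstep s i hi) ih
        _ = _ := by push_cast; ring
  have hp : p Finset.univ = x := by ext j; simp [p]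
  have := hall Finset.univ
  rw [hp, Finset.card_univ, Fintype.card_fin] at this
  linarith

/-- Second order Taylor inequality for a function whose second partial derivatives exist and are
bounded. -/
theorem norm_taylor_le_of_partial {F : EuclideanSpace ℝ (Fin m) → V}
    {F' : Fin m → EuclideanSpace ℝ (Fin m) → V}
    {F'' : Fin m → Fin m → EuclideanSpace ℝ (Fin m) → V}
    {θ x : EuclideanSpace ℝ (Fin m)} {C : ℝ}
    (hF : ∀ y, ‖y - θ‖ ≤ ‖x - θ‖ → ∀ i, HasDerivAt (fun t => F (shift y i t)) (F' i y) 0)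
    (hF' : ∀ y, ‖y - θ‖ ≤ ‖x - θ‖ → ∀ i j,
      HasDerivAt (fun t => F' j (shift y i t)) (F'' i j y) 0)
    (hC : ∀ y, ‖y - θ‖ ≤ ‖x - θ‖ → ∀ i j, ‖F'' i j y‖ ≤ C) :
    ‖F x - F θ - ∑ i, (x i - θ i) • F' i θ‖ ≤ m ^ 2 * C * ‖x - θ‖ ^ 2 := by
  -- Subtracting the linear part leaves partial derivatives `F' i y - F' i θ`, which are of first
  -- order by the mean value inequality; a second application of it gives the quadratic bound.
  let G : EuclideanSpace ℝ (Fin m) → V := fun y => F y - F θ - ∑ i, (y i - θ i) • F' i θ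
  have hG : ∀ y, ‖y - θ‖ ≤ ‖x - θ‖ → ∀ i,
      HasDerivAt (fun t => G (shift y i t)) (F' i y - F' i θ) 0 := by
    intro y hy i
    refine ((hF y hy i).sub_const (F θ)).sub ?_
    have : ∀ j, HasDerivAt (fun t : ℝ => (shift y i t j - θ j) • F' j θ)
        ((if j = i then (1 : ℝ) else 0) • F' j θ) 0 := by
      intro j
      have h0 : HasDerivAt (fun t : ℝ => shift y i t j - θ j) (if j = i then (1 : ℝ) else 0) 0 := by
        simp only [shift_apply]
        by_cases hj : j = i
        · simpa [hj] using ((hasDerivAt_id (0 : ℝ)).const_add (y j)).sub_const (θ j)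
        · simpa [hj] using hasDerivAt_const (0 : ℝ) (y j - θ j)
      exact h0.smul_const _
    have h := HasDerivAt.fun_sum fun j (_ : j ∈ Finset.univ) => this j
    simpa using h
  have hb : ∀ y, ‖y - θ‖ ≤ ‖x - θ‖ → ∀ i, ‖F' i y - F' i θ‖ ≤ m * C * ‖x - θ‖ := by
    intro y hy i
    have hC0 : 0 ≤ C := (norm_nonneg _).trans (hC θ (by simp) i i)
    refine (norm_sub_le_of_partial (F := F' i) (θ := θ) (x := y) (F' := fun j => F'' j i) (C := C)
      (fun z hz j => hF' z (hz.trans hy) j i) (fun z hz j => hC z (hz.trans hy) j i)).trans ?_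
    gcongr
  have := norm_sub_le_of_partial hG hb
  have e : G θ = 0 := by simp [G]
  rw [e, sub_zero] at this
  refine this.trans_eq ?_
  ring

/-- A `C²` function has a second order Taylor inequality. -/
theorem exists_taylor_bound {W : Type*} [NormedAddCommGroup W] [NormedSpace ℝ W] {Ψ : V → W}
    (hΨ : ContDiff ℝ 2 Ψ) (v : V) : ∃ C, ∃ r > 0, ∀ u, ‖u - v‖ < r →
      ‖Ψ u - Ψ v - fderiv ℝ Ψ v (u - v)‖ ≤ C * ‖u - v‖ ^ 2 := by
  have h1 : ContDiff ℝ 1 (fderiv ℝ Ψ) := hΨ.fderiv_right (by norm_num)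
  -- The derivative of a `C²` function is `C¹`, hence Lipschitz near `v`.
  obtain ⟨K, t, ht, hK⟩ := h1.contDiffAt (x := v) |>.exists_lipschitzOnWith
  obtain ⟨r, hr, hball⟩ := Metric.mem_nhds_iff.1 ht
  refine ⟨K, r, hr, fun u hu => ?_⟩
  have hseg : ∀ w ∈ segment ℝ v u, ‖w - v‖ ≤ ‖u - v‖ := fun w hw => by
    have := norm_sub_le_of_mem_segment hw
    simpa using this
  have hd : Differentiable ℝ Ψ := hΨ.differentiable (by norm_num)
  have := (convex_segment v u).norm_image_sub_le_of_norm_hasFDerivWithin_le' (𝕜 := ℝ) (f := Ψ)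
    (f' := fderiv ℝ Ψ) (φ := fderiv ℝ Ψ v) (C := K * ‖u - v‖)
    (fun w _ => (hd w).hasFDerivAt.hasFDerivWithinAt) (fun w hw => by
      have hw' := hseg w hw
      have := hK.norm_sub_le (hball (mem_ball_iff_norm.2 (hw'.trans_lt hu)))
        (hball (Metric.mem_ball_self hr))
      exact this.trans (by gcongr)) (left_mem_segment ℝ v u) (right_mem_segment ℝ v u)
  refine this.trans_eq ?_
  ring

variable {ι H : Type*} [NormedAddCommGroup H] [InnerProductSpace ℂ H] [CompleteSpace H]
  {b : HilbertBasis ι ℂ H} {ρ : EuclideanSpace ℝ (Fin m) → H →L[ℂ] H}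
  {Θ : Set (EuclideanSpace ℝ (Fin m))} (hΘ : IsOpen Θ)
  (hρ : ∀ θ ∈ Θ, IsDensity b (ρ θ)) (h1 : CondM1 b ρ Θ)
  {θ : EuclideanSpace ℝ (Fin m)} (hθ : θ ∈ Θ)

section State

include hΘ hρ h1 hθ

/-- By (M.1) the first and second partial derivatives are bounded in the norm of `TC b`, so the
inequalities for functions with bounded partial derivatives apply in a ball inside `Θ`. -/
theorem exists_state_taylor : ∃ C, 0 ≤ C ∧ ∀ᶠ x in 𝓝 θ,
    ‖TC.ofOp b (ρ x) - TC.ofOp b (ρ θ)‖ ≤ C * ‖x - θ‖ ∧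
    ‖TC.ofOp b (ρ x) - TC.ofOp b (ρ θ) -
      ∑ i, (x i - θ i) • TC.ofOp b (traceDeriv b ρ i θ)‖ ≤ C * ‖x - θ‖ ^ 2 := by
  obtain ⟨C, hC⟩ := exists_norm_bound hΘ hρ h1
  obtain ⟨r, hr, hball⟩ := Metric.isOpen_iff.1 hΘ θ hθ
  refine ⟨max (m * |C|) (m ^ 2 * |C|), by positivity, ?_⟩
  filter_upwards [Metric.ball_mem_nhds θ hr] with x hx
  have hmem : ∀ y, ‖y - θ‖ ≤ ‖x - θ‖ → y ∈ Θ := fun y hy =>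
    hball (mem_ball_iff_norm.2 (hy.trans_lt (mem_ball_iff_norm.1 hx)))
  have d1 : ∀ y, ‖y - θ‖ ≤ ‖x - θ‖ → ∀ i, HasDerivAt (fun t => TC.ofOp b (ρ (shift y i t)))
      (TC.ofOp b (traceDeriv b ρ i y)) 0 := fun y hy i => by
    have := hasDerivAt_state hΘ hρ h1 i (θ := y) (s := 0) (by rw [shift_zero]; exact hmem y hy)
    rwa [shift_zero] at this
  have d2 : ∀ y, ‖y - θ‖ ≤ ‖x - θ‖ → ∀ i j,
      HasDerivAt (fun t => TC.ofOp b (traceDeriv b ρ j (shift y i t)))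
        (TC.ofOp b (traceDeriv b (traceDeriv b ρ j) i y)) 0 := fun y hy i j => by
    have := hasDerivAt_traceDeriv hΘ hρ h1 i j (θ := y) (s := 0)
      (by rw [shift_zero]; exact hmem y hy)
    rwa [shift_zero] at this
  constructor
  · refine (norm_sub_le_of_partial (F := fun x => TC.ofOp b (ρ x)) d1
      fun y hy i => ((hC y (hmem y hy)).1 i).trans (le_abs_self C)).trans ?_
    gcongr
    exact le_max_left _ _
  · refine (norm_taylor_le_of_partial (F := fun x => TC.ofOp b (ρ x))
      (F' := fun i y => TC.ofOp b (traceDeriv b ρ i y))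
      (F'' := fun i j y => TC.ofOp b (traceDeriv b (traceDeriv b ρ j) i y)) d1 d2
      fun y hy i j => ((hC y (hmem y hy)).2 i j).trans (le_abs_self C)).trans ?_
    gcongr
    exact le_max_right _ _

theorem continuousAt_state : ContinuousAt (fun x => TC.ofOp b (ρ x)) θ := by
  obtain ⟨C, -, hC⟩ := exists_state_taylor hΘ hρ h1 hθ
  rw [ContinuousAt, tendsto_iff_norm_sub_tendsto_zero]
  have ht : Tendsto (fun x => C * ‖x - θ‖) (𝓝 θ) (𝓝 0) := by
    have : Continuous fun x => C * ‖x - θ‖ := by fun_prop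
    simpa using this.tendsto θ
  exact squeeze_zero' (.of_forall fun _ => norm_nonneg _) (hC.mono fun x hx => hx.1) ht

end State

/-- The `i`-th mean of a bounded estimator as a smooth function of the state. -/
theorem exists_smooth_mean (hρ : ∀ θ ∈ Θ, IsDensity b (ρ θ)) {N : ℕ} {S : Estimator ι N m} {K : ℝ}
    (hS : ∀ ω, ‖S.T ω‖ ≤ K) (i : Fin m) : ∃ Ψ : TC b → ℝ, ContDiff ℝ 2 Ψ ∧
      ∀ x ∈ Θ, S.mean b (ρ x) i = Ψ (TC.ofOp b (ρ x)) := by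
  have hm : Measurable fun ω => S.T ω i :=
    (show Measurable fun x : EuclideanSpace ℝ (Fin m) => x i by fun_prop).comp S.measurable_T
  have hb : ∀ ω, |S.T ω i| ≤ K := fun ω => (coord_abs_le _ _).trans (hS ω)
  refine ⟨fun τ => TC.expectCLM S.M hm hb (TC.tensor b N fun _ => τ), ?_, fun x hx => ?_⟩
  · exact (ContinuousLinearMap.contDiff _).comp
      ((TC.tensor b N).contDiff.comp (contDiff_pi.2 fun _ => contDiff_id))
  · have e : (TC.tensor b N fun _ => TC.ofOp b (ρ x)).val = tensorOp b fun _ => ρ x := by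
      rw [TC.val_tensor, val_state hρ hx]
    change _ = TC.expect _ _ _
    rw [TC.expect_of_nonneg S.M hm hb (by rw [e]; exact tensorOp_nonneg b fun _ => (hρ x hx).1)
      (by rw [e, traceE_tensorOp_density b (hρ x hx)]; simp), e]
    rfl

open Classical in
/-- The mean of the estimator, as a function of the parameter, and zero outside the parameter
set. -/
def Estimator.meanFun (b : HilbertBasis ι ℂ H) (ρ : EuclideanSpace ℝ (Fin m) → H →L[ℂ] H)
    (Θ : Set (EuclideanSpace ℝ (Fin m))) {N : ℕ} (S : Estimator ι N m)
    (x : EuclideanSpace ℝ (Fin m)) : EuclideanSpace ℝ (Fin m) :=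
  WithLp.toLp 2 fun i => if x ∈ Θ then S.mean b (ρ x) i else 0

theorem Estimator.meanFun_apply {N : ℕ} (S : Estimator ι N m) {x : EuclideanSpace ℝ (Fin m)}
    (hx : x ∈ Θ) (i : Fin m) : S.meanFun b ρ Θ x i = S.mean b (ρ x) i := by
  simp [Estimator.meanFun, hx]

include hρ in
theorem Estimator.abs_meanFun_le {N : ℕ} {S : Estimator ι N m} {K : ℝ} (hK : 0 ≤ K)
    (hS : ∀ ω, ‖S.T ω‖ ≤ K) (x : EuclideanSpace ℝ (Fin m)) (i : Fin m) :
    |S.meanFun b ρ Θ x i| ≤ K := by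
  by_cases hx : x ∈ Θ
  · rw [S.meanFun_apply hx]
    have : IsProbabilityMeasure (S.law b (ρ x)) := ⟨by
      rw [Estimator.law, POVM.law_univ _ _ (tensorOp_nonneg b fun _ => (hρ x hx).1),
        traceE_tensorOp_density b (hρ x hx)]⟩
    have := norm_integral_le_of_norm_le_const (μ := S.law b (ρ x)) (f := fun ω => S.T ω i) (C := K)
      (.of_forall fun ω => (coord_abs_le (S.T ω) i).trans (hS ω))
    simpa [Estimator.mean] using this
  · simpa [Estimator.meanFun, hx] using hK

include hΘ hρ h1

/-- The mean is continuous on the open set `Θ` and is set to zero outside it. -/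
theorem Estimator.measurable_meanFun {N : ℕ} {S : Estimator ι N m} {K : ℝ}
    (hS : ∀ ω, ‖S.T ω‖ ≤ K) : Measurable (S.meanFun b ρ Θ) := by
  classical
  refine (WithLp.measurable_toLp 2 _).comp (measurable_pi_iff.2 fun i => ?_)
  obtain ⟨Ψ, hΨ, hm⟩ := exists_smooth_mean hρ hS i
  have hc : ContinuousOn (fun x => S.mean b (ρ x) i) Θ := by
    refine ContinuousOn.congr (f := fun x => Ψ (TC.ofOp b (ρ x))) (fun x hx => ?_) hm
    exact (hΨ.continuous.continuousAt.comp (continuousAt_state hΘ hρ h1 hx)).continuousWithinAt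
  have := hc.measurable_piecewise (continuousOn_const (c := (0 : ℝ))) hΘ.measurableSet
  convert this using 2 with x
  simp [Set.piecewise]

include hθ

/-- The mean of a bounded estimator is differentiable, with a quadratic remainder. -/
theorem Estimator.exists_expansion {N : ℕ} {S : Estimator ι N m} {K : ℝ}
    (hS : ∀ ω, ‖S.T ω‖ ≤ K) : ∃ B : Matrix (Fin m) (Fin m) ℝ, HasBMatrix b ρ S θ B ∧
      ∃ C, 0 ≤ C ∧ ∀ x i, |S.meanFun b ρ Θ x i - S.mean b (ρ θ) i - ∑ j, B i j * (x j - θ j)| ≤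
        C * ‖x - θ‖ ^ 2 := by
  choose Ψ hΨ hm using exists_smooth_mean hρ hS
  set R := fun x => TC.ofOp b (ρ x) with hR
  let B : Matrix (Fin m) (Fin m) ℝ := Matrix.of fun i j =>
    fderiv ℝ (Ψ i) (R θ) (TC.ofOp b (traceDeriv b ρ j θ))
  have hB : HasBMatrix b ρ S θ B := by
    intro i j
    have hd := hasDerivAt_state hΘ hρ h1 j (θ := θ) (s := 0) (by rwa [shift_zero])
    have hf : HasFDerivAt (Ψ i) (fderiv ℝ (Ψ i) (R (shift θ j 0))) (R (shift θ j 0)) :=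
      ((hΨ i).differentiable (by norm_num) _).hasFDerivAt
    have := hf.comp_hasDerivAt (0 : ℝ) hd
    rw [shift_zero] at this
    refine this.congr_of_eventuallyEq ?_
    filter_upwards [eventually_shift_mem hΘ hθ j] with t ht
    exact hm i _ ht
  refine ⟨B, hB, ?_⟩
  obtain ⟨C, hC0, hC⟩ := exists_state_taylor hΘ hρ h1 hθ
  have hloc : ∀ i, ∃ C', 0 ≤ C' ∧ ∀ᶠ x in 𝓝 θ,
      |S.meanFun b ρ Θ x i - S.mean b (ρ θ) i - ∑ j, B i j * (x j - θ j)| ≤ C' * ‖x - θ‖ ^ 2 := by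
    intro i
    obtain ⟨C₂, r, hr, h2⟩ := exists_taylor_bound (hΨ i) (R θ)
    have hc := continuousAt_state hΘ hρ h1 hθ
    refine ⟨|C₂| * C ^ 2 + ‖fderiv ℝ (Ψ i) (R θ)‖ * C, by positivity, ?_⟩
    filter_upwards [hC, hc.eventually (Metric.ball_mem_nhds _ hr), hΘ.eventually_mem hθ]
      with x hx hxr hxΘ
    rw [S.meanFun_apply hxΘ, hm i x hxΘ, hm i θ hθ]
    have e : ∑ j, B i j * (x j - θ j) = fderiv ℝ (Ψ i) (R θ)
        (∑ j, (x j - θ j) • TC.ofOp b (traceDeriv b ρ j θ)) := by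
      rw [map_sum]
      refine Finset.sum_congr rfl fun j _ => ?_
      rw [map_smul, smul_eq_mul, mul_comm]
      rfl
    -- The remainder splits into that of the smooth function `Ψ i` and the image under its
    -- derivative of that of the state; both are quadratic in `x - θ`.
    have e2 : Ψ i (R x) - Ψ i (R θ) - ∑ j, B i j * (x j - θ j) =
        (Ψ i (R x) - Ψ i (R θ) - fderiv ℝ (Ψ i) (R θ) (R x - R θ)) + fderiv ℝ (Ψ i) (R θ)
          (R x - R θ - ∑ j, (x j - θ j) • TC.ofOp b (traceDeriv b ρ j θ)) := by
      rw [e, map_sub (fderiv ℝ (Ψ i) (R θ)) (R x - R θ)]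
      ring
    rw [e2]
    have a1 := h2 (R x) (mem_ball_iff_norm.1 hxr)
    have a2 := (fderiv ℝ (Ψ i) (R θ)).le_opNorm
      (R x - R θ - ∑ j, (x j - θ j) • TC.ofOp b (traceDeriv b ρ j θ))
    rw [Real.norm_eq_abs] at a1 a2
    refine (abs_add_le _ _).trans ?_
    calc _ ≤ |C₂| * (C * ‖x - θ‖) ^ 2 + ‖fderiv ℝ (Ψ i) (R θ)‖ * (C * ‖x - θ‖ ^ 2) := by
          refine add_le_add (a1.trans ?_) (a2.trans ?_)
          · have := hx.1
            calc C₂ * ‖R x - R θ‖ ^ 2 ≤ |C₂| * ‖R x - R θ‖ ^ 2 := by gcongr; exact le_abs_self _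
              _ ≤ _ := by gcongr
          · have := hx.2
            gcongr
      _ = _ := by ring
  choose C' hC' hloc using hloc
  obtain ⟨r, hr, hball⟩ := Metric.eventually_nhds_iff_ball.1 (eventually_all.2 hloc)
  have hK : 0 ≤ |K| := abs_nonneg K
  have hS' : ∀ ω, ‖S.T ω‖ ≤ |K| := fun ω => (hS ω).trans (le_abs_self K)
  set s := ∑ i, ∑ j, |B i j| with hs
  have hs0 : 0 ≤ s := Finset.sum_nonneg fun i _ => Finset.sum_nonneg fun j _ => abs_nonneg _
  -- The expansion is only local, but the bound is claimed for all `x`. At distance at least `r` the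
  -- bounded part is at most `2 * |K|` and the linear part at most `s * ‖x - θ‖`, and both are
  -- absorbed by the square of the distance at the price of `r⁻²` and `r⁻¹`.
  refine ⟨∑ i, C' i + (2 * |K| / r ^ 2 + s / r), by
    have := Finset.sum_nonneg fun i (_ : i ∈ Finset.univ) => hC' i
    positivity, fun x i => ?_⟩
  have hCi : C' i ≤ ∑ i, C' i := Finset.single_le_sum (fun i _ => hC' i) (Finset.mem_univ i)
  by_cases hx : x ∈ Metric.ball θ r
  · refine (hball x hx i).trans ?_
    have : 0 ≤ 2 * |K| / r ^ 2 + s / r := by positivity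
    gcongr
    linarith
  · rw [mem_ball_iff_norm, not_lt] at hx
    have g1 := S.abs_meanFun_le hρ hK hS' x i
    have g2 := S.abs_meanFun_le hρ hK hS' θ i
    rw [S.meanFun_apply hθ] at g2
    have g3 : |∑ j, B i j * (x j - θ j)| ≤ s * ‖x - θ‖ := by
      refine (Finset.abs_sum_le_sum_abs _ _).trans ?_
      calc _ ≤ ∑ j, |B i j| * ‖x - θ‖ := by
            refine Finset.sum_le_sum fun j _ => ?_
            rw [abs_mul]
            gcongr
            exact coord_abs_le (x - θ) j
        _ = (∑ j, |B i j|) * ‖x - θ‖ := (Finset.sum_mul ..).symm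
        _ ≤ _ := by
            gcongr
            exact Finset.single_le_sum (f := fun i => ∑ j, |B i j|)
              (fun i _ => Finset.sum_nonneg fun j _ => abs_nonneg _) (Finset.mem_univ i)
    have g4 : 2 * |K| ≤ 2 * |K| / r ^ 2 * ‖x - θ‖ ^ 2 := by
      rw [div_mul_eq_mul_div, le_div_iff₀ (by positivity)]
      gcongr
    have g5 : s * ‖x - θ‖ ≤ s / r * ‖x - θ‖ ^ 2 := by
      rw [div_mul_eq_mul_div, le_div_iff₀ hr, sq]
      nlinarith [mul_nonneg hs0 (norm_nonneg (x - θ))]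
    have g6 : 0 ≤ (∑ i, C' i) * ‖x - θ‖ ^ 2 := by
      have := Finset.sum_nonneg fun i (_ : i ∈ Finset.univ) => hC' i
      positivity
    rw [abs_le] at g1 g2 g3 ⊢
    constructor <;> nlinarith

end Taylor

/-! ### Affine images, sums and finitely valued approximations of estimators -/

section ModelMoments

variable {ι H : Type*} [NormedAddCommGroup H] [InnerProductSpace ℂ H] [CompleteSpace H]
  {b : HilbertBasis ι ℂ H} {m : ℕ} {ρ : EuclideanSpace ℝ (Fin m) → H →L[ℂ] H}
  {Θ : Set (EuclideanSpace ℝ (Fin m))} {θ : EuclideanSpace ℝ (Fin m)}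

/-- Composition with an affine map. -/
abbrev Estimator.aff {n : ℕ} (E : Estimator ι n m) (A : Matrix (Fin m) (Fin m) ℝ)
    (c : EuclideanSpace ℝ (Fin m)) : Estimator ι n m := E.comp (affMap A c) (measurable_affMap A c)

/-- The estimate has finite second moments everywhere on `Θ`. -/
def Estimator.HasMoments (b : HilbertBasis ι ℂ H) (ρ : EuclideanSpace ℝ (Fin m) → H →L[ℂ] H)
    (Θ : Set (EuclideanSpace ℝ (Fin m))) {n : ℕ} (E : Estimator ι n m) : Prop :=
  ∀ x ∈ Θ, MemLp (fun y => y) 2 (E.dist b (ρ x))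

theorem Estimator.Tame.memLp {n : ℕ} {E : Estimator ι n m} (h : E.Tame b ρ θ) :
    MemLp (fun y => y) 2 (E.dist b (ρ θ)) := by
  obtain ⟨C, hC⟩ := h.bound
  exact memLp_two_iff.2 (hC.self_of_nhds.trans_lt (by simp))

section State

variable {σ : H →L[ℂ] H} (hσ : IsDensity b σ)
include hσ

theorem Estimator.mean_aff {n : ℕ} {E : Estimator ι n m}
    (hE : MemLp (fun y => y) 2 (E.dist b σ)) (A : Matrix (Fin m) (Fin m) ℝ)
    (c : EuclideanSpace ℝ (Fin m)) (i : Fin m) :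
    (E.aff A c).mean b σ i = ∑ j, A i j * E.mean b σ j + c i := by
  have := E.isProbabilityMeasure_dist b hσ
  simp only [Estimator.mean_eq, Estimator.comp_dist, QEst.mean_aff hE]

theorem Estimator.cov_aff {n : ℕ} {E : Estimator ι n m}
    (hE : MemLp (fun y => y) 2 (E.dist b σ)) (A : Matrix (Fin m) (Fin m) ℝ)
    (c : EuclideanSpace ℝ (Fin m)) : (E.aff A c).cov b σ = A * E.cov b σ * A.transpose := by
  have := E.isProbabilityMeasure_dist b hσ
  rw [Estimator.cov_eq, Estimator.cov_eq, Estimator.comp_dist, covM_aff hE]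

variable {a c : ℕ} {E : Estimator ι a m} {F : Estimator ι c m} (hF : F.IsFinite)
  (hE : MemLp (fun y => y) 2 (E.dist b σ)) (hF2 : MemLp (fun y => y) 2 (F.dist b σ))
include hE hF2

theorem Estimator.mean_add (i : Fin m) :
    (E.add F hF).mean b σ i = E.mean b σ i + F.mean b σ i := by
  have := E.isProbabilityMeasure_dist b hσ
  have := F.isProbabilityMeasure_dist b hσ
  simp only [Estimator.mean_eq]
  rw [Estimator.add_dist b E F hF hσ]
  exact mean_conv hE hF2 i

theorem Estimator.cov_add : (E.add F hF).cov b σ = E.cov b σ + F.cov b σ := by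
  have := E.isProbabilityMeasure_dist b hσ
  have := F.isProbabilityMeasure_dist b hσ
  rw [Estimator.cov_eq, Estimator.cov_eq, Estimator.cov_eq, Estimator.add_dist b E F hF hσ]
  exact covM_conv hE hF2

end State

theorem HasBMatrix.unique {n : ℕ} {E : Estimator ι n m} {B B' : Matrix (Fin m) (Fin m) ℝ}
    (h : HasBMatrix b ρ E θ B) (h' : HasBMatrix b ρ E θ B') : B = B' := by
  ext i j
  exact (h i j).unique (h' i j)

section BMatrix

variable (hΘ : IsOpen Θ) (hρ : ∀ θ ∈ Θ, IsDensity b (ρ θ)) (hθ : θ ∈ Θ)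
include hΘ hρ hθ

theorem HasBMatrix.aff {n : ℕ} {E : Estimator ι n m} (hE : E.HasMoments b ρ Θ)
    {B : Matrix (Fin m) (Fin m) ℝ} (hB : HasBMatrix b ρ E θ B) (A : Matrix (Fin m) (Fin m) ℝ)
    (c : EuclideanSpace ℝ (Fin m)) : HasBMatrix b ρ (E.aff A c) θ (A * B) := by
  intro i j
  have h := (HasDerivAt.fun_sum fun k (_ : k ∈ Finset.univ) => (hB k j).const_mul (A i k)).add_const
    (c i)
  refine h.congr_of_eventuallyEq ?_
  filter_upwards [eventually_shift_mem hΘ hθ j] with t ht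
  exact Estimator.mean_aff (hρ _ ht) (hE _ ht) A c i

theorem HasBMatrix.add {a c : ℕ} {E : Estimator ι a m} {F : Estimator ι c m} (hF : F.IsFinite)
    (hE : E.HasMoments b ρ Θ) (hF2 : F.HasMoments b ρ Θ) {B B' : Matrix (Fin m) (Fin m) ℝ}
    (hB : HasBMatrix b ρ E θ B) (hB' : HasBMatrix b ρ F θ B') :
    HasBMatrix b ρ (E.add F hF) θ (B + B') := by
  intro i j
  refine ((hB i j).add (hB' i j)).congr_of_eventuallyEq ?_
  filter_upwards [eventually_shift_mem hΘ hθ j] with t ht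
  exact Estimator.mean_add (hρ _ ht) hF (hE _ ht) (hF2 _ ht) i

end BMatrix

/-- The matrix of the derivatives of the means, computed from the derivative of the
distribution. -/
def Estimator.dMat (b : HilbertBasis ι ℂ H) (ρ : EuclideanSpace ℝ (Fin m) → H →L[ℂ] H)
    {n : ℕ} (E : Estimator ι n m) (θ : EuclideanSpace ℝ (Fin m)) : Matrix (Fin m) (Fin m) ℝ :=
  Matrix.of fun i j => E.dInt b ρ θ j fun x => x i

section Approx

/-- Approximations of the identity by simple functions. -/
def simpleApprox (m j : ℕ) : SimpleFunc (EuclideanSpace ℝ (Fin m)) (EuclideanSpace ℝ (Fin m)) :=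
  SimpleFunc.approxOn id measurable_id Set.univ 0 (Set.mem_univ _) j

theorem tendsto_simpleApprox (x : EuclideanSpace ℝ (Fin m)) :
    Tendsto (fun j => simpleApprox m j x) atTop (𝓝 x) :=
  SimpleFunc.tendsto_approxOn measurable_id (Set.mem_univ _) (by simp)

theorem norm_simpleApprox_le (j : ℕ) (x : EuclideanSpace ℝ (Fin m)) :
    ‖simpleApprox m j x‖ ≤ 2 * ‖x‖ := by
  have := SimpleFunc.norm_approxOn_zero_le (measurable_id (α := EuclideanSpace ℝ (Fin m)))
    (Set.mem_univ 0) x j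
  simpa [simpleApprox, two_mul] using this

theorem tendsto_coord (i : Fin m) (x : EuclideanSpace ℝ (Fin m)) :
    Tendsto (fun j => simpleApprox m j x i) atTop (𝓝 (x i)) :=
  ((show Continuous fun y : EuclideanSpace ℝ (Fin m) => y i by fun_prop).tendsto x).comp
    (tendsto_simpleApprox x)

theorem tendsto_mean_simpleApprox {μ : Measure (EuclideanSpace ℝ (Fin m))}
    (hμ : Integrable (fun x => x) μ) (i : Fin m) :
    Tendsto (fun j => ∫ x, x i ∂(μ.map (simpleApprox m j))) atTop (𝓝 (∫ x, x i ∂μ)) := by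
  have e : ∀ j, ∫ x, x i ∂(μ.map (simpleApprox m j)) = ∫ x, simpleApprox m j x i ∂μ := fun j =>
    integral_map (simpleApprox m j).measurable.aemeasurable (by fun_prop)
  simp_rw [e]
  refine tendsto_integral_of_dominated_convergence (fun x => 2 * ‖x‖) (fun j => ?_)
    (hμ.norm.const_mul 2)
    (fun j => .of_forall fun x => (coord_abs_le _ _).trans (norm_simpleApprox_le j x))
    (.of_forall (tendsto_coord i))
  exact ((show Measurable fun y : EuclideanSpace ℝ (Fin m) => y i by fun_prop).comp
    (simpleApprox m j).measurable).aestronglyMeasurable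

theorem memLp_simpleApprox {μ : Measure (EuclideanSpace ℝ (Fin m))}
    (hμ : MemLp (fun x => x) 2 μ) (j : ℕ) : MemLp (fun x => x) 2 (μ.map (simpleApprox m j)) := by
  rw [memLp_map_measure_iff (by fun_prop) (simpleApprox m j).measurable.aemeasurable]
  exact (hμ.const_smul (2 : ℝ)).of_le (simpleApprox m j).measurable.aestronglyMeasurable
    (.of_forall fun x => (norm_simpleApprox_le j x).trans_eq (by
      change _ = ‖(2 : ℝ) • x‖
      rw [norm_smul]; norm_num))

/-- The approximations are dominated by `2 * ‖x‖`, so second moments and means converge by dominated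
convergence, and the covariance is a polynomial in them. -/
theorem tendsto_covM_simpleApprox {μ : Measure (EuclideanSpace ℝ (Fin m))} [IsProbabilityMeasure μ]
    (hμ : MemLp (fun x => x) 2 μ) :
    Tendsto (fun j => covM (μ.map (simpleApprox m j))) atTop (𝓝 (covM μ)) := by
  have key : ∀ {ν : Measure (EuclideanSpace ℝ (Fin m))} [IsProbabilityMeasure ν],
      MemLp (fun x => x) 2 ν → ∀ i k, covM ν i k =
        ∫ x, x i * x k ∂ν - (∫ x, x i ∂ν) * ∫ x, x k ∂ν := by
    intro ν _ hν i k
    have := congrFun₂ (mse_eq hν 0) i k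
    simp only [Matrix.of_apply, Matrix.add_apply, PiLp.zero_apply, sub_zero] at this
    linarith
  have hi : Integrable (fun x => x) μ := hμ.integrable one_le_two
  refine tendsto_pi_nhds.2 fun i => tendsto_pi_nhds.2 fun k => ?_
  have hp : ∀ j, IsProbabilityMeasure (μ.map (simpleApprox m j)) := fun j =>
    Measure.isProbabilityMeasure_map (simpleApprox m j).measurable.aemeasurable
  simp_rw [fun j => key (memLp_simpleApprox hμ j) i k, key hμ i k]
  refine Tendsto.sub ?_ ((tendsto_mean_simpleApprox hi i).mul (tendsto_mean_simpleApprox hi k))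
  have e : ∀ j, ∫ x, x i * x k ∂(μ.map (simpleApprox m j)) =
      ∫ x, simpleApprox m j x i * simpleApprox m j x k ∂μ := fun j =>
    integral_map (simpleApprox m j).measurable.aemeasurable (by fun_prop)
  simp_rw [e]
  refine tendsto_integral_of_dominated_convergence (fun x => 4 * ‖x‖ ^ 2) (fun j => ?_)
    ((hμ.integrable_norm_pow two_ne_zero).const_mul 4)
    (fun j => .of_forall fun x => ?_)
    (.of_forall fun x => (tendsto_coord i x).mul (tendsto_coord k x))
  · exact ((show Measurable fun y : EuclideanSpace ℝ (Fin m) => y i * y k by fun_prop).comp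
      (simpleApprox m j).measurable).aestronglyMeasurable
  · rw [norm_mul]
    have h1 := (coord_abs_le _ i).trans (norm_simpleApprox_le j x)
    have h2 := (coord_abs_le _ k).trans (norm_simpleApprox_le j x)
    calc _ ≤ (2 * ‖x‖) * (2 * ‖x‖) := mul_le_mul h1 h2 (abs_nonneg _) (by positivity)
      _ = _ := by ring

/-- Approximations of an estimator by estimators with finitely many values. -/
def Estimator.approx {n : ℕ} (E : Estimator ι n m) (j : ℕ) : Estimator ι n m :=
  E.comp (simpleApprox m j) (simpleApprox m j).measurable

theorem Estimator.approx_distOp {n : ℕ} (E : Estimator ι n m) (j : ℕ)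
    (τ : TensorPower ι n →L[ℂ] TensorPower ι n) :
    (E.approx j).distOp τ = (E.distOp τ).map (simpleApprox m j) :=
  E.comp_distOp _ _ τ

theorem Estimator.isFinite_approx {n : ℕ} (E : Estimator ι n m) (j : ℕ) :
    (E.approx j).IsFinite := by
  refine (simpleApprox m j).finite_range.subset ?_
  rintro _ ⟨ω, rfl⟩
  exact Set.mem_range_self _

theorem Estimator.IsFinite.bounded {n : ℕ} {E : Estimator ι n m} (h : E.IsFinite) :
    ∃ K : ℝ≥0, ∀ ω, ‖E.T ω‖ ≤ K := by
  obtain ⟨K, hK⟩ := h.exists_bound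
  exact ⟨K.toNNReal, fun ω => (hK ω).trans (Real.le_coe_toNNReal K)⟩

end Approx

variable (hΘ : IsOpen Θ) (hρ : ∀ θ ∈ Θ, IsDensity b (ρ θ)) (h1 : CondM1 b ρ Θ) (hθ : θ ∈ Θ)
include hΘ hρ h1

theorem Estimator.HasMoments.of_condE {n : ℕ} {E : Estimator ι n m} (h : CondE b ρ Θ E) :
    E.HasMoments b ρ Θ := fun _ hx => (Estimator.Tame.of_condE hΘ hρ h1 hx h).memLp

theorem Estimator.IsFinite.hasMoments {n : ℕ} {E : Estimator ι n m} (h : E.IsFinite) :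
    E.HasMoments b ρ Θ := fun _ hx => by
  obtain ⟨K, hK⟩ := h.bounded
  exact (Estimator.Tame.of_bounded hΘ hρ h1 hx hK).memLp

include hθ

theorem Estimator.Tame.hasBMatrix {n : ℕ} {E : Estimator ι n m} (h : E.Tame b ρ θ) :
    HasBMatrix b ρ E θ (E.dMat b ρ θ) := fun i j => by
  have := h.hasDerivAt hΘ hρ h1 hθ (φ := fun x => x i) (by fun_prop) (a := 0) (c := 1)
    (fun x => by simpa using coord_abs_le x i) j
  change HasDerivAt (fun t => E.mean b (ρ (shift θ j t)) i) (E.dInt b ρ θ j fun x => x i) 0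
  simp only [Estimator.mean_eq]
  exact this

theorem Estimator.IsFinite.hasBMatrix {n : ℕ} {E : Estimator ι n m} (h : E.IsFinite) :
    HasBMatrix b ρ E θ (E.dMat b ρ θ) := by
  obtain ⟨K, hK⟩ := h.bounded
  exact (Estimator.Tame.of_bounded hΘ hρ h1 hθ hK).hasBMatrix hΘ hρ h1 hθ

theorem Estimator.Tame.tendsto_dMat {n : ℕ} {E : Estimator ι n m} (h : E.Tame b ρ θ) :
    Tendsto (fun j => (E.approx j).dMat b ρ θ) atTop (𝓝 (E.dMat b ρ θ)) := by
  have := isFiniteMeasure_dPos hΘ hρ h1 hθ E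
  have := isFiniteMeasure_dNeg hΘ hρ h1 hθ E
  refine tendsto_pi_nhds.2 fun i => tendsto_pi_nhds.2 fun k => ?_
  have hp : Integrable (fun x => x) (E.dPos b ρ θ k) := ⟨by fun_prop, (h.pos k).lt_top⟩
  have hn : Integrable (fun x => x) (E.dNeg b ρ θ k) := ⟨by fun_prop, (h.neg k).lt_top⟩
  simp only [Estimator.dMat, Matrix.of_apply, Estimator.dInt, Estimator.approx_distOp]
  exact (tendsto_mean_simpleApprox hp i).sub (tendsto_mean_simpleApprox hn i)

theorem Estimator.Tame.tendsto_cov {n : ℕ} {E : Estimator ι n m} (h : E.Tame b ρ θ) :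
    Tendsto (fun j => (E.approx j).cov b (ρ θ)) atTop (𝓝 (E.cov b (ρ θ))) := by
  have := E.isProbabilityMeasure_dist b (hρ θ hθ)
  simp only [Estimator.cov_eq, Estimator.approx_distOp]
  exact tendsto_covM_simpleApprox h.memLp

omit hΘ hρ h1 hθ in
theorem tendsto_matrix_inv {f : ℕ → Matrix (Fin m) (Fin m) ℝ} (h : Tendsto f atTop (𝓝 1)) :
    Tendsto (fun j => (f j)⁻¹) atTop (𝓝 1) ∧ ∀ᶠ j in atTop, (f j)⁻¹ * f j = 1 := by
  constructor
  · have hc : ContinuousAt (Inv.inv : Matrix (Fin m) (Fin m) ℝ → _) 1 := by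
      refine continuousAt_matrix_inv _ ?_
      rw [Matrix.det_one, Ring.inverse_eq_inv']
      exact continuousAt_inv₀ one_ne_zero
    have := hc.tendsto.comp h
    rwa [inv_one] at this
  · have hdet : Tendsto (fun j => (f j).det) atTop (𝓝 1) := by
      have := ((continuous_id.matrix_det (n := Fin m) (R := ℝ)).tendsto 1).comp h
      simpa [Function.comp_def] using this
    filter_upwards [hdet.eventually_ne one_ne_zero] with j hj
    exact Matrix.nonsing_inv_mul _ (isUnit_iff_ne_zero.2 hj)

/-- Locally unbiased estimators are approximated by locally unbiased estimators with finitely many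
values. -/
theorem localBound_isFinite_le (G : Matrix (Fin m) (Fin m) ℝ) {n : ℕ} {C : Estimator ι n m → Prop}
    (hC : ∀ E, C E → E.Tame b ρ θ) :
    localBound b ρ G θ n Estimator.IsFinite ≤ localBound b ρ G θ n C := by
  refine le_iInf₂ fun E hE => le_iInf fun hCE => ?_
  have hT := hC E hCE
  have hB : E.dMat b ρ θ = 1 := (hT.hasBMatrix hΘ hρ h1 hθ).unique hE.2
  have tB := hT.tendsto_dMat hΘ hρ h1 hθ
  rw [hB] at tB
  obtain ⟨tI, hI⟩ := tendsto_matrix_inv tB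
  set A := fun j => ((E.approx j).dMat b ρ θ)⁻¹
  let c : ℕ → EuclideanSpace ℝ (Fin m) := fun j =>
    WithLp.toLp 2 fun i => θ i - ∑ k, A j i k * (E.approx j).mean b (ρ θ) k
  have hm : ∀ j, (E.approx j).HasMoments b ρ Θ := fun j =>
    (E.isFinite_approx j).hasMoments hΘ hρ h1
  have tcov : Tendsto (fun j => A j * (E.approx j).cov b (ρ θ) * (A j).transpose) atTop
      (𝓝 (E.cov b (ρ θ))) := by
    have := (tI.mul (hT.tendsto_cov hΘ hρ h1 hθ)).mul
      ((continuous_id.matrix_transpose.tendsto (1 : Matrix (Fin m) (Fin m) ℝ)).comp tI)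
    simpa using this
  have ttr : Tendsto (fun j => (((n * (G * (A j * (E.approx j).cov b (ρ θ) *
      (A j).transpose)).trace : ℝ) : ℝ) : EReal)) atTop
      (𝓝 ((n * (G * E.cov b (ρ θ)).trace : ℝ) : EReal)) := by
    have hc : Continuous fun M : Matrix (Fin m) (Fin m) ℝ => (n : ℝ) * (G * M).trace := by
      fun_prop
    exact (continuous_coe_real_ereal.tendsto _).comp ((hc.tendsto _).comp tcov)
  refine ge_of_tendsto ttr ?_
  filter_upwards [hI] with j hj
  have hcov := Estimator.cov_aff (hρ θ hθ) (hm j θ hθ) (A j) (c j)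
  rw [← hcov]
  refine iInf₂_le_of_le ((E.approx j).aff (A j) (c j)) ⟨fun i => ?_, ?_⟩ (iInf_le_of_le ?_ le_rfl)
  · rw [Estimator.mean_aff (hρ θ hθ) (hm j θ hθ)]
    simp [c]
  · have := HasBMatrix.aff hΘ hρ hθ (hm j) ((E.isFinite_approx j).hasBMatrix hΘ hρ h1 hθ) (A j) (c j)
    rwa [hj] at this
  · exact (E.isFinite_approx j).comp _ _

end ModelMoments

/-! ### Local bounds from asymptotically unbiased sequences -/

section Upper

variable {m : ℕ}

theorem PosSemidef.sum_nonneg {G : Matrix (Fin m) (Fin m) ℝ} (hG : G.PosSemidef) (u : Fin m → ℝ) :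
    0 ≤ ∑ i, ∑ j, G i j * (u j * u i) := by
  have h := hG.dotProduct_mulVec_nonneg u
  simp only [dotProduct, Matrix.mulVec, star_trivial, Finset.mul_sum] at h
  refine h.trans_eq (Finset.sum_congr rfl fun i _ => Finset.sum_congr rfl fun j _ => ?_)
  ring

theorem trace_mul_nonneg_of_moment {X : Type*} [MeasurableSpace X] {μ : Measure X}
    {G : Matrix (Fin m) (Fin m) ℝ} (hG : G.PosSemidef) {u : Fin m → X → ℝ}
    (hu : ∀ i, MemLp (u i) 2 μ) :
    0 ≤ (G * Matrix.of fun i j => ∫ x, u i x * u j x ∂μ).trace := by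
  have hi : ∀ i j, Integrable (fun x => G i j * (u j x * u i x)) μ := fun i j =>
    ((hu j).integrable_mul (hu i)).const_mul _
  have e : (G * Matrix.of fun i j => ∫ x, u i x * u j x ∂μ).trace =
      ∫ x, ∑ i, ∑ j, G i j * (u j x * u i x) ∂μ := by
    rw [integral_finsetSum _ fun i _ => integrable_finsetSum _ fun j _ => hi i j]
    simp only [integral_finsetSum _ fun j _ => hi _ j, integral_const_mul]
    rfl
  rw [e]
  exact integral_nonneg fun x => PosSemidef.sum_nonneg hG fun i => u i x

/-- Sandwiching bounded matrices between matrices that tend to zero. -/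
theorem tendsto_sandwich {A W : ℕ → Matrix (Fin m) (Fin m) ℝ} (hA : Tendsto A atTop (𝓝 0)) {C : ℝ}
    (hW : ∀ᶠ n in atTop, ∀ i j, |W n i j| ≤ C) :
    Tendsto (fun n => A n * W n * (A n).transpose) atTop (𝓝 0) := by
  have hA' : ∀ i j, Tendsto (fun n => |A n i j|) atTop (𝓝 0) := fun i j => by
    have := ((tendsto_pi_nhds.1 (tendsto_pi_nhds.1 hA i) j)).abs
    simpa using this
  refine tendsto_pi_nhds.2 fun i => tendsto_pi_nhds.2 fun j => ?_
  have hg : Tendsto (fun n => ∑ k, (∑ l, |A n i l| * C) * |A n j k|) atTop (𝓝 0) := by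
    have : Tendsto (fun n => ∑ k, (∑ l, |A n i l| * C) * |A n j k|) atTop
        (𝓝 (∑ _k : Fin m, (∑ _l : Fin m, (0 : ℝ) * C) * 0)) :=
      tendsto_finsetSum _ fun k _ =>
        (tendsto_finsetSum _ fun l _ => (hA' i l).mul_const C).mul (hA' j k)
    simpa using this
  refine squeeze_zero_norm' ?_ hg
  filter_upwards [hW] with n hn
  simp only [Matrix.mul_apply, Matrix.transpose_apply, Real.norm_eq_abs]
  refine (Finset.abs_sum_le_sum_abs _ _).trans (Finset.sum_le_sum fun k _ => ?_)
  rw [abs_mul]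
  gcongr
  refine (Finset.abs_sum_le_sum_abs _ _).trans (Finset.sum_le_sum fun l _ => ?_)
  rw [abs_mul]
  gcongr
  exact hn l k

theorem integral_norm_pow_four_le {μ : Measure (EuclideanSpace ℝ (Fin m))} [IsProbabilityMeasure μ]
    {θ : EuclideanSpace ℝ (Fin m)} {D : ℝ} (hD : 0 ≤ D)
    (h : ∫⁻ x, ‖x - θ‖ₑ ^ 4 ∂μ ≤ ENNReal.ofReal D) :
    Integrable (fun x => ‖x - θ‖ ^ 4) μ ∧ ∫ x, ‖x - θ‖ ^ 4 ∂μ ≤ D := by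
  have e : ∫⁻ x, ‖x - θ‖ₑ ^ 4 ∂μ = ∫⁻ x, ENNReal.ofReal (‖x - θ‖ ^ 4) ∂μ :=
    lintegral_congr fun x => by rw [ENNReal.ofReal_pow (norm_nonneg _), ofReal_norm]
  rw [e] at h
  have hm : AEStronglyMeasurable (fun x => ‖x - θ‖ ^ 4) μ := by fun_prop
  refine ⟨⟨hm, ?_⟩, ?_⟩
  · rw [hasFiniteIntegral_iff_ofReal (.of_forall fun x => by positivity)]
    exact h.trans_lt (by simp)
  · rw [integral_eq_lintegral_of_nonneg_ae (.of_forall fun x => by positivity) hm]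
    exact ENNReal.toReal_le_of_le_ofReal hD h

/-- A fourth moment of order `n⁻²` gives a second moment of order `n⁻¹`, by `t ^ 2 ≤ n * t ^ 4 + 1 /
n`. -/
theorem integral_norm_sq_le {μ : Measure (EuclideanSpace ℝ (Fin m))} [IsProbabilityMeasure μ]
    (hμ : MemLp (fun x => x) 2 μ)
    {θ : EuclideanSpace ℝ (Fin m)} {D : ℝ} (hD : 0 ≤ D) {n : ℕ} (hn : 1 ≤ n)
    (h : ∫⁻ x, ‖x - θ‖ₑ ^ 4 ∂μ ≤ ENNReal.ofReal (D / n ^ 2)) :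
    ∫ x, ‖x - θ‖ ^ 2 ∂μ ≤ (D + 1) / n := by
  obtain ⟨h1, h2⟩ := integral_norm_pow_four_le (by positivity) h
  have hn' : (0 : ℝ) < n := by exact_mod_cast hn
  have h3 : Integrable (fun x => ‖x - θ‖ ^ 2) μ :=
    (hμ.sub (memLp_const θ)).integrable_norm_pow two_ne_zero
  calc ∫ x, ‖x - θ‖ ^ 2 ∂μ ≤ ∫ x, (n * ‖x - θ‖ ^ 4 + 1 / n) ∂μ := by
        refine integral_mono h3 ((h1.const_mul _).add (integrable_const _)) fun x => ?_
        have : 0 ≤ (n * ‖x - θ‖ ^ 2 - 1) ^ 2 + n * ‖x - θ‖ ^ 2 := by positivity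
        change ‖x - θ‖ ^ 2 ≤ n * ‖x - θ‖ ^ 4 + 1 / n
        rw [← mul_le_mul_iff_right₀ hn']
        field_simp
        nlinarith
    _ = n * ∫ x, ‖x - θ‖ ^ 4 ∂μ + 1 / n := by
        rw [integral_add (h1.const_mul _) (integrable_const _), integral_const_mul]; simp
    _ ≤ n * (D / n ^ 2) + 1 / n := by gcongr
    _ = _ := by field_simp

variable {ι H : Type*} [NormedAddCommGroup H] [InnerProductSpace ℂ H] [CompleteSpace H]
  {b : HilbertBasis ι ℂ H} {ρ : EuclideanSpace ℝ (Fin m) → H →L[ℂ] H}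
  {Θ : Set (EuclideanSpace ℝ (Fin m))} {θ : EuclideanSpace ℝ (Fin m)}

theorem CondM3.exists_estimators (h3 : CondM3 b ρ Θ) : ∃ T : ∀ n, Estimator ι n m,
    AsympUnbiased b ρ Θ T ∧ (∀ n ≥ 1, CondE b ρ Θ (T n)) ∧ ∀ θ ∈ Θ, ∃ D : ℝ, 0 ≤ D ∧
      ∀ n : ℕ, 1 ≤ n → ∫⁻ x, ‖x - θ‖ₑ ^ 4 ∂((T n).dist b (ρ θ)) ≤ ENNReal.ofReal (D / n ^ 2) := by
  obtain ⟨l, M, M', T, hT, -, hu, hE, hD⟩ := h3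
  refine ⟨fun n => ⟨n * l, M' n, T n, hT n⟩, hu, hE, fun θ hθ => ?_⟩
  obtain ⟨D, hD⟩ := hD θ hθ
  refine ⟨|D|, abs_nonneg D, fun n hn => ?_⟩
  refine le_trans (le_of_eq ?_) ((hD n hn).trans (ENNReal.ofReal_le_ofReal (by
    gcongr; exact le_abs_self D)))
  exact lintegral_map (by fun_prop) (hT n)

theorem Estimator.mse_eq_cov_add (hρ : ∀ θ ∈ Θ, IsDensity b (ρ θ)) (hθ : θ ∈ Θ) {n : ℕ}
    {E : Estimator ι n m} (hE : E.HasMoments b ρ Θ) (c : EuclideanSpace ℝ (Fin m)) :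
    E.mse b (ρ θ) c = E.cov b (ρ θ) +
      Matrix.of fun i j => (E.mean b (ρ θ) i - c i) * (E.mean b (ρ θ) j - c j) := by
  have := E.isProbabilityMeasure_dist b (hρ θ hθ)
  rw [Estimator.mse_eq_dist, mse_eq (hE θ hθ) c, Estimator.cov_eq]
  simp only [Estimator.mean_eq]

/-- The mean square error exceeds the covariance by the rank one matrix of the bias, and pairings of
`G` with second moment matrices are nonnegative. -/
theorem Estimator.trace_mse (hρ : ∀ θ ∈ Θ, IsDensity b (ρ θ)) (hθ : θ ∈ Θ)
    {G : Matrix (Fin m) (Fin m) ℝ} (hG : G.PosSemidef) {n : ℕ}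
    {E : Estimator ι n m} (hE : E.HasMoments b ρ Θ) :
    (G * E.cov b (ρ θ)).trace ≤ (G * E.mse b (ρ θ) θ).trace ∧
      0 ≤ (G * E.mse b (ρ θ) θ).trace := by
  have := E.isProbabilityMeasure_dist b (hρ θ hθ)
  constructor
  · rw [E.mse_eq_cov_add hρ hθ hE θ, mul_add, Matrix.trace_add, le_add_iff_nonneg_right]
    let v : Fin m → ℝ := fun i => E.mean b (ρ θ) i - θ i
    have h : 0 ≤ ∑ i, ∑ j, G i j * (v j * v i) := PosSemidef.sum_nonneg hG v
    simpa only [Matrix.trace, Matrix.diag_apply, Matrix.mul_apply, Matrix.of_apply] using h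
  · rw [Estimator.mse_eq_dist]
    exact trace_mul_nonneg_of_moment hG (u := fun i (x : EuclideanSpace ℝ (Fin m)) => x i - θ i) fun i =>
      (memLp_coord (hE θ hθ) i).sub (memLp_const _)

variable (hΘ : IsOpen Θ) (hρ : ∀ θ ∈ Θ, IsDensity b (ρ θ)) (h1 : CondM1 b ρ Θ) (hθ : θ ∈ Θ)
include hΘ hρ h1 hθ

/-- Estimators with finitely many values that are almost locally unbiased, and have variance of
order `1/k`. -/
theorem exists_correction (h3 : CondM3 b ρ Θ) : ∃ V : ∀ k, Estimator ι k m, (∀ k, (V k).IsFinite) ∧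
    Tendsto (fun k => (V k).dMat b ρ θ) atTop (𝓝 1) ∧
    ∃ C : ℝ, ∀ k ≥ 1, ∀ i j, |(V k).cov b (ρ θ) i j| ≤ C / k := by
  obtain ⟨T, hu, hE, hD⟩ := h3.exists_estimators
  obtain ⟨D, hD0, hD⟩ := hD θ hθ
  obtain ⟨-, B, hB, hB1⟩ := hu θ hθ
  have hT : ∀ k ≥ 1, (T k).Tame b ρ θ := fun k hk =>
    Estimator.Tame.of_condE hΘ hρ h1 hθ (hE k hk)
  -- A finitely valued approximation is chosen within `1/k` of the preliminary estimator in both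
  -- derivative matrix and covariance. The second moment bound `(D + 1) / k` thereby becomes the
  -- covariance bound `(D + 2) / k`.
  have hex : ∀ k, ∃ j, 1 ≤ k → (∀ i l, |((T k).approx j).dMat b ρ θ i l - B k i l| ≤ 1 / k) ∧
      ∀ i l, |((T k).approx j).cov b (ρ θ) i l - (T k).cov b (ρ θ) i l| ≤ 1 / k := by
    intro k
    by_cases hk : 1 ≤ k
    · have hk0 : (0 : ℝ) < 1 / k := by positivity
      have e : (T k).dMat b ρ θ = B k := ((hT k hk).hasBMatrix hΘ hρ h1 hθ).unique (hB k hk)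
      have t1 := (hT k hk).tendsto_dMat hΘ hρ h1 hθ
      have t2 := (hT k hk).tendsto_cov hΘ hρ h1 hθ
      rw [e] at t1
      have key : ∀ {M : ℕ → Matrix (Fin m) (Fin m) ℝ} {M₀ : Matrix (Fin m) (Fin m) ℝ},
          Tendsto M atTop (𝓝 M₀) → ∀ᶠ j in atTop, ∀ i l, |M j i l - M₀ i l| ≤ 1 / k := by
        intro M M₀ ht
        refine eventually_all.2 fun i => eventually_all.2 fun l => ?_
        have := (((tendsto_pi_nhds.1 (tendsto_pi_nhds.1 ht i) l)).sub_const (M₀ i l)).abs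
        rw [sub_self, abs_zero] at this
        exact (this.eventually_lt_const hk0).mono fun _ h => h.le
      obtain ⟨j, h1, h2⟩ := ((key t1).and (key t2)).exists
      exact ⟨j, fun _ => ⟨h1, h2⟩⟩
    · exact ⟨0, fun h => absurd h hk⟩
  choose j hj using hex
  refine ⟨fun k => (T k).approx (j k), fun k => (T k).isFinite_approx _, ?_, D + 2, ?_⟩
  · refine tendsto_pi_nhds.2 fun i => tendsto_pi_nhds.2 fun l => ?_
    have t1 := tendsto_pi_nhds.1 (tendsto_pi_nhds.1 hB1 i) l
    have t2 : Tendsto (fun k => ((T k).approx (j k)).dMat b ρ θ i l - B k i l) atTop (𝓝 0) := by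
      refine squeeze_zero_norm' ?_ (tendsto_one_div_atTop_nhds_zero_nat (𝕜 := ℝ))
      filter_upwards [eventually_ge_atTop 1] with k hk
      exact (hj k hk).1 i l
    simpa using t2.add t1
  · intro k hk i l
    have := (T k).isProbabilityMeasure_dist b (hρ θ hθ)
    have c1 := (hj k hk).2 i l
    have c2 := (covM_abs_le (hT k hk).memLp θ i l).trans
      (integral_norm_sq_le (hT k hk).memLp hD0 hk (hD k hk))
    rw [← Estimator.cov_eq] at c2
    have e : (D + 2) / k = 1 / k + (D + 1) / (k : ℝ) := by ring
    rw [e]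
    calc _ = |(((T k).approx (j k)).cov b (ρ θ) i l - (T k).cov b (ρ θ) i l) +
          (T k).cov b (ρ θ) i l| := by rw [sub_add_cancel]
      _ ≤ _ := (abs_add_le _ _).trans (add_le_add c1 c2)

/-- The bias of an estimator at `θ` can be corrected using `k` additional copies. -/
theorem localBound_le_of_correction (G : Matrix (Fin m) (Fin m) ℝ) {n n' k : ℕ} (hn : n' + k = n)
    (hn' : 1 ≤ n') {E : Estimator ι n' m} (hE : CondE b ρ Θ E) {B : Matrix (Fin m) (Fin m) ℝ}
    (hB : HasBMatrix b ρ E θ B) {V : Estimator ι k m} (hV : V.IsFinite)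
    (hinv : ((V.dMat b ρ θ)⁻¹) * V.dMat b ρ θ = 1) :
    localBound b ρ G θ n (CondE b ρ Θ) ≤ ((n * ((G * E.cov b (ρ θ)).trace +
      (G * (((1 - B) * (V.dMat b ρ θ)⁻¹) * V.cov b (ρ θ) *
        ((1 - B) * (V.dMat b ρ θ)⁻¹).transpose)).trace) : ℝ) : EReal) := by
  subst hn
  -- With this matrix `B + A * V.dMat b ρ θ = 1`; the constant `c` corrects the mean at `θ`.
  set A := (1 - B) * (V.dMat b ρ θ)⁻¹ with hA
  let c : EuclideanSpace ℝ (Fin m) :=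
    WithLp.toLp 2 fun i => θ i - E.mean b (ρ θ) i - ∑ j, A i j * V.mean b (ρ θ) j
  have hEm := Estimator.HasMoments.of_condE hΘ hρ h1 hE
  have hVm := hV.hasMoments hΘ hρ h1
  have hF : (V.aff A c).IsFinite := hV.comp _ _
  have hFm := hF.hasMoments hΘ hρ h1
  have hcov := Estimator.cov_add (hρ θ hθ) hF (hEm θ hθ) (hFm θ hθ)
  rw [Estimator.cov_aff (hρ θ hθ) (hVm θ hθ)] at hcov
  rw [← Matrix.trace_add, ← mul_add, ← hcov]
  refine iInf₂_le_of_le (E.add (V.aff A c) hF) ⟨fun i => ?_, ?_⟩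
    (iInf_le_of_le (hE.add hρ hn' _ _) le_rfl)
  · rw [Estimator.mean_add (hρ θ hθ) hF (hEm θ hθ) (hFm θ hθ),
      Estimator.mean_aff (hρ θ hθ) (hVm θ hθ)]
    simp [c]
  · have := HasBMatrix.add hΘ hρ hθ hF hEm hFm hB
      (HasBMatrix.aff hΘ hρ hθ hVm (hV.hasBMatrix hΘ hρ h1 hθ) A c)
    have e : B + A * V.dMat b ρ θ = 1 := by rw [hA, mul_assoc, hinv, mul_one, add_sub_cancel]
    rwa [e] at this

/-- Of `n` copies, `n / q` serve to remove the bias of the estimator on the other `n - n / q`. The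
correction matrices tend to zero, so the cost of the removal is negligible, and the copies withdrawn
cost a factor of at most `q / (q - 1)`. -/
theorem limsup_localBound_le (h3 : CondM3 b ρ Θ) {G : Matrix (Fin m) (Fin m) ℝ}
    (hG : G.PosSemidef) {E : ∀ n, Estimator ι n m} (hu : AsympUnbiased b ρ Θ E)
    (hE : ∀ n ≥ 1, CondE b ρ Θ (E n)) :
    limsup (fun n => localBound b ρ G θ n (CondE b ρ Θ)) atTop ≤
      limsup (fun n : ℕ => ((n * (G * (E n).mse b (ρ θ) θ).trace : ℝ) : EReal)) atTop := by
  obtain ⟨V, hV, hV1, C, hVC⟩ := exists_correction hΘ hρ h1 hθ h3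
  obtain ⟨-, B, hB, hB1⟩ := hu θ hθ
  obtain ⟨hI, hinv⟩ := tendsto_matrix_inv hV1
  refine le_of_forall_gt_imp_ge_of_dense fun c hc => ?_
  obtain ⟨x, hLx, hxc⟩ := EReal.lt_iff_exists_real_btwn.1 hc
  obtain ⟨y, hLy, hyx⟩ := EReal.lt_iff_exists_real_btwn.1 hLx
  have hyx' : y < x := by exact_mod_cast hyx
  have hy := eventually_lt_of_limsup_lt hLy
  have hmom : ∀ n ≥ 1, (E n).HasMoments b ρ Θ := fun n hn =>
    Estimator.HasMoments.of_condE hΘ hρ h1 (hE n hn)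
  -- The bound `x / (x - y)` makes `q * y / (q - 1) < x`, so the loss of copies fits between `y` and
  -- `x`; the bound 2 keeps `n / q` below `n - n / q`.
  obtain ⟨q, hq⟩ := exists_nat_gt (max 2 (x / (x - y)))
  have hq2 : 2 < q := by exact_mod_cast (le_max_left _ _).trans_lt hq
  have hqx : x < (x - y) * q := by
    have := (le_max_right _ _).trans_lt hq
    rwa [div_lt_iff₀ (sub_pos.2 hyx'), mul_comm] at this
  have hq1 : (0 : ℝ) < q - 1 := by
    have : (2 : ℝ) < q := by exact_mod_cast hq2
    linarith
  have tk : Tendsto (fun n : ℕ => n / q) atTop atTop := Nat.tendsto_div_const_atTop (by omega)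
  have tn : Tendsto (fun n : ℕ => n - n / q) atTop atTop := by
    refine tendsto_atTop_mono (fun n => ?_) tk
    have h2 : n / q * 2 ≤ n := (Nat.mul_le_mul_left _ hq2.le).trans (Nat.div_mul_le_self n q)
    omega
  set A : ℕ → Matrix (Fin m) (Fin m) ℝ := fun n =>
    (1 - B (n - n / q)) * ((V (n / q)).dMat b ρ θ)⁻¹ with hAdef
  have hA : Tendsto A atTop (𝓝 0) := by
    have := ((tendsto_const_nhds (x := (1 : Matrix (Fin m) (Fin m) ℝ))).sub (hB1.comp tn)).mul
      (hI.comp tk)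
    simpa [Function.comp_def] using this
  -- The covariance of `V (n / q)` is at most `C` divided by `n / q`, and `n ≤ 2 * q * (n / q)` once
  -- the integer quotient is positive; multiplied by `n` it stays bounded.
  have hW : ∀ᶠ n : ℕ in atTop, ∀ i j, |((n : ℝ) • (V (n / q)).cov b (ρ θ)) i j| ≤ 2 * q * |C| := by
    filter_upwards [tk.eventually_ge_atTop 1] with n hn i j
    have hk : (0 : ℝ) < (n / q : ℕ) := by exact_mod_cast hn
    have h2 : n ≤ 2 * q * (n / q) := by
      have := Nat.lt_mul_div_succ n (show 0 < q by omega)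
      nlinarith
    have h2' : (n : ℝ) ≤ 2 * q * (n / q : ℕ) := by exact_mod_cast h2
    rw [Matrix.smul_apply, smul_eq_mul, abs_mul, Nat.abs_cast]
    calc (n : ℝ) * |(V (n / q)).cov b (ρ θ) i j| ≤ (2 * q * (n / q : ℕ)) * (|C| / (n / q : ℕ)) := by
          gcongr
          refine (hVC _ hn i j).trans ?_
          gcongr
          exact le_abs_self C
      _ = _ := by field_simp
  have herr : Tendsto (fun n : ℕ => (n : ℝ) * (G * (A n * (V (n / q)).cov b (ρ θ) *
      (A n).transpose)).trace) atTop (𝓝 0) := by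
    have h := tendsto_sandwich hA hW
    have hc : Continuous fun M : Matrix (Fin m) (Fin m) ℝ => (G * M).trace := by fun_prop
    have := (hc.tendsto 0).comp h
    simp only [mul_zero, Matrix.trace_zero] at this
    refine this.congr fun n => ?_
    simp [Matrix.trace_smul]
  have hy' : q * y / (q - 1) < x := by
    rw [div_lt_iff₀ hq1]; linarith
  refine limsup_le_of_le (by isBoundedDefault) ?_
  filter_upwards [tn.eventually hy, tk.eventually_ge_atTop 1, tn.eventually_ge_atTop 1,
    tk.eventually hinv, herr.eventually_lt_const (sub_pos.2 hy')] with n hn hk hp hi he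
  have hpk : n - n / q + n / q = n := Nat.sub_add_cancel (Nat.div_le_self n q)
  refine (localBound_le_of_correction hΘ hρ h1 hθ G hpk hp (hE _ hp) (hB _ hp) (hV (n / q)) hi).trans
    (le_trans ?_ hxc.le)
  rw [EReal.coe_le_coe_iff, mul_add]
  set t := (G * (E (n - n / q)).mse b (ρ θ) θ).trace with ht
  obtain ⟨t1, t0⟩ := (E (n - n / q)).trace_mse hρ hθ hG (hmom _ hp)
  have hn' : ((n - n / q : ℕ) : ℝ) * t < y := by exact_mod_cast hn
  have hcast : (n : ℝ) * (q - 1) ≤ q * (n - n / q : ℕ) := by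
    rw [Nat.cast_sub (Nat.div_le_self n q)]
    have : ((n / q : ℕ) : ℝ) * q ≤ n := by exact_mod_cast Nat.div_mul_le_self n q
    linarith
  have h5 : (n : ℝ) * t ≤ q * y / (q - 1) := by
    rw [le_div_iff₀ hq1]
    calc (n : ℝ) * t * (q - 1) = (n * (q - 1)) * t := by ring
      _ ≤ (q * (n - n / q : ℕ)) * t := by gcongr
      _ = q * ((n - n / q : ℕ) * t) := by ring
      _ ≤ q * y := by gcongr
  have h6 : (n : ℝ) * (G * (E (n - n / q)).cov b (ρ θ)).trace ≤ n * t := by gcongr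
  have h7 : (n : ℝ) * (G * (A n * (V (n / q)).cov b (ρ θ) * (A n).transpose)).trace <
    x - q * y / (q - 1) := he
  linarith

end Upper

/-! ### Residuals of preliminary estimates -/

section Lower

variable {ι H : Type*} [NormedAddCommGroup H] [InnerProductSpace ℂ H] [CompleteSpace H]
  {b : HilbertBasis ι ℂ H} {m : ℕ} {ρ : EuclideanSpace ℝ (Fin m) → H →L[ℂ] H}
  {Θ : Set (EuclideanSpace ℝ (Fin m))} {θ : EuclideanSpace ℝ (Fin m)}
  (hΘ : IsOpen Θ) (hρ : ∀ θ ∈ Θ, IsDensity b (ρ θ)) (h1 : CondM1 b ρ Θ)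
include hΘ hρ h1

/-- Adding the estimates from `r` further groups of copies. -/
theorem exists_add_copies {k N : ℕ} (hk : 1 ≤ k) {E : Estimator ι k m} (hE : CondE b ρ Θ E)
    {S : Estimator ι N m} (hS : S.IsFinite) (r : ℕ) : ∀ n, n = k + N * r →
      ∃ F : Estimator ι n m, CondE b ρ Θ F ∧ ∀ x ∈ Θ,
        (∀ i, F.mean b (ρ x) i = E.mean b (ρ x) i + r * S.mean b (ρ x) i) ∧
        F.cov b (ρ x) = E.cov b (ρ x) + (r : ℝ) • S.cov b (ρ x) := by
  induction r with
  | zero =>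
    rintro n rfl
    exact ⟨E, hE, fun x _ => by simp⟩
  | succ r ih =>
    intro n hn
    obtain ⟨F, hF, h⟩ := ih _ rfl
    -- The number of copies is part of the type of the estimator. Keeping it as a variable with an
    -- equation allows a substitution here in place of a transport.
    have hn' : n = k + N * r + N := by rw [hn]; ring
    subst hn'
    refine ⟨F.add S hS, hF.add hρ (by omega) S hS, fun x hx => ⟨fun i => ?_, ?_⟩⟩
    · rw [Estimator.mean_add (hρ x hx) hS (Estimator.HasMoments.of_condE hΘ hρ h1 hF x hx)
        (hS.hasMoments hΘ hρ h1 x hx), (h x hx).1]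
      push_cast
      ring
    · rw [Estimator.cov_add (hρ x hx) hS (Estimator.HasMoments.of_condE hΘ hρ h1 hF x hx)
        (hS.hasMoments hΘ hρ h1 x hx), (h x hx).2]
      push_cast
      rw [add_smul, one_smul, add_assoc]

/-- Adding the average of the estimates from `r` further groups of copies. -/
theorem exists_add_average {k N : ℕ} (hk : 1 ≤ k) {E : Estimator ι k m} (hE : CondE b ρ Θ E)
    {S : Estimator ι N m} (hS : S.IsFinite) {r : ℕ} (hr : 1 ≤ r) {n : ℕ} (hn : n = k + N * r) :
      ∃ F : Estimator ι n m, CondE b ρ Θ F ∧ ∀ x ∈ Θ,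
        (∀ i, F.mean b (ρ x) i = E.mean b (ρ x) i + S.mean b (ρ x) i) ∧
        F.cov b (ρ x) = E.cov b (ρ x) + (r : ℝ)⁻¹ • S.cov b (ρ x) := by
  have hr' : (r : ℝ) ≠ 0 := by exact_mod_cast (by omega : r ≠ 0)
  -- Each of the `r` estimates is scaled by `r⁻¹`, so the covariances add up to `r * r⁻² = r⁻¹`
  -- times that of `S`.
  obtain ⟨F, hF, h⟩ := exists_add_copies hΘ hρ h1 hk hE
    (hS.comp _ (measurable_affMap ((r : ℝ)⁻¹ • 1) 0)) r n hn
  refine ⟨F, hF, fun x hx => ⟨fun i => ?_, ?_⟩⟩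
  · rw [(h x hx).1, Estimator.mean_aff (hρ x hx) (hS.hasMoments hΘ hρ h1 x hx)]
    simp [Matrix.one_apply, hr']
  · rw [(h x hx).2, Estimator.cov_aff (hρ x hx) (hS.hasMoments hΘ hρ h1 x hx)]
    simp [smul_smul, hr']

/-- Subtracting from the preliminary estimate the value there of the mean of `S`. -/
def Estimator.residual (b : HilbertBasis ι ℂ H) (ρ : EuclideanSpace ℝ (Fin m) → H →L[ℂ] H)
    (Θ : Set (EuclideanSpace ℝ (Fin m))) {k N : ℕ} (T : Estimator ι k m) (S : Estimator ι N m)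
    (hf : Measurable (S.meanFun b ρ Θ)) : Estimator ι k m :=
  T.comp (fun x => x - S.meanFun b ρ Θ x) (measurable_id.sub hf)

omit hΘ h1 in
-- The preliminary estimate is displaced by the mean function of `S`, whose coordinates are bounded
-- by `K` and whose norm is therefore at most `√(m * K ^ 2)`.
theorem CondE.residual {k N : ℕ} (hk : 1 ≤ k) {T : Estimator ι k m} (hT : CondE b ρ Θ T)
    {S : Estimator ι N m} (hS : S.IsFinite) (hf : Measurable (S.meanFun b ρ Θ)) :
    CondE b ρ Θ (T.residual b ρ Θ S hf) := by
  obtain ⟨K, hK⟩ := hS.bounded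
  refine CondE.comp hρ hk hT _ (measurable_id.sub hf) (K := NNReal.sqrt (m * K ^ 2)) fun x => ?_
  change ‖x - S.meanFun b ρ Θ x - x‖ ≤ _
  rw [sub_sub_cancel_left, norm_neg, EuclideanSpace.norm_eq, Real.coe_sqrt]
  refine Real.sqrt_le_sqrt ?_
  calc ∑ i, ‖S.meanFun b ρ Θ x i‖ ^ 2 ≤ ∑ _i : Fin m, (K : ℝ) ^ 2 :=
        Finset.sum_le_sum fun i _ => pow_le_pow_left₀ (norm_nonneg _)
          (S.abs_meanFun_le hρ K.coe_nonneg hK x i) 2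
    _ = _ := by simp

/-- The remainder of the first order expansion of the mean of `S`. -/
def Estimator.remainder (b : HilbertBasis ι ℂ H) (ρ : EuclideanSpace ℝ (Fin m) → H →L[ℂ] H)
    (Θ : Set (EuclideanSpace ℝ (Fin m))) {N : ℕ} (S : Estimator ι N m)
    (θ : EuclideanSpace ℝ (Fin m)) (B : Matrix (Fin m) (Fin m) ℝ) (i : Fin m)
    (x : EuclideanSpace ℝ (Fin m)) : ℝ :=
  S.meanFun b ρ Θ x i - S.mean b (ρ θ) i - ∑ j, B i j * (x j - θ j)

omit hΘ hρ h1 in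
theorem Estimator.measurable_remainder {N : ℕ} {S : Estimator ι N m}
    (hf : Measurable (S.meanFun b ρ Θ)) (B : Matrix (Fin m) (Fin m) ℝ) (i : Fin m) :
    Measurable (S.remainder b ρ Θ θ B i) := by
  have : Measurable fun x => S.meanFun b ρ Θ x i :=
    (show Measurable fun x : EuclideanSpace ℝ (Fin m) => x i by fun_prop).comp hf
  unfold Estimator.remainder
  fun_prop

omit hΘ h1 in
-- The mean function is bounded and the subtracted part is affine. Linear growth is what
-- integrability and differentiation of the expectation require; the quadratic bound is for size
-- only.
theorem Estimator.abs_remainder_le {N : ℕ} {S : Estimator ι N m} (hS : S.IsFinite) (hθ : θ ∈ Θ)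
    (B : Matrix (Fin m) (Fin m) ℝ) (i : Fin m) : ∃ a c : ℝ, ∀ x,
      |S.remainder b ρ Θ θ B i x| ≤ a + c * ‖x‖ := by
  obtain ⟨K, hK⟩ := hS.bounded
  refine ⟨K + K + ∑ j, |B i j| * ‖θ‖, ∑ j, |B i j|, fun x => ?_⟩
  have g1 := S.abs_meanFun_le hρ K.coe_nonneg hK x i
  have g2 := S.abs_meanFun_le hρ K.coe_nonneg hK θ i
  rw [S.meanFun_apply hθ] at g2
  have g3 : |∑ j, B i j * (x j - θ j)| ≤ (∑ j, |B i j|) * ‖x‖ + ∑ j, |B i j| * ‖θ‖ := by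
    rw [Finset.sum_mul, ← Finset.sum_add_distrib]
    refine (Finset.abs_sum_le_sum_abs _ _).trans (Finset.sum_le_sum fun j _ => ?_)
    rw [abs_mul, ← mul_add]
    gcongr
    exact (abs_sub _ _).trans (add_le_add (coord_abs_le x j) (coord_abs_le θ j))
  calc |S.remainder b ρ Θ θ B i x| ≤ |S.meanFun b ρ Θ x i| + |S.mean b (ρ θ) i| +
        |∑ j, B i j * (x j - θ j)| :=
        (abs_sub _ _).trans (add_le_add (abs_sub _ _) le_rfl)
    _ ≤ _ := by linarith

omit hΘ hρ h1 in
theorem memLp_of_growth {μ : Measure (EuclideanSpace ℝ (Fin m))} [IsProbabilityMeasure μ]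
    (hμ : MemLp (fun x => x) 2 μ) {φ : EuclideanSpace ℝ (Fin m) → ℝ} (hφ : Measurable φ)
    {a c : ℝ} (h : ∀ x, |φ x| ≤ a + c * ‖x‖) : MemLp φ 2 μ := by
  have h2 : MemLp (fun x => a + c * ‖x‖) 2 μ := (memLp_const a).add (hμ.norm.const_mul c)
  exact h2.of_le hφ.aestronglyMeasurable (.of_forall fun x => (h x).trans (le_abs_self _))

omit h1 in
/-- The means of the residual in terms of the remainder at `θ`. -/
theorem Estimator.mean_residual {k N : ℕ} {T : Estimator ι k m} (hT : T.HasMoments b ρ Θ)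
    {S : Estimator ι N m} (hS : S.IsFinite) (hf : Measurable (S.meanFun b ρ Θ)) (hθ : θ ∈ Θ)
    (B : Matrix (Fin m) (Fin m) ℝ) {x : EuclideanSpace ℝ (Fin m)} (hx : x ∈ Θ) (i : Fin m) :
    (T.residual b ρ Θ S hf).mean b (ρ x) i = T.mean b (ρ x) i - S.mean b (ρ θ) i -
      ∑ j, B i j * (T.mean b (ρ x) j - θ j) -
      ∫ y, S.remainder b ρ Θ θ B i y ∂(T.dist b (ρ x)) := by
  have := T.isProbabilityMeasure_dist b (hρ x hx)
  obtain ⟨a, c, hac⟩ := Estimator.abs_remainder_le hρ hS hθ B i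
  have hR := (memLp_of_growth (hT x hx) (S.measurable_remainder hf B i) hac).integrable one_le_two
  have hc : ∀ j, Integrable (fun y : EuclideanSpace ℝ (Fin m) => y j) (T.dist b (ρ x)) := fun j =>
    (memLp_coord (hT x hx) j).integrable one_le_two
  have hm : Measurable fun y : EuclideanSpace ℝ (Fin m) => y - S.meanFun b ρ Θ y :=
    measurable_id.sub hf
  simp only [Estimator.mean_eq b T]
  rw [Estimator.mean_eq, Estimator.residual, Estimator.comp_dist,
    integral_map hm.aemeasurable (by fun_prop)]
  have e : ∀ y : EuclideanSpace ℝ (Fin m), (y - S.meanFun b ρ Θ y) i = y i - S.mean b (ρ θ) i -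
      ∑ j, B i j * (y j - θ j) - S.remainder b ρ Θ θ B i y := fun y => by
    simp only [Estimator.remainder, PiLp.sub_apply]
    ring
  have hs : ∀ j, Integrable (fun y : EuclideanSpace ℝ (Fin m) => B i j * (y j - θ j))
      (T.dist b (ρ x)) := fun j => ((hc j).sub (integrable_const _)).const_mul _
  have h1 : Integrable (fun y : EuclideanSpace ℝ (Fin m) => y i - S.mean b (ρ θ) i)
      (T.dist b (ρ x)) := (hc i).sub (integrable_const _)
  have h2 : Integrable (fun y : EuclideanSpace ℝ (Fin m) => ∑ j, B i j * (y j - θ j))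
      (T.dist b (ρ x)) := integrable_finsetSum _ fun j _ => hs j
  have h12 : Integrable (fun y : EuclideanSpace ℝ (Fin m) => y i - S.mean b (ρ θ) i -
      ∑ j, B i j * (y j - θ j)) (T.dist b (ρ x)) := h1.sub h2
  rw [integral_congr_ae (.of_forall e), integral_sub h12 hR, integral_sub h1 h2,
    integral_sub (hc i) (integrable_const _), integral_finsetSum _ fun j _ => hs j]
  simp only [integral_const_mul]
  simp_rw [fun j => integral_sub (hc j) (integrable_const (θ j))]
  simp

variable (h2 : CondM2 b ρ Θ) {T : ∀ n, Estimator ι n m} (hu : AsympUnbiased b ρ Θ T)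
  (hT : ∀ n ≥ 1, CondE b ρ Θ (T n))
  (hD : ∀ θ ∈ Θ, ∃ D : ℝ, 0 ≤ D ∧ ∀ n : ℕ, 1 ≤ n →
    ∫⁻ x, ‖x - θ‖ₑ ^ 4 ∂((T n).dist b (ρ θ)) ≤ ENNReal.ofReal (D / n ^ 2))
  {N : ℕ} {S : Estimator ι N m} (hS : S.IsFinite) (hf : Measurable (S.meanFun b ρ Θ))
  (hθ : θ ∈ Θ)
include hT hD hS hθ

omit h1 hθ in
theorem integral_remainder_mul_le {B : Matrix (Fin m) (Fin m) ℝ} {C : ℝ} (hC0 : 0 ≤ C)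
    (hC : ∀ x i, |S.remainder b ρ Θ θ B i x| ≤ C * ‖x - θ‖ ^ 2) {D : ℝ} (hD0 : 0 ≤ D) {k : ℕ}
    {μ : Measure (EuclideanSpace ℝ (Fin m))} [IsProbabilityMeasure μ]
    (hDk : ∫⁻ x, ‖x - θ‖ₑ ^ 4 ∂μ ≤ ENNReal.ofReal (D / k ^ 2)) (i j : Fin m) :
    |∫ x, S.remainder b ρ Θ θ B i x * S.remainder b ρ Θ θ B j x ∂μ| ≤ C ^ 2 * D / k ^ 2 := by
  obtain ⟨i1, i2⟩ := integral_norm_pow_four_le (by positivity) hDk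
  have hle : ∀ x, ‖S.remainder b ρ Θ θ B i x * S.remainder b ρ Θ θ B j x‖ ≤
      C ^ 2 * ‖x - θ‖ ^ 4 := fun x => by
    rw [norm_mul]
    calc _ ≤ (C * ‖x - θ‖ ^ 2) * (C * ‖x - θ‖ ^ 2) :=
          mul_le_mul (hC x i) (hC x j) (abs_nonneg _) (by positivity)
      _ = _ := by ring
  refine (norm_integral_le_of_norm_le (i1.const_mul (C ^ 2)) (.of_forall hle)).trans ?_
  rw [integral_const_mul, mul_div_assoc]
  gcongr

include h2 hu in
/-- Asymptotic behaviour of the residual. -/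
theorem residual_asymptotics : ∃ B : Matrix (Fin m) (Fin m) ℝ, HasBMatrix b ρ S θ B ∧
    (∀ i, Tendsto (fun k => ((T k).residual b ρ Θ S hf).mean b (ρ θ) i + S.mean b (ρ θ) i) atTop
      (𝓝 (θ i))) ∧
    ∃ B₀ : ℕ → Matrix (Fin m) (Fin m) ℝ,
      (∀ k ≥ 1, HasBMatrix b ρ ((T k).residual b ρ Θ S hf) θ (B₀ k)) ∧
      Tendsto B₀ atTop (𝓝 (1 - B)) := by
  obtain ⟨K, hK⟩ := hS.bounded
  obtain ⟨B, hB, C, hC0, hC⟩ := Estimator.exists_expansion hΘ hρ h1 hθ hK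
  obtain ⟨D, hD0, hD⟩ := hD θ hθ
  obtain ⟨hm, Bt, hBt, hBt1⟩ := hu θ hθ
  have hmom : ∀ k ≥ 1, (T k).HasMoments b ρ Θ := fun k hk =>
    Estimator.HasMoments.of_condE hΘ hρ h1 (hT k hk)
  have htame : ∀ k ≥ 1, (T k).Tame b ρ θ := fun k hk =>
    Estimator.Tame.of_condE hΘ hρ h1 hθ (hT k hk)
  have hprob : ∀ k, IsProbabilityMeasure ((T k).dist b (ρ θ)) := fun k =>
    (T k).isProbabilityMeasure_dist b (hρ θ hθ)
  have tdiv : ∀ c : ℝ, Tendsto (fun k : ℕ => c / k) atTop (𝓝 0) := fun c =>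
    tendsto_const_div_atTop_nhds_zero_nat c
  -- The three terms of the derivative matrix belong to `T`, to the linear part of the mean function
  -- at `T`, and to the remainder; the first two tend to `1 - B`, and the third must be shown to
  -- vanish.
  refine ⟨B, hB, fun i => ?_, fun k => Bt k - B * Bt k -
    Matrix.of fun i l => (T k).dInt b ρ θ l (S.remainder b ρ Θ θ B i), fun k hk i l => ?_, ?_⟩
  · have t1 : Tendsto (fun k => ∫ y, S.remainder b ρ Θ θ B i y ∂((T k).dist b (ρ θ))) atTop
        (𝓝 0) := by
      refine squeeze_zero_norm' ?_ (tdiv (C * (D + 1)))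
      filter_upwards [eventually_ge_atTop 1] with k hk
      have h3 : Integrable (fun x => ‖x - θ‖ ^ 2) ((T k).dist b (ρ θ)) :=
        ((hmom k hk θ hθ).sub (memLp_const θ)).integrable_norm_pow two_ne_zero
      refine (norm_integral_le_of_norm_le (h3.const_mul C) (.of_forall fun x => hC x i)).trans ?_
      rw [integral_const_mul, mul_div_assoc]
      gcongr
      exact integral_norm_sq_le (hmom k hk θ hθ) hD0 hk (hD k hk)
    have t2 : Tendsto (fun k => ∑ j, B i j * ((T k).mean b (ρ θ) j - θ j)) atTop
        (𝓝 (∑ j, B i j * (θ j - θ j))) :=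
      tendsto_finsetSum _ fun j _ => ((hm j).sub_const _).const_mul _
    have t3 := ((hm i).sub t2).sub t1
    simp only [sub_self, mul_zero, Finset.sum_const_zero, sub_zero] at t3
    refine t3.congr' ?_
    filter_upwards [eventually_ge_atTop 1] with k hk
    rw [Estimator.mean_residual hΘ hρ (hmom k hk) hS hf hθ B hθ]
    ring
  · obtain ⟨a, c, hac⟩ := Estimator.abs_remainder_le hρ hS hθ B i
    have d1 := (htame k hk).hasDerivAt hΘ hρ h1 hθ (S.measurable_remainder hf B i) hac l
    have d2 := HasDerivAt.fun_sum fun j (_ : j ∈ Finset.univ) =>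
      ((hBt k hk j l).sub_const (θ j)).const_mul (B i j)
    have d3 := ((((hBt k hk i l).sub_const (S.mean b (ρ θ) i)).sub d2)).sub d1
    refine d3.congr_of_eventuallyEq ?_
    filter_upwards [eventually_shift_mem hΘ hθ l] with t ht
    exact Estimator.mean_residual hΘ hρ (hmom k hk) hS hf hθ B ht i
  · have t1 : Tendsto (fun k => Matrix.of fun i l =>
        (T k).dInt b ρ θ l (S.remainder b ρ Θ θ B i)) atTop
        (𝓝 (0 : Matrix (Fin m) (Fin m) ℝ)) := by
      refine tendsto_pi_nhds.2 fun i => tendsto_pi_nhds.2 fun l => ?_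
      obtain ⟨J, hJ⟩ := exists_fisher_bound hΘ hρ h1 hθ h2 l
      obtain ⟨a, c, hac⟩ := Estimator.abs_remainder_le hρ hS hθ B i
      have hR := S.measurable_remainder hf B i (θ := θ)
      -- The information inequality gives `k * J` times the second moment of the remainder, which is
      -- at most `C ^ 2 * D / k ^ 2` by the fourth moment bound; the product is of order `1/k`.
      have tsq : Tendsto (fun k => (T k).dInt b ρ θ l (S.remainder b ρ Θ θ B i) ^ 2) atTop
          (𝓝 0) := by
        refine squeeze_zero' (.of_forall fun k => sq_nonneg _) ?_ (tdiv (J * (C ^ 2 * D)))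
        filter_upwards [eventually_ge_atTop 1] with k hk
        have hk' : (0 : ℝ) < k := by exact_mod_cast hk
        have := isFiniteMeasure_dPos hΘ hρ h1 hθ (T k) l
        have := isFiniteMeasure_dNeg hΘ hρ h1 hθ (T k) l
        have f1 := hJ k (T k) _ hR (memLp_of_growth (hmom k hk θ hθ) hR hac)
          (integrable_of_growth hΘ hρ hθ inferInstance ((htame k hk).pos l) hR hac)
          (integrable_of_growth hΘ hρ hθ inferInstance ((htame k hk).neg l) hR hac)
        have f2 := (le_abs_self _).trans
          (integral_remainder_mul_le hΘ hρ hT ‹_› hS hC0 hC hD0 (hD k hk) i i)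
        simp only [← sq] at f2
        calc _ ≤ _ := f1
          _ ≤ k * J * (C ^ 2 * D / k ^ 2) := by gcongr
          _ = _ := by field_simp
      have := (tsq.sqrt).congr fun k => Real.sqrt_sq_eq_abs _
      rw [Real.sqrt_zero] at this
      exact (tendsto_zero_iff_abs_tendsto_zero _).2 this
    have := (hBt1.sub (hBt1.const_mul B)).sub t1
    simpa using this

/-- If `S` is locally unbiased at `θ`, the second moments of the residual at `θ` are of
order `k⁻²`. -/
theorem residual_moments (hLU : LocallyUnbiased b ρ S θ) : ∃ C : ℝ, ∀ k ≥ 1, ∀ i j,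
    |((T k).residual b ρ Θ S hf).mse b (ρ θ) 0 i j| ≤ C / k ^ 2 := by
  obtain ⟨K, hK⟩ := hS.bounded
  obtain ⟨B, hB, C, hC0, hC⟩ := Estimator.exists_expansion hΘ hρ h1 hθ hK
  obtain rfl : B = 1 := hB.unique hLU.2
  obtain ⟨D, hD0, hD⟩ := hD θ hθ
  refine ⟨C ^ 2 * D, fun k hk i j => ?_⟩
  have := (T k).isProbabilityMeasure_dist b (hρ θ hθ)
  have hm : Measurable fun y : EuclideanSpace ℝ (Fin m) => y - S.meanFun b ρ Θ y :=
    measurable_id.sub hf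
  rw [Estimator.mse_eq_dist, Matrix.of_apply, Estimator.residual, Estimator.comp_dist,
    integral_map hm.aemeasurable (by fun_prop)]
  refine le_trans (le_of_eq ?_)
    (integral_remainder_mul_le hΘ hρ hT ‹_› hS hC0 hC hD0 (hD k hk) i j)
  congr 1
  refine integral_congr_ae (.of_forall fun y => ?_)
  -- As `S` is locally unbiased, its mean function has value `θ` and derivative matrix 1 at `θ`, so
  -- `y` cancels from the linear part and the residual is minus the remainder.
  have e : ∀ i, S.remainder b ρ Θ θ 1 i y = -(y - S.meanFun b ρ Θ y) i := fun i => by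
    simp [Estimator.remainder, Matrix.one_apply, hLU.1 i]
  simp only [e, PiLp.zero_apply, sub_zero, neg_mul_neg]

end Lower

/-! ### The two inequalities and the limits -/

section Main

theorem tendsto_natCast_div {q N : ℕ} (hq : 1 ≤ q) (hN : 1 ≤ N) {s : ℕ} (hs : 1 ≤ s) :
    Tendsto (fun n : ℕ => (n : ℝ) * ((s * (n / (q * N)) : ℕ) : ℝ)⁻¹) atTop
      (𝓝 (q * N / s)) := by
  have hqN : (0 : ℝ) < q * N := by exact_mod_cast Nat.mul_pos hq hN
  have hs' : (0 : ℝ) < s := by exact_mod_cast hs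
  have h := tendsto_nat_floor_mul_div_atTop (R := ℝ) (a := (q * N : ℝ)⁻¹) (by positivity)
  have h' := (h.comp tendsto_natCast_atTop_atTop).inv₀ (by positivity)
  have := h'.mul_const ((s : ℝ)⁻¹)
  rw [inv_inv, ← div_eq_mul_inv] at this
  refine this.congr fun n => ?_
  have e : ⌊(q * N : ℝ)⁻¹ * n⌋₊ = n / (q * N) := by
    rw [inv_mul_eq_div, ← Nat.cast_mul, Nat.floor_div_eq_div]
  simp only [Function.comp_apply, e, inv_div]
  push_cast
  rw [mul_inv, div_eq_mul_inv]
  ring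

variable {ι H : Type*} [NormedAddCommGroup H] [InnerProductSpace ℂ H] [CompleteSpace H]
  {b : HilbertBasis ι ℂ H} {m : ℕ} {ρ : EuclideanSpace ℝ (Fin m) → H →L[ℂ] H}
  {Θ : Set (EuclideanSpace ℝ (Fin m))} {θ : EuclideanSpace ℝ (Fin m)}
  (hΘ : IsOpen Θ) (hρ : ∀ θ ∈ Θ, IsDensity b (ρ θ)) (h1 : CondM1 b ρ Θ)
  (h2 : CondM2 b ρ Θ) (h3 : CondM3 b ρ Θ) (hθ : θ ∈ Θ)
include hΘ hρ h1 h2 h3 hθ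

/-- From a preliminary estimate on few copies and repetitions of a locally unbiased `S` one obtains
an asymptotically unbiased sequence. -/
theorem exists_asympUnbiased {N : ℕ} (hN : 1 ≤ N) {S : Estimator ι N m} (hS : S.IsFinite)
    (hLU : LocallyUnbiased b ρ S θ) {q : ℕ} (hq : 2 ≤ q) :
    ∃ F : ∀ n, Estimator ι n m, AsympUnbiased b ρ Θ F ∧ (∀ n ≥ 1, CondE b ρ Θ (F n)) ∧
      Tendsto (fun n : ℕ => (n : ℝ) • (F n).mse b (ρ θ) θ) atTop
        (𝓝 ((q * N / (q - 1 : ℕ) : ℝ) • S.cov b (ρ θ))) := by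
  obtain ⟨T, hu, hT, hD⟩ := h3.exists_estimators
  obtain ⟨K, hK⟩ := hS.bounded
  have hf := S.measurable_meanFun hΘ hρ h1 hK
  -- The copies form `n / (q * N)` blocks of `q * N`. In each block `q - 1` groups of `N` go to `S`,
  -- and the preliminary estimate gets the rest, that is `k n` copies with `n ≤ q * k n`.
  set r : ℕ → ℕ := fun n => (q - 1) * (n / (q * N)) with hr
  have hqN : 0 < q * N := by positivity
  have hNr : ∀ n, q * (N * r n) ≤ (q - 1) * n := fun n => by
    have := Nat.mul_div_le n (q * N)
    calc q * (N * r n) = (q - 1) * (q * N * (n / (q * N))) := by simp only [hr]; ring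
      _ ≤ _ := Nat.mul_le_mul_left _ this
  have hle : ∀ n, N * r n ≤ n := fun n => by
    have h4 := hNr n
    have h5 : (q - 1) * n ≤ q * n := Nat.mul_le_mul_right _ (Nat.sub_le _ _)
    exact Nat.le_of_mul_le_mul_left (h4.trans h5) (by omega)
  set k : ℕ → ℕ := fun n => n - N * r n with hkdef
  have hqk : ∀ n, n ≤ q * k n := fun n => by
    have h4 := hNr n
    have h5 : q * k n + q * (N * r n) = q * n := by
      rw [← mul_add, hkdef]; simp only; rw [Nat.sub_add_cancel (hle n)]
    have h6 : (q - 1) * n + n = q * n := by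
      obtain ⟨p, rfl⟩ : ∃ p, q = p + 1 := ⟨q - 1, by omega⟩
      simp; ring
    omega
  have hk1 : ∀ n ≥ 1, 1 ≤ k n := fun n hn => by
    have := hqk n
    by_contra h0
    rw [show k n = 0 by omega] at this
    omega
  have hk : Tendsto k atTop atTop := by
    refine tendsto_atTop.2 fun c => ?_
    filter_upwards [eventually_ge_atTop (q * c)] with n hn
    exact Nat.le_of_mul_le_mul_left (hn.trans (hqk n)) (by omega)
  have hr1 : ∀ᶠ n in atTop, 1 ≤ r n := by
    filter_upwards [eventually_ge_atTop (q * N)] with n hn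
    exact Nat.mul_pos (by omega) (Nat.div_pos hn hqN)
  have hres : ∀ k ≥ 1, CondE b ρ Θ ((T k).residual b ρ Θ S hf) := fun k hk =>
    CondE.residual hρ hk (hT k hk) hS hf
  -- While `n` is too small for a single group, the preliminary estimator on all copies is used; it
  -- satisfies (E), and the limits do not see it.
  have hex : ∀ n, ∃ F : Estimator ι n m, 1 ≤ n → CondE b ρ Θ F ∧
      (1 ≤ r n → ∀ x ∈ Θ,
        (∀ i, F.mean b (ρ x) i = ((T (k n)).residual b ρ Θ S hf).mean b (ρ x) i +
          S.mean b (ρ x) i) ∧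
        F.cov b (ρ x) = ((T (k n)).residual b ρ Θ S hf).cov b (ρ x) +
          (r n : ℝ)⁻¹ • S.cov b (ρ x)) := by
    intro n
    by_cases hn : 1 ≤ n
    · by_cases hr0 : 1 ≤ r n
      · obtain ⟨F, hF, h⟩ := exists_add_average hΘ hρ h1 (hk1 n hn) (hres _ (hk1 n hn)) hS hr0
          (n := n) (by rw [hkdef]; simp only; rw [Nat.sub_add_cancel (hle n)])
        exact ⟨F, fun _ => ⟨hF, fun _ => h⟩⟩
      · exact ⟨T n, fun _ => ⟨hT n hn, fun h => absurd h hr0⟩⟩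
    · exact ⟨T n, fun h => absurd h hn⟩
  choose F hF using hex
  refine ⟨F, fun x hx => ?_, fun n hn => (hF n hn).1, ?_⟩
  · obtain ⟨B, hB, hm, B₀, hB₀, hB₀1⟩ := residual_asymptotics hΘ hρ h1 h2 hu hT hD hS hf hx
    refine ⟨fun i => ((hm i).comp hk).congr' ?_, ?_⟩
    · filter_upwards [hr1, eventually_ge_atTop 1] with n hn hn1
      exact (((hF n hn1).2 hn x hx).1 i).symm
    · have hB' : ∀ n ≥ 1, HasBMatrix b ρ (F n) x ((F n).dMat b ρ x) := fun n hn =>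
        (Estimator.Tame.of_condE hΘ hρ h1 hx (hF n hn).1).hasBMatrix hΘ hρ h1 hx
      refine ⟨fun n => (F n).dMat b ρ x, hB', ?_⟩
      · have := (hB₀1.comp hk).add_const B
        rw [sub_add_cancel] at this
        refine this.congr' ?_
        filter_upwards [hr1, eventually_ge_atTop 1] with n hn hn1
        have hd : HasBMatrix b ρ (F n) x (B₀ (k n) + B) := fun i j => by
          refine ((hB₀ _ (hk1 n hn1) i j).add (hB i j)).congr_of_eventuallyEq ?_
          filter_upwards [eventually_shift_mem hΘ hx j] with t ht
          exact ((hF n hn1).2 hn _ ht).1 i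
        exact hd.unique (hB' n hn1)
  · obtain ⟨C, hC⟩ := residual_moments hΘ hρ h1 hT hD hS hf hθ hLU
    have hdiv := tendsto_natCast_div (show 1 ≤ q by omega) hN (show 1 ≤ q - 1 by omega)
    have herr : Tendsto (fun n : ℕ => (n : ℝ) • ((T (k n)).residual b ρ Θ S hf).mse b (ρ θ) 0)
        atTop (𝓝 0) := by
      refine tendsto_pi_nhds.2 fun i => tendsto_pi_nhds.2 fun j => ?_
      refine squeeze_zero_norm' ?_
        ((tendsto_const_div_atTop_nhds_zero_nat (q * |C|)).comp hk)
      filter_upwards [eventually_ge_atTop 1] with n hn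
      have hkn : (0 : ℝ) < k n := by exact_mod_cast hk1 n hn
      have hqk' : (n : ℝ) ≤ q * k n := by exact_mod_cast hqk n
      rw [Matrix.smul_apply, smul_eq_mul, norm_mul, Real.norm_natCast, Real.norm_eq_abs]
      calc (n : ℝ) * _ ≤ (q * k n) * (|C| / k n ^ 2) := by
            gcongr
            refine (hC _ (hk1 n hn) i j).trans ?_
            gcongr
            exact le_abs_self C
        _ = _ := by simp only [Function.comp_apply]; field_simp
    have := (hdiv.smul_const (S.cov b (ρ θ))).add herr
    rw [add_zero] at this
    refine this.congr' ?_
    filter_upwards [hr1, eventually_ge_atTop 1] with n hn hn1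
    obtain ⟨hE, h⟩ := hF n hn1
    obtain ⟨e1, e2⟩ := h hn θ hθ
    -- At `θ` the mean of `S` is `θ`, so the bias of `F n` is the mean of the residual. Covariance
    -- and squared bias of the residual combine to its second moments about 0, leaving the
    -- covariance of the average.
    rw [(F n).mse_eq_cov_add hρ hθ (Estimator.HasMoments.of_condE hΘ hρ h1 hE) θ,
      Estimator.mse_eq_cov_add hρ hθ
        (Estimator.HasMoments.of_condE hΘ hρ h1 (hres _ (hk1 n hn1))) 0, e2]
    simp only [e1, hLU.1, add_sub_cancel_right, PiLp.zero_apply, sub_zero, smul_add, smul_smul]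
    abel

/-- The sequence built from `S` attains `q * N / (q - 1)` times the trace of `G` against the
covariance of `S`; the factor tends to `N` as `q` grows. The index is shifted by 2 because the
construction needs `q ≥ 2`. -/
theorem CQ_le_localBound (G : Matrix (Fin m) (Fin m) ℝ) {N : ℕ} (hN : 1 ≤ N) :
    CQ b ρ Θ G θ ≤ localBound b ρ G θ N Estimator.IsFinite := by
  refine le_iInf₂ fun S hLU => le_iInf fun hS => ?_
  have key : ∀ q : ℕ, CQ b ρ Θ G θ ≤
      (((q + 2 : ℕ) * N / (q + 2 - 1 : ℕ) * (G * S.cov b (ρ θ)).trace : ℝ) : EReal) := fun q => by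
    obtain ⟨F, hu, hE, h⟩ := exists_asympUnbiased hΘ hρ h1 h2 h3 hθ hN hS hLU
      (show 2 ≤ q + 2 by omega)
    refine (iInf₂_le_of_le F hu (iInf_le _ hE)).trans (le_of_eq (Tendsto.limsup_eq ?_))
    have hc : Continuous fun M : Matrix (Fin m) (Fin m) ℝ => (((G * M).trace : ℝ) : EReal) :=
      continuous_coe_real_ereal.comp (by fun_prop)
    have := (hc.tendsto _).comp h
    simpa only [Function.comp_def, Matrix.mul_smul, Matrix.trace_smul, smul_eq_mul] using this
  refine ge_of_tendsto' (x := atTop) ((continuous_coe_real_ereal.tendsto _).comp ?_) key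
  refine Tendsto.mul_const _ ?_
  have h : Tendsto (fun q : ℕ => (N : ℝ) + N * (1 / ((q : ℝ) + 1))) atTop (𝓝 (N + N * 0)) :=
    tendsto_const_nhds.add (tendsto_one_div_add_atTop_nhds_zero_nat.const_mul _)
  simp only [mul_zero, add_zero] at h
  refine h.congr fun q => ?_
  have : (0 : ℝ) < q + 1 := by positivity
  simp only [Nat.add_one_sub_one]
  push_cast
  field_simp
  ring

/-- Finitely valued estimators satisfy (E') and approximate those with (E). For `n ≥ 1` the bound
for (E') thus lies between the asymptotic bound and the bound for (E), whose limsup is at most the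
asymptotic bound. -/
theorem tendsto_localBound {G : Matrix (Fin m) (Fin m) ℝ} (hG : G.PosSemidef) :
    Tendsto (fun n : ℕ => localBound b ρ G θ n CondE') atTop (𝓝 (CQ b ρ Θ G θ)) ∧
      Tendsto (fun n : ℕ => localBound b ρ G θ n (CondE b ρ Θ)) atTop (𝓝 (CQ b ρ Θ G θ)) := by
  have hE : ∀ n, localBound b ρ G θ n Estimator.IsFinite ≤
      localBound b ρ G θ n (CondE b ρ Θ) := fun n =>
    localBound_isFinite_le hΘ hρ h1 hθ G fun _ => Estimator.Tame.of_condE hΘ hρ h1 hθ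
  have hE' : ∀ n, localBound b ρ G θ n Estimator.IsFinite ≤ localBound b ρ G θ n CondE' := by
    refine fun n => localBound_isFinite_le hΘ hρ h1 hθ G fun E hE => ?_
    obtain ⟨s, hs, a, ha⟩ := hE
    -- The value at the data point 0 serves as a reference point in the bounded set.
    refine Estimator.Tame.of_bounded hΘ hρ h1 hθ (K := (‖E.T 0‖ + a).toNNReal) fun ω => ?_
    refine le_trans ?_ (Real.le_coe_toNNReal _)
    have := norm_sub_norm_le (E.T ω) (E.T 0)
    linarith [ha _ (hs ω) _ (hs 0)]
  have hfin : ∀ n, localBound b ρ G θ n CondE' ≤ localBound b ρ G θ n Estimator.IsFinite :=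
    fun n => le_iInf₂ fun E hLU => le_iInf fun hE => iInf₂_le_of_le E hLU (iInf_le _ hE.condE')
  have hlow : ∀ᶠ n in atTop, CQ b ρ Θ G θ ≤ localBound b ρ G θ n Estimator.IsFinite := by
    filter_upwards [eventually_ge_atTop 1] with n hn
    exact CQ_le_localBound hΘ hρ h1 h2 h3 hθ G hn
  have hup : limsup (fun n => localBound b ρ G θ n (CondE b ρ Θ)) atTop ≤ CQ b ρ Θ G θ :=
    le_iInf₂ fun E hu => le_iInf fun hE => limsup_localBound_le hΘ hρ h1 hθ h3 hG hu hE
  have hlimE : Tendsto (fun n : ℕ => localBound b ρ G θ n (CondE b ρ Θ)) atTop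
      (𝓝 (CQ b ρ Θ G θ)) :=
    tendsto_of_le_liminf_of_limsup_le
      (le_liminf_of_le (by isBoundedDefault) (hlow.mono fun n hn => hn.trans (hE n))) hup
      (by isBoundedDefault) (by isBoundedDefault)
  refine ⟨tendsto_of_tendsto_of_tendsto_of_le_of_le' tendsto_const_nhds hlimE
    (hlow.mono fun n hn => hn.trans (hE' n)) (.of_forall fun n => (hfin n).trans (hE n)), hlimE⟩

end Main

end QEst

end

theorem mainTheorem1 {ι H : Type*} [NormedAddCommGroup H] [InnerProductSpace ℂ H]
    [CompleteSpace H] [TopologicalSpace.SeparableSpace H] (b : HilbertBasis ι ℂ H)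
    {m : ℕ} (Θ : Set (EuclideanSpace ℝ (Fin m))) (hΘo : IsOpen Θ) (hΘc : Convex ℝ Θ)
    (ρ : EuclideanSpace ℝ (Fin m) → H →L[ℂ] H) (hρ : ∀ θ ∈ Θ, QEst.IsDensity b (ρ θ))
    (h1 : QEst.CondM1 b ρ Θ) (h2 : QEst.CondM2 b ρ Θ) (h3 : QEst.CondM3 b ρ Θ)
    (G : EuclideanSpace ℝ (Fin m) → Matrix (Fin m) (Fin m) ℝ)
    (hG : ∀ θ ∈ Θ, (G θ).PosSemidef) (θ : EuclideanSpace ℝ (Fin m)) (hθ : θ ∈ Θ) :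
    Tendsto (fun n : ℕ => QEst.localBound b ρ (G θ) θ n QEst.CondE') atTop
        (𝓝 (QEst.CQ b ρ Θ (G θ) θ)) ∧
      Tendsto (fun n : ℕ => QEst.localBound b ρ (G θ) θ n (QEst.CondE b ρ Θ)) atTop
        (𝓝 (QEst.CQ b ρ Θ (G θ) θ)) :=
  QEst.tendsto_localBound hΘo hρ h1 h2 h3 hθ (hG θ hθ)
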